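/- **Setting.** Let $\mathfrak q\ge 4$ be an even integer, $a>0$, and let $\mathbf h_0$ be a translation invariant operator on $L^2(\mathbb Z^3)$ whose Fourier transform $\hat{\mathbf h}_0(\mathbf p)=\sum_{\mathbf x}\mathbf h_0(\mathbf x)e^{-i\mathbf p\cdot\mathbf x}$ is entire in $\mathbf p$, invariant under $\mathbf p_\nu\to-\mathbf p_\nu$ for each $1\le\nu\le3$, nonnegative for real $\mathbf p$, strictly positive on $\mathbb R^3\setminus2\pi\mathbb Z^3$, and satisfies $\hat{\mathbf h}_0(0)=0$, $\nabla\hat{\mathbf h}_0(0)=0$ with positive definite Hessian at $0$. Let $L$ be an odd positive integer and $n\ge 0$; put $\varepsilon_j=L^{-j}$, $L_0=L^2$, $L_1=L_2=L_3=L$, $\varepsilon_{n,\nu}=L_\nu^{-n}$. Let $L_{\rm tp}$, $L_{\rm sp}$ be powers of $L$ divisible by $L^{2n}$ and $L^n$ respectively. For $0\le j\le n$ let $$\mathcal X_j^{(n-j)}=\big(\varepsilon_j^2\mathbb Z/\varepsilon_n^2L_{\rm tp}\mathbb Z\big)\times\big(\varepsilon_j\mathbb Z^3/\varepsilon_nL_{\rm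 sp}\mathbb Z^3\big),\qquad \mathcal X_n=\mathcal X_n^{(0)},$$ and let $\mathcal H_j^{(n-j)}$ be the space of complex functions on it, with $\int du=\varepsilon_j^5\sum_u$ and the real (bilinear) inner product $\langle\alpha,\beta\rangle=\int\alpha(u)\beta(u)\,du$; write $\mathcal H_n=\mathcal H_n^{(0)}$. Adjoints $^*$ are with respect to these inner products, kernels $A(u,u')$ of operators are with respect to these integrals, and $|u-u'|$ is the Euclidean length of the shortest representative of $u-u'$. For an operator $A$ on $\mathcal H_n$ and $m\ge0$ let $$\|A\|_m=\max\Big\{\sup_u\int du'\,e^{m|u-u'|}|A(u,u')|,\ \sup_{u'}\int du\,e^{m|u-u'|}|A(u,u')|\Big\}.$$ * *Averaging.* Let $q=L^{-5\mathfrak q}\,1_\square*\cdots*1_\square$ ($\mathfrak q$ factors), where $1_\square$ is the characteristic function of $\big[-\frac{L^2-1}2,\frac{L^2-1}2\big]\times\big[-\frac{L-1}2,\frac{L-1}2\big]^3$ in $\mathbb Z\times\mathbb Z^3$. For $j\ge1$ let $Q^{(j)}:\mathcal H_j^{(n-j)}\to\mathcal H_{j-1}^{(n-j+1)}$, $(Q^{(j)}\psi)(y)=\sum_{x\in\mathbb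 Z\times\mathbb Z^3}q(x)\,\psi\big(y+[(\varepsilon_j^2x_0,\varepsilon_j\mathbf x)]\big)$. Put $Q_j=Q^{(1)}\cdots Q^{(j)}:\mathcal H_j^{(n-j)}\to\mathcal H_0^{(n)}$ and $\mathfrak Q_n=a\big(1+\sum_{j=1}^{n-1}L^{-2j}Q_jQ_j^*\big)^{-1}$ on $\mathcal H_0^{(n)}$. * *Differential operator.* $D_n$ is the operator $L^{2n}\big(1-e^{-h_0}-e^{-h_0}\partial_0\big)$ on functions on $(\mathbb Z/L_{\rm tp}\mathbb Z)\times(\mathbb Z^3/L_{\rm sp}\mathbb Z^3)$, transported to $\mathcal H_n$ by the scaling $(u_0,\mathbf u)\mapsto(L^{2n}u_0,L^n\mathbf u)$; here $h_0$ is the periodization of $\mathbf h_0$, acting in the space variables, and $(\partial_0\alpha)(x)=\alpha(x+e_0)-\alpha(x)$. * *Intertwined averaging.* With $s_{\nu}(p)=\dfrac{\sin\frac12p_\nu}{\varepsilon_{n,\nu}^{-1}\sin\frac12\varepsilon_{n,\nu}p_\nu}$ (continuously extended) put $u_n=\prod_{\nu'=0}^3s_{\nu'}$, $u^{(+)}_{n,\nu}=\prod_{\nu'\ne\nu}s_{\nu'}$,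 $u^{(-)}_{n,\nu}=s_\nu\prod_{\nu'=0}^3s_{\nu'}$ and $$\zeta^{(\pm)}_{n,\nu}(k,\ell)=e^{\pm i\varepsilon_{n,\nu}(k+\ell)_\nu/2}\,e^{\mp ik_\nu/2}\cos\tfrac12\ell_\nu.$$ Momenta in the dual lattice of $\mathcal X_n$ are written $k+\ell$ with $k$ in the dual lattice of $\mathcal X_0^{(n)}$ and $\ell\in(2\pi\mathbb Z/2\pi L^{2n}\mathbb Z)\times(2\pi\mathbb Z^3/2\pi L^n\mathbb Z^3)$. With $\hat\alpha(p)=\int\alpha(u)e^{-ip\cdot u}du$, the operators $Q^{(+)}_{n,\nu}:\mathcal H_0^{(n)}\to\mathcal H_n$ and $Q^{(-)}_{n,\nu}:\mathcal H_n\to\mathcal H_0^{(n)}$, $0\le\nu\le3$, are defined by $$\widehat{Q^{(+)}_{n,\nu}\psi}(k+\ell)=\zeta^{(+)}_{n,\nu}(k,\ell)\,u^{(+)}_{n,\nu}(k+\ell)\,u_n(k+\ell)^{\mathfrak q-1}\hat\psi(k),$$ $$\widehat{Q^{(-)}_{n,\nu}\phi}(k)=\sum_\ell\zeta^{(-)}_{n,\nu}(k,\ell)\,u^{(-)}_{n,\nu}(k+\ell)\,u_n(k+\ell)^{\mathfrak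 q-1}\hat\phi(k+\ell).$$ **Proposition.** There is a constant $\Gamma_2$ depending only on $\mathfrak q$, and there are constants $\mu_{\rm up},m_3>0$ and $\Gamma_{11}$ depending only on $\mathfrak q$, $\mathbf h_0$ and $a$ (in particular independent of $n$, of $L_{\rm tp},L_{\rm sp}$, and of the odd integer $L>\Gamma_2$), such that for all odd $L>\Gamma_2$, all $n$, $L_{\rm tp}$, $L_{\rm sp}$ as above, all complex $\mu$ with $|\mu|\le\mu_{\rm up}$ and all $0\le\nu\le3$, the operators $$D_n+Q_n^*\mathfrak Q_nQ_n-\mu,\qquad D_n^*+Q^{(+)}_{n,\nu}\mathfrak Q_nQ^{(-)}_{n,\nu}-\mu,\qquad D_n+Q^{(+)}_{n,\nu}\mathfrak Q_nQ^{(-)}_{n,\nu}-\mu$$ on $\mathcal H_n$ are invertible, and their inverses $S_n(\mu)$, $S^{(+)}_{n,\nu}(\mu)$, $S^{(-)}_{n,\nu}(\mu)$, respectively, satisfy $$\|S_n(\mu)\|_{m_3},\ \|S^{(\pm)}_{n,\nu}(\mu)\|_{m_3}\le\Gamma_{11},\qquad \|S_n(\mu)-S_n(0)\|_{m_3},\ \|S^{(\pm)}_{n,\nu}(\mu)-S^{(\pm)}_{n,\nu}(0)\|_{m_3}\le|\mu|\,\Gamma_{11}.$$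 -/

import Mathlib

namespace PBS

noncomputable section

/-! ### Lattices

Fix an odd `L`, a scale `n` and exponents `t s`, and put `L_tp = L ^ (2 n + t)`, `L_sp = L ^ (n + s)`.
For `0 ≤ j ≤ n` the lattice
`X_j^(n-j) = (ε_j² ℤ / ε_n² L_tp ℤ) × (ε_j ℤ³ / ε_n L_sp ℤ³)`, `ε_j = L ^ (-j)`,
has period `L ^ t` in the time direction `0` and `L ^ s` in the space directions `1, 2, 3`.
Its points are described by their integer coordinates in units of the lattice spacing; in these
coordinates the scaling isomorphisms `(u₀, u) ↦ (L² u₀, L u)` are the identity. -/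

/-- `L_ν`: the factor `L²` in the time direction `0`, and `L` in the space directions. -/
def Ldir (L : ℕ) (ν : Fin 4) : ℕ := if ν = 0 then L ^ 2 else L

/-- The period of the torus in direction `ν`, which is also the number of points of the unit
lattice `X_0^(n)` in that direction. -/
def period (L t s : ℕ) (ν : Fin 4) : ℕ := if ν = 0 then L ^ t else L ^ s

/-- The number of points of `X_j^(n-j)` in direction `ν`. -/
def size (L t s j : ℕ) (ν : Fin 4) : ℕ := Ldir L ν ^ j * period L t s ν

instance instNeZeroLdir (L : ℕ) [NeZero L] (ν : Fin 4) : NeZero (Ldir L ν) := by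
  unfold Ldir; split_ifs <;> infer_instance

instance instNeZeroPeriod (L t s : ℕ) [NeZero L] (ν : Fin 4) : NeZero (period L t s ν) := by
  unfold period; split_ifs <;> infer_instance

instance instNeZeroSize (L t s j : ℕ) [NeZero L] (ν : Fin 4) : NeZero (size L t s j ν) := by
  unfold size; infer_instance

/-- The lattice `X_j^(n-j)`; in particular `Lat L t s n` is `X_n` and `Lat L t s 0` is the unit
lattice `X_0^(n)`. -/
abbrev Lat (L t s j : ℕ) : Type := (ν : Fin 4) → ZMod (size L t s j ν)

/-- The lattice spacing `ε_{j,ν} = L_ν ^ (-j)`. -/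
def eps (L j : ℕ) (ν : Fin 4) : ℝ := ((Ldir L ν : ℝ) ^ j)⁻¹

/-- The weight `ε_j ^ 5` of a point in the integral over `X_j^(n-j)`. -/
def weight (L j : ℕ) : ℝ := ((L : ℝ) ^ (5 * j))⁻¹

/-- A representative in `ℝ⁴` of a point of `X_j^(n-j)`. -/
def pos {L t s j : ℕ} (u : Lat L t s j) (ν : Fin 4) : ℝ := eps L j ν * ((u ν).val : ℝ)

/-- The Euclidean distance `|u - u'|` on the torus: the length of the shortest representative
of `u - u'`. -/
def latDist {L t s j : ℕ} (u u' : Lat L t s j) : ℝ :=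
  √(∑ ν, (eps L j ν * (((u ν - u' ν).valMinAbs : ℤ) : ℝ)) ^ 2)

/-! ### Operators

An operator from functions on `X_j^(n-j)` to functions on `X_k^(n-k)` is given by its matrix,
`(A α)(u) = ∑ u', A u u' * α u'`. Its kernel is taken with respect to the integral
`∫ du' = ε_j ^ 5 ∑ u'`, so it is `ε_j ^ (-5) * A u u'`. -/

/-- The kernel of an operator on functions on `X_j^(n-j)`. -/
def kernel {L t s j : ℕ} (A : Matrix (Lat L t s j) (Lat L t s j) ℂ) (u u' : Lat L t s j) : ℂ :=
  ((weight L j : ℝ) : ℂ)⁻¹ * A u u'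

/-- The exponentially weighted `ℓ¹`-`ℓ^∞` norm `‖A‖_m` of the kernel of an operator. -/
def expNorm {L t s j : ℕ} [NeZero L] (m : ℝ) (A : Matrix (Lat L t s j) (Lat L t s j) ℂ) : ℝ :=
  max (⨆ u : Lat L t s j,
        ∑ u' : Lat L t s j, weight L j * (Real.exp (m * latDist u u') * ‖kernel A u u'‖))
      (⨆ u' : Lat L t s j,
        ∑ u : Lat L t s j, weight L j * (Real.exp (m * latDist u u') * ‖kernel A u u'‖))

/-! ### Block spin averaging -/

/-- The characteristic function of the rectangle
`[-(L²-1)/2, (L²-1)/2] × [-(L-1)/2, (L-1)/2]³` in `ℤ × ℤ³`. -/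
def box (L : ℕ) (x : Fin 4 → ℤ) : ℝ := if ∀ ν, 2 * |x ν| ≤ (Ldir L ν : ℤ) - 1 then 1 else 0

/-- The `m`-fold convolution of `f` with itself (the unit mass at `0` for `m = 0`). -/
def convPow (f : (Fin 4 → ℤ) → ℝ) : ℕ → (Fin 4 → ℤ) → ℝ
  | 0 => fun x => if x = 0 then 1 else 0
  | m + 1 => fun x => ∑' y : Fin 4 → ℤ, f y * convPow f m (x - y)

/-- The averaging profile `q`. -/
def profile (L q : ℕ) (x : Fin 4 → ℤ) : ℝ := ((L : ℝ) ^ (5 * q))⁻¹ * convPow (box L) q x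

/-- The inclusion of `X_j^(n-j)` into the finer lattice `X_{j+1}^(n-j-1)`. -/
def incl {L t s j : ℕ} (y : Lat L t s j) : Lat L t s (j + 1) :=
  fun ν => ((Ldir L ν * (y ν).val : ℕ) : ZMod (size L t s (j + 1) ν))

/-- The averaging operator `Q^(j+1)` from functions on `X_{j+1}^(n-j-1)` to functions on
`X_j^(n-j)`, the scaled version of `(Q ψ)(y) = ∑ x ∈ ℤ × ℤ³, q(x) ψ(y + [x])`. -/
def Qstep (L q t s j : ℕ) : Matrix (Lat L t s j) (Lat L t s (j + 1)) ℂ :=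
  Matrix.of fun y u => ∑' x : Fin 4 → ℤ,
    if (∀ ν, incl y ν + (x ν : ZMod (size L t s (j + 1) ν)) = u ν)
      then ((profile L q x : ℝ) : ℂ) else 0

/-- `Q_j = Q^(1) ⋯ Q^(j)`, from functions on `X_j^(n-j)` to functions on `X_0^(n)`. -/
def Qn (L q t s : ℕ) [NeZero L] : (j : ℕ) → Matrix (Lat L t s 0) (Lat L t s j) ℂ
  | 0 => 1
  | j + 1 => Qn L q t s j * Qstep L q t s j

/-- The adjoint `Q_j^*` with respect to the real inner products
`⟨α, β⟩ = ε_j ^ 5 ∑ u, α u * β u` on `X_j^(n-j)` and `∑ x, α x * β x` on `X_0^(n)`. -/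
def QnStar (L q t s : ℕ) [NeZero L] (j : ℕ) : Matrix (Lat L t s j) (Lat L t s 0) ℂ :=
  ((weight L j : ℝ) : ℂ)⁻¹ • (Qn L q t s j).transpose

/-- `𝔔_n = a (1 + ∑_{j=1}^{n-1} L ^ (-2 j) Q_j Q_j^*)⁻¹`. -/
def fQ (L q t s : ℕ) [NeZero L] (a : ℝ) (n : ℕ) : Matrix (Lat L t s 0) (Lat L t s 0) ℂ :=
  (a : ℂ) • (1 + ∑ j ∈ Finset.Ico 1 n,
    ((L : ℂ) ^ (2 * j))⁻¹ • (Qn L q t s j * QnStar L q t s j))⁻¹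

/-! ### The operators intertwined with the derivatives

Momenta in the dual lattice of `X_n` are written `p = k + ℓ` where `k` runs over the dual lattice
of `X_0^(n)` and `ℓ` over the dual of the single period lattice `B_n`. -/

/-- For odd `N`, the entire function `sin (x / 2) / (N sin (x / (2 N)))`, at real `x`;
it takes the value `1` at its removable singularities. -/
def sinRatio (N : ℕ) (x : ℝ) : ℝ :=
  if Real.sin (x / (2 * N)) = 0 then 1 else Real.sin (x / 2) / (N * Real.sin (x / (2 * N)))

/-- The `ν'`-th factor `sin (p_ν' / 2) / (ε_{n,ν'}⁻¹ sin (ε_{n,ν'} p_ν' / 2))` of `u_n(p)`. -/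
def uFactor (L n : ℕ) (p : Fin 4 → ℝ) (ν' : Fin 4) : ℝ := sinRatio (Ldir L ν' ^ n) (p ν')

/-- `u_n(p)`. -/
def un (L n : ℕ) (p : Fin 4 → ℝ) : ℝ := ∏ ν', uFactor L n p ν'

/-- `u_{n,ν}^(+)(p)`. -/
def unPlus (L n : ℕ) (ν : Fin 4) (p : Fin 4 → ℝ) : ℝ :=
  ∏ ν' ∈ Finset.univ.erase ν, uFactor L n p ν'

/-- `u_{n,ν}^(-)(p)`. -/
def unMinus (L n : ℕ) (ν : Fin 4) (p : Fin 4 → ℝ) : ℝ :=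
  uFactor L n p ν * ∏ ν', uFactor L n p ν'

/-- `ζ_{n,ν}^(+)(k, ℓ)`. -/
def zetaPlus (L n : ℕ) (ν : Fin 4) (k ℓ : Fin 4 → ℝ) : ℂ :=
  Complex.exp (Complex.I * ((eps L n ν * (k ν + ℓ ν) / 2 : ℝ) : ℂ)) *
    Complex.exp (-(Complex.I * ((k ν / 2 : ℝ) : ℂ))) * ((Real.cos (ℓ ν / 2) : ℝ) : ℂ)

/-- `ζ_{n,ν}^(-)(k, ℓ)`. -/
def zetaMinus (L n : ℕ) (ν : Fin 4) (k ℓ : Fin 4 → ℝ) : ℂ :=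
  Complex.exp (Complex.I * ((k ν / 2 : ℝ) : ℂ)) *
    Complex.exp (-(Complex.I * ((eps L n ν * (k ν + ℓ ν) / 2 : ℝ) : ℂ))) *
      ((Real.cos (ℓ ν / 2) : ℝ) : ℂ)

/-- The shortest representative of the element with label `κ` of the dual lattice
`(2π / L ^ t) ℤ / 2π ℤ × ((2π / L ^ s) ℤ / 2π ℤ)³` of `X_0^(n)`. -/
def kMom {L t s : ℕ} (κ : Lat L t s 0) (ν : Fin 4) : ℝ :=
  2 * Real.pi * (((κ ν).valMinAbs : ℤ) : ℝ) / (period L t s ν : ℝ)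

/-- Labels for the dual `2π ℤ / (2π L ^ (2 n)) ℤ × (2π ℤ / (2π L ^ n) ℤ)³` of `B_n`. -/
abbrev Bdual (L n : ℕ) : Type := (ν : Fin 4) → ZMod (Ldir L ν ^ n)

/-- The shortest representative of an element of the dual of `B_n`. -/
def lMom {L n : ℕ} (l : Bdual L n) (ν : Fin 4) : ℝ :=
  2 * Real.pi * (((l ν).valMinAbs : ℤ) : ℝ)

/-- `e ^ (i p · x)`. -/
def phase (p x : Fin 4 → ℝ) : ℂ := Complex.exp (Complex.I * ((∑ ν, p ν * x ν : ℝ) : ℂ))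

/-- The volume of the torus. -/
def volume (L t s : ℕ) : ℝ := ∏ ν, (period L t s ν : ℝ)

/-- `Q_{n,ν}^(+)`, from functions on `X_0^(n)` to functions on `X_n`, determined by
`(Q_{n,ν}^(+) ψ)^(k + ℓ) = ζ^(+)(k, ℓ) u_{n,ν}^(+)(k + ℓ) u_n(k + ℓ) ^ (q - 1) ψ^(k)`.
Here `ψ^(k) = ∑ x, ψ x e ^ (-i k x)` and `φ u = volume⁻¹ ∑ p, φ^(p) e ^ (i p u)`. -/
def QnPlus (L q t s : ℕ) [NeZero L] (n : ℕ) (ν : Fin 4) :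
    Matrix (Lat L t s n) (Lat L t s 0) ℂ :=
  Matrix.of fun u x => ((volume L t s : ℝ) : ℂ)⁻¹ *
    ∑ κ : Lat L t s 0, ∑ l : Bdual L n,
      phase (kMom κ + lMom l) (pos u) *
        (zetaPlus L n ν (kMom κ) (lMom l) * ((unPlus L n ν (kMom κ + lMom l) : ℝ) : ℂ) *
          ((un L n (kMom κ + lMom l) : ℝ) : ℂ) ^ (q - 1)) *
        phase (-kMom κ) (pos x)

/-- `Q_{n,ν}^(-)`, from functions on `X_n` to functions on `X_0^(n)`, determined by
`(Q_{n,ν}^(-) φ)^(k)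
  = ∑ ℓ, ζ^(-)(k, ℓ) u_{n,ν}^(-)(k + ℓ) u_n(k + ℓ) ^ (q - 1) φ^(k + ℓ)`.
Here `φ^(p) = ε_n ^ 5 ∑ u, φ u e ^ (-i p u)` and `ψ x = volume⁻¹ ∑ k, ψ^(k) e ^ (i k x)`. -/
def QnMinus (L q t s : ℕ) [NeZero L] (n : ℕ) (ν : Fin 4) :
    Matrix (Lat L t s 0) (Lat L t s n) ℂ :=
  Matrix.of fun x u => ((volume L t s : ℝ) : ℂ)⁻¹ *
    ∑ κ : Lat L t s 0, phase (kMom κ) (pos x) *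
      ∑ l : Bdual L n,
        (zetaMinus L n ν (kMom κ) (lMom l) * ((unMinus L n ν (kMom κ + lMom l) : ℝ) : ℂ) *
          ((un L n (kMom κ + lMom l) : ℝ) : ℂ) ^ (q - 1)) *
        (((weight L n : ℝ) : ℂ) * phase (-(kMom κ + lMom l)) (pos u))

/-! ### The differential operator -/

/-- `h` is the convolution kernel of a translation invariant operator on `L²(ℤ³)`, whose Fourier
transform `hhat` has the properties required of the single particle Hamiltonian. -/
structure IsHamiltonian (h : (Fin 3 → ℤ) → ℂ) (hhat : (Fin 3 → ℂ) → ℂ) : Prop where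
  fourier : ∀ p : Fin 3 → ℝ,
    HasSum (fun x : Fin 3 → ℤ => h x * Complex.exp (-(Complex.I * ((∑ i, p i * x i : ℝ) : ℂ))))
      (hhat fun i => (p i : ℂ))
  entire : Differentiable ℂ hhat
  even : ∀ (p : Fin 3 → ℂ) (i : Fin 3), hhat (Function.update p i (-p i)) = hhat p
  real : ∀ p : Fin 3 → ℝ, (hhat fun i => (p i : ℂ)).im = 0
  nonneg : ∀ p : Fin 3 → ℝ, 0 ≤ (hhat fun i => (p i : ℂ)).re
  pos : ∀ p : Fin 3 → ℝ, (¬ ∃ z : Fin 3 → ℤ, ∀ i, p i = 2 * Real.pi * z i) →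
    0 < (hhat fun i => (p i : ℂ)).re
  zero : hhat 0 = 0
  gradient : ∀ i, fderiv ℂ hhat 0 (Pi.single i 1) = 0
  hessian : (Matrix.of fun i j : Fin 3 =>
    (fderiv ℂ (fun p => fderiv ℂ hhat p (Pi.single j 1)) 0 (Pi.single i 1)).re).PosDef

/-- The periodization of `h`, acting in the space directions on functions on the lattice `X_0`
of space-time (which is identified with `X_n` by scaling). -/
def hPer (L t s n : ℕ) (h : (Fin 3 → ℤ) → ℂ) : Matrix (Lat L t s n) (Lat L t s n) ℂ :=
  Matrix.of fun u v => if u 0 = v 0 then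
    ∑' x : Fin 3 → ℤ,
      if (∀ i : Fin 3, (x i : ZMod (size L t s n i.succ)) = u i.succ - v i.succ)
        then h x else 0
    else 0

/-- The forward time derivative `(∂₀ α)(x) = α(x + e₀) - α(x)` on `X_0`. -/
def timeDeriv (L t s n : ℕ) : Matrix (Lat L t s n) (Lat L t s n) ℂ :=
  Matrix.of fun u v => (if v = u + Pi.single 0 1 then 1 else 0) - (if v = u then 1 else 0)

/-- `D_n`, the operator `L ^ (2 n) (1 - e^{-h₀} - e^{-h₀} ∂₀)` on `X_0`, scaled to `X_n`. -/
def Dn (L t s : ℕ) [NeZero L] (h : (Fin 3 → ℤ) → ℂ) (n : ℕ) :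
    Matrix (Lat L t s n) (Lat L t s n) ℂ :=
  ((L : ℂ) ^ (2 * n)) •
    (1 - NormedSpace.exp (-hPer L t s n h)
      - NormedSpace.exp (-hPer L t s n h) * timeDeriv L t s n)

/-! ### The operators whose inverses are the Green's functions -/

/-- `D_n + Q_n^* 𝔔_n Q_n - μ`. -/
def K (L q t s : ℕ) [NeZero L] (a : ℝ) (h : (Fin 3 → ℤ) → ℂ) (n : ℕ) (μ : ℂ) :
    Matrix (Lat L t s n) (Lat L t s n) ℂ :=
  Dn L t s h n + QnStar L q t s n * fQ L q t s a n * Qn L q t s n - μ • 1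

/-- `D_n^* + Q_{n,ν}^(+) 𝔔_n Q_{n,ν}^(-) - μ`, with the adjoint with respect to the real inner
product. -/
def KPlus (L q t s : ℕ) [NeZero L] (a : ℝ) (h : (Fin 3 → ℤ) → ℂ) (n : ℕ) (ν : Fin 4) (μ : ℂ) :
    Matrix (Lat L t s n) (Lat L t s n) ℂ :=
  (Dn L t s h n).transpose + QnPlus L q t s n ν * fQ L q t s a n * QnMinus L q t s n ν - μ • 1

/-- `D_n + Q_{n,ν}^(+) 𝔔_n Q_{n,ν}^(-) - μ`. -/
def KMinus (L q t s : ℕ) [NeZero L] (a : ℝ) (h : (Fin 3 → ℤ) → ℂ) (n : ℕ) (ν : Fin 4) (μ : ℂ) :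
    Matrix (Lat L t s n) (Lat L t s n) ℂ :=
  Dn L t s h n + QnPlus L q t s n ν * fQ L q t s a n * QnMinus L q t s n ν - μ • 1

end

end PBS

/-! The difficulty is uniformity in n, in the periods and in L: the operator D (which is D_n or its
transpose) has norm of order L^(2n), so a direct perturbation argument is useless. Put B = Q⁺ 𝔔_n Q⁻
and precondition with the resolvent R = (1 + D)⁻¹. Then R (D + B) = 1 - E with E = R - R B, hence (D
+ B)⁻¹ = (1 - E)⁻¹ R, and only operators with uniformly decaying kernels remain.

The inverse of 1 - E is controlled by `exists_expBd_inv_one_sub` from three facts: the exponentially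
weighted row and column sums of E are bounded, E³ has a bounded, exponentially decaying density with
respect to the lattice volume, and 1 - E is bounded below on ℓ². Conjugation with exp(m' d(·, v))
for small m' changes E little in operator norm, so the lower bound survives in weighted spaces
(Combes–Thomas). In (1 - E)⁻¹ = ∑_{j<6} E^j + E³ (1 - E)⁻¹ E³ the last term is sandwiched between
two densities, which turns the weighted ℓ² bound into a pointwise one. The same lemma on the unit
lattice bounds 𝔔_n.

Density of R (`IsHamiltonian.exists_resolv_bounds`): with η = L^(-2n) and ρ = e^{-h₀}(1 + ∂₀) one
has D_n = (1 - ρ)/η and R = ∑_j η (1 + η)^(-j-1) ρ^j. The kernel of ρ^j lives on one time slice,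
where it is the heat kernel at time j; a contour shift in momentum space gives its decay. By power
counting R³ is the first power with a bounded density.

Density of B (`exists_ptBd_averaging`): the averaging operators are restrictions to the unit lattice
of products of a translation and window averages, and a single full window already has a bounded
density.

Lower bound (`exists_l2_lower`): the Fourier transform splits D + B into fibres over k. Each fibre
is a diagonal matrix with nonnegative real parts plus a rank one matrix. Diagonal entries with ℓ ≠ 0
stay away from 0; the entry ℓ = 0 may vanish, but there the rank one part contributes a positive
multiple of u_n(k)^(2q), which is bounded below on the Brillouin zone. A Schur complement finishes.
The phases ζ^(±) have modulus 1 and cancel, and u⁺ u⁻ = u_n², so all three operators fit the common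
structure `SymPair`. Finally μ is restored by a Neumann argument. -/

namespace PBS

/-! ### Weighted kernel bounds for matrices -/

section Bounds

variable {X Y Z : Type*} [Fintype X] [Fintype Y] [Fintype Z]

/-- The exponentially weighted row sums of `A` are at most `C`. -/
def RowBd (d : X → Y → ℝ) (m C : ℝ) (A : Matrix X Y ℂ) : Prop :=
  ∀ u, ∑ v, Real.exp (m * d u v) * ‖A u v‖ ≤ C

/-- The exponentially weighted row and column sums of `A` are at most `C`. -/
structure ExpBd (d : X → Y → ℝ) (m C : ℝ) (A : Matrix X Y ℂ) : Prop where
  row : RowBd d m C A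
  col : RowBd (fun v u => d u v) m C A.transpose

/-- The entries of `A` are at most `C * exp (-m d)`. -/
def PtBd (d : X → Y → ℝ) (m C : ℝ) (A : Matrix X Y ℂ) : Prop :=
  ∀ u v, ‖A u v‖ ≤ C * Real.exp (-(m * d u v))

theorem RowBd.mul {d : X → Y → ℝ} {d' : Y → Z → ℝ} {d'' : X → Z → ℝ} {m C C' : ℝ}
    (hm : 0 ≤ m) (hC' : 0 ≤ C') (ht : ∀ u v w, d'' u w ≤ d u v + d' v w)
    {A : Matrix X Y ℂ} {B : Matrix Y Z ℂ} (hA : RowBd d m C A) (hB : RowBd d' m C' B) :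
    RowBd d'' m (C * C') (A * B) := by
  intro u
  calc ∑ w, Real.exp (m * d'' u w) * ‖(A * B) u w‖
      ≤ ∑ w, ∑ v, Real.exp (m * d u v) * ‖A u v‖ * (Real.exp (m * d' v w) * ‖B v w‖) := by
        refine Finset.sum_le_sum fun w _ => ?_
        rw [Matrix.mul_apply]
        calc _ ≤ Real.exp (m * d'' u w) * ∑ v, ‖A u v * B v w‖ := by
              gcongr; exact norm_sum_le _ _
          _ ≤ _ := by
              rw [Finset.mul_sum]
              refine Finset.sum_le_sum fun v _ => ?_
              have h : Real.exp (m * d'' u w) ≤ Real.exp (m * d u v) * Real.exp (m * d' v w) := by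
                rw [← Real.exp_add, ← mul_add]
                exact Real.exp_le_exp.2 (mul_le_mul_of_nonneg_left (ht u v w) hm)
              rw [norm_mul]
              calc _ ≤ Real.exp (m * d u v) * Real.exp (m * d' v w) * (‖A u v‖ * ‖B v w‖) := by
                    gcongr
                _ = _ := by ring
    _ = ∑ v, Real.exp (m * d u v) * ‖A u v‖ * ∑ w, (Real.exp (m * d' v w) * ‖B v w‖) := by
        rw [Finset.sum_comm]; simp_rw [Finset.mul_sum]
    _ ≤ ∑ v, Real.exp (m * d u v) * ‖A u v‖ * C' := by
        gcongr with v; exact hB v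
    _ ≤ C * C' := by
        rw [← Finset.sum_mul]; gcongr; exact hA u

theorem ExpBd.mul {d : X → Y → ℝ} {d' : Y → Z → ℝ} {d'' : X → Z → ℝ} {m C C' : ℝ}
    (hm : 0 ≤ m) (hC : 0 ≤ C) (hC' : 0 ≤ C') (ht : ∀ u v w, d'' u w ≤ d u v + d' v w)
    {A : Matrix X Y ℂ} {B : Matrix Y Z ℂ} (hA : ExpBd d m C A) (hB : ExpBd d' m C' B) :
    ExpBd d'' m (C * C') (A * B) := by
  refine ⟨hA.row.mul hm hC' ht hB.row, ?_⟩
  rw [Matrix.transpose_mul, mul_comm]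
  exact hB.col.mul hm hC (fun w v u => by linarith [ht u v w]) hA.col

theorem RowBd.mono {d : X → Y → ℝ} {m m' C C' : ℝ} (hm : m' ≤ m) (hC : C ≤ C')
    (hd : ∀ u v, 0 ≤ d u v) {A : Matrix X Y ℂ} (hA : RowBd d m C A) : RowBd d m' C' A :=
  fun u => le_trans (Finset.sum_le_sum fun v _ => by
    gcongr
    exact hd u v) ((hA u).trans hC)

theorem ExpBd.mono {d : X → Y → ℝ} {m m' C C' : ℝ} (hm : m' ≤ m) (hC : C ≤ C')
    (hd : ∀ u v, 0 ≤ d u v) {A : Matrix X Y ℂ} (hA : ExpBd d m C A) : ExpBd d m' C' A :=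
  ⟨hA.row.mono hm hC hd, hA.col.mono hm hC fun v u => hd u v⟩

theorem RowBd.add {d : X → Y → ℝ} {m C C' : ℝ} {A B : Matrix X Y ℂ}
    (hA : RowBd d m C A) (hB : RowBd d m C' B) : RowBd d m (C + C') (A + B) := by
  intro u
  refine le_trans ?_ (add_le_add (hA u) (hB u))
  rw [← Finset.sum_add_distrib]
  refine Finset.sum_le_sum fun v _ => ?_
  rw [← mul_add]
  gcongr
  exact norm_add_le _ _

theorem ExpBd.add {d : X → Y → ℝ} {m C C' : ℝ} {A B : Matrix X Y ℂ}
    (hA : ExpBd d m C A) (hB : ExpBd d m C' B) : ExpBd d m (C + C') (A + B) :=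
  ⟨hA.row.add hB.row, by rw [Matrix.transpose_add]; exact hA.col.add hB.col⟩

theorem ExpBd.smul {d : X → Y → ℝ} {m C : ℝ} (c : ℂ) {A : Matrix X Y ℂ}
    (hA : ExpBd d m C A) : ExpBd d m (‖c‖ * C) (c • A) := by
  constructor <;> intro u
  · simp only [Matrix.smul_apply, norm_smul, mul_left_comm _ ‖c‖, ← Finset.mul_sum]
    gcongr; exact hA.row u
  · simp only [Matrix.transpose_smul, Matrix.smul_apply, norm_smul, mul_left_comm _ ‖c‖,
      ← Finset.mul_sum]
    gcongr; exact hA.col u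

theorem ExpBd.neg {d : X → Y → ℝ} {m C : ℝ} {A : Matrix X Y ℂ}
    (hA : ExpBd d m C A) : ExpBd d m C (-A) := by
  simpa using hA.smul (-1)

theorem ExpBd.sub {d : X → Y → ℝ} {m C C' : ℝ} {A B : Matrix X Y ℂ}
    (hA : ExpBd d m C A) (hB : ExpBd d m C' B) : ExpBd d m (C + C') (A - B) := by
  rw [sub_eq_add_neg]; exact hA.add hB.neg

theorem ExpBd.sum {ι : Type*} (s : Finset ι) {d : X → Y → ℝ} {m : ℝ} {C : ι → ℝ}
    {A : ι → Matrix X Y ℂ} (hA : ∀ i ∈ s, ExpBd d m (C i) (A i)) :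
    ExpBd d m (∑ i ∈ s, C i) (∑ i ∈ s, A i) := by
  classical
  induction s using Finset.induction_on with
  | empty => constructor <;> intro u <;> simp
  | insert a s ha ih =>
    rw [Finset.sum_insert ha, Finset.sum_insert ha]
    exact (hA a (by simp)).add (ih fun i hi => hA i (by simp [hi]))

theorem ExpBd.transpose {d : X → X → ℝ} (hs : ∀ u v, d u v = d v u) {m C : ℝ}
    {A : Matrix X X ℂ} (hA : ExpBd d m C A) : ExpBd d m C A.transpose := by
  have h : (fun v u => d u v) = d := by ext u v; exact hs v u
  exact ⟨by simpa only [h] using hA.col, by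
    rw [Matrix.transpose_transpose]; simpa only [h] using hA.row⟩

theorem ExpBd.nonneg [Nonempty X] {d : X → Y → ℝ} {m C : ℝ} {A : Matrix X Y ℂ}
    (hA : ExpBd d m C A) : 0 ≤ C :=
  le_trans (Finset.sum_nonneg fun _ _ => by positivity) (hA.row (Classical.arbitrary X))

/-- A distance function in the sense needed here: a finite pseudometric. -/
structure IsDist (d : X → X → ℝ) : Prop where
  self : ∀ u, d u u = 0
  symm : ∀ u v, d u v = d v u
  tri : ∀ u v w, d u w ≤ d u v + d v w

theorem IsDist.nonneg {d : X → X → ℝ} (hd : IsDist d) (u v : X) : 0 ≤ d u v := by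
  have := hd.tri u v u
  rw [hd.self, hd.symm v u] at this
  linarith

theorem ExpBd.one [DecidableEq X] {d : X → X → ℝ} (hd : IsDist d) (m : ℝ) :
    ExpBd d m 1 (1 : Matrix X X ℂ) := by
  constructor <;> intro u <;>
  · simp only [Matrix.transpose_one, Matrix.one_apply]
    rw [Finset.sum_eq_single u]
    · simp [hd.self]
    · intro b _ hb; simp [hb.symm]
    · simp

theorem ExpBd.pow [DecidableEq X] {d : X → X → ℝ} (hd : IsDist d) {m C : ℝ} (hm : 0 ≤ m)
    (hC : 0 ≤ C) {A : Matrix X X ℂ} (hA : ExpBd d m C A) (k : ℕ) : ExpBd d m (C ^ k) (A ^ k) := by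
  induction k with
  | zero => simpa using ExpBd.one hd m
  | succ k ih => rw [pow_succ, pow_succ]; exact ih.mul hm (by positivity) hC hd.tri hA

theorem PtBd.mono {d : X → Y → ℝ} {m m' C C' : ℝ} (hm : m' ≤ m) (hC : C ≤ C') (hC0 : 0 ≤ C)
    (hd : ∀ u v, 0 ≤ d u v) {A : Matrix X Y ℂ} (hA : PtBd d m C A) : PtBd d m' C' A :=
  fun u v => (hA u v).trans (by
    have := hd u v
    have := hC0.trans hC
    gcongr)

theorem PtBd.sub {d : X → Y → ℝ} {m C C' : ℝ} {A B : Matrix X Y ℂ}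
    (hA : PtBd d m C A) (hB : PtBd d m C' B) : PtBd d m (C + C') (A - B) := fun u v => by
  rw [add_mul]; exact (norm_sub_le _ _).trans (add_le_add (hA u v) (hB u v))

theorem PtBd.smul {d : X → Y → ℝ} {m C : ℝ} (c : ℂ) {A : Matrix X Y ℂ}
    (hA : PtBd d m C A) : PtBd d m (‖c‖ * C) (c • A) := fun u v => by
  rw [Matrix.smul_apply, norm_smul, mul_assoc]; gcongr; exact hA u v

theorem PtBd.sum {ι : Type*} (s : Finset ι) {d : X → Y → ℝ} {m : ℝ} {C : ι → ℝ}
    {A : ι → Matrix X Y ℂ} (hA : ∀ i ∈ s, PtBd d m (C i) (A i)) :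
    PtBd d m (∑ i ∈ s, C i) (∑ i ∈ s, A i) := fun u v => by
  rw [Matrix.sum_apply, Finset.sum_mul]
  exact (norm_sum_le _ _).trans (Finset.sum_le_sum fun i hi => hA i hi u v)

theorem PtBd.transpose {d : X → Y → ℝ} {m C : ℝ} {A : Matrix X Y ℂ}
    (hA : PtBd d m C A) : PtBd (fun v u => d u v) m C A.transpose := fun u v => hA v u

/-- In a product only one factor needs a density: summation against bounded weighted rows preserves
a pointwise bound. This is how densities propagate through all the products below. -/
theorem PtBd.rowBd_mul {d : X → Y → ℝ} {d' : Y → Z → ℝ} {d'' : X → Z → ℝ} {m C C' : ℝ}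
    (hm : 0 ≤ m) (hC' : 0 ≤ C') (ht : ∀ u v w, d'' u w ≤ d u v + d' v w)
    {A : Matrix X Y ℂ} {B : Matrix Y Z ℂ} (hA : RowBd d m C A) (hB : PtBd d' m C' B) :
    PtBd d'' m (C * C') (A * B) := by
  intro u w
  rw [Matrix.mul_apply]
  calc ‖∑ v, A u v * B v w‖ ≤ ∑ v, ‖A u v‖ * ‖B v w‖ := by
        refine (norm_sum_le _ _).trans (le_of_eq ?_); simp
    _ ≤ ∑ v, Real.exp (m * d u v) * ‖A u v‖ * (C' * Real.exp (-(m * d'' u w))) := by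
        refine Finset.sum_le_sum fun v _ => ?_
        have h : Real.exp (-(m * d' v w)) ≤ Real.exp (m * d u v) * Real.exp (-(m * d'' u w)) := by
          rw [← Real.exp_add]
          refine Real.exp_le_exp.2 ?_
          nlinarith [mul_le_mul_of_nonneg_left (ht u v w) hm]
        calc _ ≤ ‖A u v‖ * (C' * Real.exp (-(m * d' v w))) := by gcongr; exact hB v w
          _ ≤ ‖A u v‖ * (C' * (Real.exp (m * d u v) * Real.exp (-(m * d'' u w)))) := by gcongr
          _ = _ := by ring
    _ ≤ C * C' * Real.exp (-(m * d'' u w)) := by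
        rw [← Finset.sum_mul, mul_assoc]; gcongr; exact hA u

theorem PtBd.mul_expBd {d : X → Y → ℝ} {d' : Y → Z → ℝ} {d'' : X → Z → ℝ} {m C C' : ℝ}
    (hm : 0 ≤ m) (hC : 0 ≤ C) (ht : ∀ u v w, d'' u w ≤ d u v + d' v w)
    {A : Matrix X Y ℂ} {B : Matrix Y Z ℂ} (hA : PtBd d m C A) (hB : ExpBd d' m C' B) :
    PtBd d'' m (C * C') (A * B) := by
  have := PtBd.rowBd_mul (d'' := fun w u => d'' u w) hm hC
    (fun w v u => by linarith [ht u v w]) hB.col hA.transpose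
  rw [← Matrix.transpose_mul, mul_comm] at this
  exact this.transpose

/-- The part s of the decay rate m + s is spent on making the volume sum finite; the rate m is left
for the weight. -/
theorem PtBd.rowBd {d : X → Y → ℝ} {m s wt C V : ℝ} (hC : 0 ≤ C) {A : Matrix X Y ℂ}
    (hA : PtBd d (m + s) (C * wt) A) (hV : ∀ u, ∑ v, wt * Real.exp (-(s * d u v)) ≤ V) :
    RowBd d m (C * V) A := by
  intro u
  calc _ ≤ ∑ v, C * (wt * Real.exp (-(s * d u v))) := by
        refine Finset.sum_le_sum fun v _ => ?_
        calc _ ≤ Real.exp (m * d u v) * (C * wt * Real.exp (-((m + s) * d u v))) := by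
              gcongr; exact hA u v
          _ = C * wt * (Real.exp (m * d u v) * Real.exp (-((m + s) * d u v))) := by ring
          _ = _ := by rw [← Real.exp_add, mul_assoc]; congr 3; ring
    _ ≤ C * V := by rw [← Finset.mul_sum]; gcongr; exact hV u

theorem PtBd.expBd {d : X → X → ℝ} (hs : ∀ u v, d u v = d v u) {m s wt C V : ℝ} (hC : 0 ≤ C)
    {A : Matrix X X ℂ} (hA : PtBd d (m + s) (C * wt) A)
    (hV : ∀ u, ∑ v, wt * Real.exp (-(s * d u v)) ≤ V) : ExpBd d m (C * V) A :=
  ⟨hA.rowBd hC hV, hA.transpose.rowBd hC fun u => by simpa only [hs u] using hV u⟩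

end Bounds

/-! ### The `ℓ²` norm -/

section L2

variable {X Y : Type*} [Fintype X] [Fintype Y]

/-- The `ℓ²` norm of a function on a finite type. -/
noncomputable def l2 (x : X → ℂ) : ℝ := ‖(WithLp.toLp 2 x : EuclideanSpace ℂ X)‖

theorem l2_sq (x : X → ℂ) : l2 x ^ 2 = ∑ i, ‖x i‖ ^ 2 := by
  simp [l2, EuclideanSpace.norm_sq_eq]

theorem l2_nonneg (x : X → ℂ) : 0 ≤ l2 x := norm_nonneg _

theorem l2_add_le (x y : X → ℂ) : l2 (x + y) ≤ l2 x + l2 y := norm_add_le _ _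

theorem l2_sub_le (x y : X → ℂ) : l2 (x - y) ≤ l2 x + l2 y := norm_sub_le _ _

theorem l2_eq_zero {x : X → ℂ} (h : l2 x = 0) : x = 0 := by
  simpa [l2] using h

theorem l2_le_iff {x : X → ℂ} {c : ℝ} (hc : 0 ≤ c) : l2 x ≤ c ↔ ∑ i, ‖x i‖ ^ 2 ≤ c ^ 2 := by
  rw [← l2_sq, sq_le_sq₀ (l2_nonneg x) hc]

theorem norm_le_l2 (x : X → ℂ) (i : X) : ‖x i‖ ≤ l2 x := by
  refine le_of_sq_le_sq ?_ (l2_nonneg x)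
  rw [l2_sq]
  exact Finset.single_le_sum (f := fun i => ‖x i‖ ^ 2) (fun _ _ => by positivity)
    (Finset.mem_univ i)

theorem norm_sum_mul_le_l2 (x y : X → ℂ) : ‖∑ i, x i * y i‖ ≤ l2 x * l2 y := by
  refine (norm_sum_le _ _).trans ?_
  refine le_of_sq_le_sq ?_ (mul_nonneg (l2_nonneg x) (l2_nonneg y))
  rw [mul_pow, l2_sq, l2_sq]
  simpa using Finset.sum_mul_sq_le_sq_mul_sq Finset.univ (fun i => ‖x i‖) (fun i => ‖y i‖)

theorem l2_mono {x y : X → ℂ} (h : ∀ i, ‖x i‖ ≤ ‖y i‖) : l2 x ≤ l2 y := by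
  rw [l2_le_iff (l2_nonneg y), l2_sq]
  gcongr with i
  exact h i

/-- Schur's test. -/
theorem l2_mulVec_le {A : Matrix X Y ℂ} {C : ℝ} (hC : 0 ≤ C) (hr : ∀ u, ∑ v, ‖A u v‖ ≤ C)
    (hc : ∀ v, ∑ u, ‖A u v‖ ≤ C) (x : Y → ℂ) : l2 (A.mulVec x) ≤ C * l2 x := by
  rw [l2_le_iff (mul_nonneg hC (l2_nonneg x)), mul_pow, l2_sq]
  calc ∑ u, ‖A.mulVec x u‖ ^ 2 ≤ ∑ u, C * ∑ v, ‖A u v‖ * ‖x v‖ ^ 2 := by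
        refine Finset.sum_le_sum fun u _ => ?_
        calc ‖A.mulVec x u‖ ^ 2 ≤ (∑ v, ‖A u v‖ * ‖x v‖) ^ 2 := by
              gcongr
              refine (norm_sum_le _ _).trans (le_of_eq ?_); simp
          _ = (∑ v, √‖A u v‖ * (√‖A u v‖ * ‖x v‖)) ^ 2 := by
              congr 2 with v
              rw [← mul_assoc, Real.mul_self_sqrt (norm_nonneg _)]
          _ ≤ (∑ v, √‖A u v‖ ^ 2) * ∑ v, (√‖A u v‖ * ‖x v‖) ^ 2 :=
              Finset.sum_mul_sq_le_sq_mul_sq _ _ _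
          _ = (∑ v, ‖A u v‖) * ∑ v, ‖A u v‖ * ‖x v‖ ^ 2 := by
              simp_rw [mul_pow, Real.sq_sqrt (norm_nonneg _)]
          _ ≤ _ := by gcongr; exact hr u
    _ = C * ∑ v, (∑ u, ‖A u v‖) * ‖x v‖ ^ 2 := by
        rw [← Finset.mul_sum, Finset.sum_comm]; simp_rw [Finset.sum_mul]
    _ ≤ C * ∑ v, C * ‖x v‖ ^ 2 := by gcongr with v; exact hc v
    _ = _ := by rw [← Finset.mul_sum]; ring

theorem ExpBd.l2_mulVec_le {d : X → Y → ℝ} {m C : ℝ} (hm : 0 ≤ m) (hC : 0 ≤ C)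
    (hd : ∀ u v, 0 ≤ d u v) {A : Matrix X Y ℂ} (hA : ExpBd d m C A) (x : Y → ℂ) :
    l2 (A.mulVec x) ≤ C * l2 x := by
  refine PBS.l2_mulVec_le hC (fun u => ?_) (fun v => ?_) x
  · simpa using (hA.mono hm le_rfl hd).row u
  · simpa using (hA.mono hm le_rfl hd).col v

/-- A square matrix is invertible as soon as it is injective, and the lower bound forces a trivial
kernel. -/
theorem isUnit_of_l2_lower [DecidableEq X] {A : Matrix X X ℂ} {c : ℝ} (hc : 0 < c)
    (h : ∀ x, c * l2 x ≤ l2 (A.mulVec x)) : IsUnit A := by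
  rw [← Matrix.mulVec_injective_iff_isUnit]
  refine (injective_iff_map_eq_zero (Matrix.mulVecLin A)).2 fun x hx => ?_
  have h1 := h x
  rw [Matrix.mulVecLin_apply] at hx
  rw [hx] at h1
  have : l2 (0 : X → ℂ) = 0 := by simp [l2]
  rw [this] at h1
  exact l2_eq_zero (le_antisymm (by nlinarith [l2_nonneg x]) (l2_nonneg x))

end L2

/-! ### Inverses with exponentially decaying kernels -/

section Inverse

variable {X : Type*} [Fintype X] [DecidableEq X]

/-- At a point where r is maximal the sum is at most half of the maximum and can be absorbed on the
left. -/
theorem exists_bound_of_absorb [Nonempty X] (r : X → ℝ) (A : X → X → ℝ)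
    (hA : ∀ u v, 0 ≤ A u v) (hA' : ∀ u, ∑ v, A u v ≤ 1 / 2)
    (h : ∀ u, r u ≤ 1 + ∑ v, A u v * r v) (u : X) : r u ≤ 2 := by
  obtain ⟨w, hw⟩ := Finite.exists_max r
  by_contra hu
  push Not at hu
  have h0 : 0 ≤ r w := by linarith [hw u]
  have h1 : ∑ v, A w v * r v ≤ 1 / 2 * r w := by
    calc _ ≤ ∑ v, A w v * r w := Finset.sum_le_sum fun v _ =>
          mul_le_mul_of_nonneg_left (hw v) (hA w v)
      _ = (∑ v, A w v) * r w := by rw [Finset.sum_mul]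
      _ ≤ _ := by gcongr; exact hA' w
  linarith [h w, hw u]

/-- By the triangle inequality the weighted row sums of G satisfy the hypothesis of
`exists_bound_of_absorb`. This replaces the convergence of a Neumann series by an a priori estimate.
-/
theorem rowBd_of_eq_one_add_mul {d : X → X → ℝ} (hd : IsDist d) {m : ℝ} (hm : 0 ≤ m)
    {A G : Matrix X X ℂ} (hA : RowBd d m (1 / 2) A) (hG : G = 1 + A * G) : RowBd d m 2 G := by
  intro u
  have : Nonempty X := ⟨u⟩
  refine exists_bound_of_absorb (fun u => ∑ v, Real.exp (m * d u v) * ‖G u v‖)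
    (fun u v => Real.exp (m * d u v) * ‖A u v‖) (fun _ _ => by positivity) hA (fun u => ?_) u
  conv_lhs => rw [hG]
  have h1 := (ExpBd.one hd m).row u
  calc _ ≤ ∑ w, (Real.exp (m * d u w) * ‖(1 : Matrix X X ℂ) u w‖ +
        ∑ v, Real.exp (m * d u v) * ‖A u v‖ * (Real.exp (m * d v w) * ‖G v w‖)) := by
        refine Finset.sum_le_sum fun w _ => ?_
        calc _ ≤ Real.exp (m * d u w) * (‖(1 : Matrix X X ℂ) u w‖ + ‖(A * G) u w‖) := by
              gcongr; exact norm_add_le _ _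
          _ ≤ _ := by
              rw [mul_add]
              gcongr
              rw [Matrix.mul_apply]
              calc _ ≤ Real.exp (m * d u w) * ∑ v, ‖A u v * G v w‖ := by
                    gcongr; exact norm_sum_le _ _
                _ ≤ _ := by
                    rw [Finset.mul_sum]
                    refine Finset.sum_le_sum fun v _ => ?_
                    have h : Real.exp (m * d u w) ≤
                        Real.exp (m * d u v) * Real.exp (m * d v w) := by
                      rw [← Real.exp_add, ← mul_add]
                      exact Real.exp_le_exp.2 (mul_le_mul_of_nonneg_left (hd.tri u v w) hm)
                    rw [norm_mul]
                    calc _ ≤ Real.exp (m * d u v) * Real.exp (m * d v w) *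
                          (‖A u v‖ * ‖G v w‖) := by gcongr
                      _ = _ := by ring
    _ ≤ _ := by
        rw [Finset.sum_add_distrib, Finset.sum_comm]
        simp_rw [← Finset.mul_sum]
        gcongr

theorem ExpBd.isUnit_one_sub {d : X → X → ℝ} (hd : IsDist d) {m : ℝ} (hm : 0 ≤ m)
    {A : Matrix X X ℂ} (hA : ExpBd d m (1 / 2) A) :
    IsUnit (1 - A) ∧ ExpBd d m 2 (1 - A)⁻¹ := by
  have hu : IsUnit (1 - A) := by
    refine isUnit_of_l2_lower (c := 1 / 2) (by norm_num) fun x => ?_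
    have h1 := hA.l2_mulVec_le hm (by norm_num) hd.nonneg x
    have h2 := l2_add_le ((1 - A).mulVec x) (A.mulVec x)
    rw [← Matrix.add_mulVec, sub_add_cancel, Matrix.one_mulVec] at h2
    linarith
  refine ⟨hu, ?_⟩
  have hdet := (Matrix.isUnit_iff_isUnit_det _).1 hu
  have h1 : (1 - A)⁻¹ = 1 + A * (1 - A)⁻¹ := by
    have := Matrix.mul_nonsing_inv _ hdet
    rw [sub_mul, one_mul] at this
    exact sub_eq_iff_eq_add.1 this
  have h2 : (1 - A)⁻¹ = 1 + (1 - A)⁻¹ * A := by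
    have := Matrix.nonsing_inv_mul _ hdet
    rw [mul_sub, mul_one] at this
    exact sub_eq_iff_eq_add.1 this
  -- Rows are bounded through G = 1 + A G; the columns are the rows of the transpose, bounded
  -- through G = 1 + G A.
  refine ⟨rowBd_of_eq_one_add_mul hd hm hA.row h1, ?_⟩
  have hs : (fun v u => d u v) = d := by ext u v; exact hd.symm v u
  rw [hs]
  refine rowBd_of_eq_one_add_mul hd hm (A := A.transpose) ?_ ?_
  · have := hA.col; rwa [hs] at this
  · conv_lhs => rw [h2]
    rw [Matrix.transpose_add, Matrix.transpose_one, Matrix.transpose_mul]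

/-- A Combes–Thomas estimate for the conjugated lower bound. -/
theorem l2_lower_weighted {d : X → X → ℝ} (hd : IsDist d) {m m' C c : ℝ} (hm : 0 < m)
    (hm' : 0 ≤ m') (hmm : m' ≤ m) (hC : 0 ≤ C) (hsmall : m' / m * C ≤ c / 2)
    {E : Matrix X X ℂ} (hE : ExpBd d m C E)
    (hlow : ∀ x, c * l2 x ≤ l2 ((1 - E).mulVec x)) (v₀ : X) (x : X → ℂ) :
    c / 2 * l2 (fun u => (Real.exp (m' * d u v₀) : ℂ) * x u) ≤
      l2 (fun u => (Real.exp (m' * d u v₀) : ℂ) * (1 - E).mulVec x u) := by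
  set φ : X → ℝ := fun u => m' * d u v₀ with hφ
  set y : X → ℂ := fun u => (Real.exp (φ u) : ℂ) * x u with hy
  -- F is exp(φ) E exp(-φ) - E, so that (1 - E) y = exp(φ) (1 - E) x + F y for y = exp(φ) x. It
  -- suffices that F has norm at most c / 2.
  set F : Matrix X X ℂ := Matrix.of fun u v =>
    (Real.exp (φ u - φ v) - 1 : ℂ) * E u v with hF
  have hφd : ∀ u v, |φ u - φ v| ≤ m' * d u v := by
    intro u v
    rw [abs_le]
    constructor
    · have := mul_le_mul_of_nonneg_left (hd.tri v u v₀) hm'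
      rw [hd.symm v u] at this
      simp only [hφ]; linarith
    · have := mul_le_mul_of_nonneg_left (hd.tri u v v₀) hm'
      simp only [hφ]; linarith
  have hFb : ∀ u v, ‖F u v‖ ≤ m' / m * (Real.exp (m * d u v) * ‖E u v‖) := by
    intro u v
    have hdn := hd.nonneg u v
    rw [hF, Matrix.of_apply, norm_mul]
    have h1 : ‖(Real.exp (φ u - φ v) - 1 : ℂ)‖ ≤ m' / m * Real.exp (m * d u v) := by
      rw [← Complex.ofReal_one, ← Complex.ofReal_sub, Complex.norm_real, Real.norm_eq_abs]
      have h2 : |Real.exp (φ u - φ v) - 1| ≤ Real.exp (m' * d u v) - 1 := by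
        have := hφd u v
        rw [abs_le] at this ⊢
        have e1 : Real.exp (φ u - φ v) ≤ Real.exp (m' * d u v) := Real.exp_le_exp.2 this.2
        have e2 : Real.exp (-(m' * d u v)) ≤ Real.exp (φ u - φ v) := Real.exp_le_exp.2 this.1
        have e3 : 0 < Real.exp (m' * d u v) := Real.exp_pos _
        have e4 : 2 - Real.exp (m' * d u v) ≤ Real.exp (-(m' * d u v)) := by
          rw [Real.exp_neg]
          have : (Real.exp (m' * d u v))⁻¹ * Real.exp (m' * d u v) = 1 :=
            inv_mul_cancel₀ e3.ne'
          have hpos : 0 < (Real.exp (m' * d u v))⁻¹ := by positivity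
          nlinarith [sq_nonneg (Real.exp (m' * d u v) - 1)]
        constructor <;> linarith
      -- Convexity of exp on [0, m d] produces the small factor m' / m while the full weight exp(m
      -- d) is charged to E.
      have h3 : Real.exp (m' * d u v) - 1 ≤ m' / m * (Real.exp (m * d u v) - 1) := by
        have ht0 : 0 ≤ m' / m := by positivity
        have ht1 : m' / m ≤ 1 := (div_le_one hm).2 hmm
        have hc := convexOn_exp.2 (Set.mem_univ (m * d u v)) (Set.mem_univ 0) ht0
          (by linarith : 0 ≤ 1 - m' / m) (by ring)
        simp only [smul_eq_mul, mul_zero, add_zero, Real.exp_zero, mul_one] at hc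
        have e : m' / m * (m * d u v) = m' * d u v := by field_simp
        rw [e] at hc
        linarith
      have h4 : m' / m * (Real.exp (m * d u v) - 1) ≤ m' / m * Real.exp (m * d u v) := by
        gcongr; linarith
      linarith
    calc _ ≤ m' / m * Real.exp (m * d u v) * ‖E u v‖ := by gcongr
      _ = _ := by ring
  have hF2 : l2 (F.mulVec y) ≤ m' / m * C * l2 y := by
    refine PBS.l2_mulVec_le (by positivity) (fun u => ?_) (fun v => ?_) y
    · refine (Finset.sum_le_sum fun v _ => hFb u v).trans ?_
      rw [← Finset.mul_sum]
      gcongr; exact hE.row u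
    · refine (Finset.sum_le_sum fun u _ => hFb u v).trans ?_
      rw [← Finset.mul_sum]
      gcongr; exact hE.col v
  have hkey : (1 - E).mulVec y =
      (fun u => (Real.exp (φ u) : ℂ) * (1 - E).mulVec x u) + F.mulVec y := by
    ext u
    simp only [Pi.add_apply, Matrix.sub_mulVec, Matrix.one_mulVec, Pi.sub_apply]
    have : F.mulVec y u = (Real.exp (φ u) : ℂ) * E.mulVec x u - E.mulVec y u := by
      simp only [Matrix.mulVec, dotProduct, Finset.mul_sum, ← Finset.sum_sub_distrib]
      refine Finset.sum_congr rfl fun v _ => ?_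
      have he : (Real.exp (φ u - φ v) : ℂ) * (Real.exp (φ v) : ℂ) = Real.exp (φ u) := by
        rw [← Complex.ofReal_mul, ← Real.exp_add, sub_add_cancel]
      simp only [hF, hy, Matrix.of_apply]
      rw [← he]; ring
    rw [this]
    simp only [hy]; ring
  have h1 := hlow y
  rw [hkey] at h1
  have h2 := l2_add_le (fun u => (Real.exp (φ u) : ℂ) * (1 - E).mulVec x u) (F.mulVec y)
  have h3 : m' / m * C * l2 y ≤ c / 2 * l2 y := mul_le_mul_of_nonneg_right hsmall (l2_nonneg y)
  linarith

/-- If `E` has exponential decay, `E ^ 3` has an exponentially decaying bounded density and `1 - E`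
is bounded below on `ℓ²`, then `(1 - E)⁻¹` has exponential decay, with uniform constants. -/
theorem exists_expBd_inv_one_sub {m C₁ C₂ c : ℝ} (hm : 0 < m) (hC₁ : 0 ≤ C₁) (hC₂ : 0 ≤ C₂)
    (hc : 0 < c) (V : ℝ → ℝ) : ∃ m' C : ℝ, 0 < m' ∧ m' ≤ m ∧ 0 ≤ C ∧
    ∀ {X : Type} [Fintype X] [DecidableEq X] (d : X → X → ℝ) (wt : ℝ) (E : Matrix X X ℂ),
      IsDist d → 0 < wt → (∀ s, 0 < s → ∀ u, ∑ v, wt * Real.exp (-(s * d u v)) ≤ V s) →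
      ExpBd d m C₁ E → PtBd d m (C₂ * wt) (E ^ 3) →
      (∀ x, c * l2 x ≤ l2 ((1 - E).mulVec x)) →
      IsUnit (1 - E) ∧ ExpBd d m' C (1 - E)⁻¹ := by
  -- The bound m / 2 leaves half of the decay of E³ for ℓ² sums; the second bound makes m₁ / m * C₁
  -- ≤ c / 2, as the Combes–Thomas estimate requires.
  set m₁ : ℝ := min (m / 2) (m * (c / (2 * (C₁ + 1)))) with hm₁
  have hm₁pos : 0 < m₁ := by rw [hm₁]; positivity
  have hm₁le : m₁ ≤ m / 2 := min_le_left _ _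
  have hsmall : m₁ / m * C₁ ≤ c / 2 := by
    have : m₁ / m ≤ c / (2 * (C₁ + 1)) := by
      rw [div_le_iff₀ hm, mul_comm]; exact min_le_right _ _
    calc m₁ / m * C₁ ≤ c / (2 * (C₁ + 1)) * C₁ := by gcongr
      _ ≤ c / (2 * (C₁ + 1)) * (C₁ + 1) := by gcongr; linarith
      _ = c / 2 := by field_simp
  set P : ℝ := 2 / c * C₂ ^ 2 * max (V (m / 2)) 0 with hP
  refine ⟨m₁ / 2, (∑ j ∈ Finset.range 6, C₁ ^ j) + P * max (V (m₁ / 2)) 0, by linarith,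
    by linarith, by positivity, ?_⟩
  intro X _ _ d wt E hd hwt hV hE hE3 hlow
  have hu := isUnit_of_l2_lower hc hlow
  have hdet := (Matrix.isUnit_iff_isUnit_det _).1 hu
  refine ⟨hu, ?_⟩
  set G := (1 - E)⁻¹ with hG
  have hG1 : (1 - E) * G = 1 := Matrix.mul_nonsing_inv _ hdet
  have hG2 : G * (1 - E) = 1 := Matrix.nonsing_inv_mul _ hdet
  have hGl : G = 1 + E * G := by
    rw [sub_mul, one_mul] at hG1; rw [← hG1, sub_add_cancel]
  have hGr : G = 1 + G * E := by
    rw [mul_sub, mul_one] at hG2; rw [← hG2, sub_add_cancel]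
  -- The identities G = 1 + E G = 1 + G E, each applied three times, put three factors of E on
  -- either side of G.
  have hexp : G = ∑ j ∈ Finset.range 6, E ^ j + E ^ 3 * G * E ^ 3 := by
    have a1 : E ^ 3 * G * E ^ 3 = G - ∑ j ∈ Finset.range 6, E ^ j := by
      have b1 : E ^ 3 * G = G - (1 + E + E ^ 2) := by
        have c1 : E * G = G - 1 := by conv_rhs => rw [hGl]
                                      abel
        calc E ^ 3 * G = E * (E * (E * G)) := by noncomm_ring
          _ = _ := by rw [c1, mul_sub, c1, mul_sub, mul_sub, c1]; noncomm_ring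
      have b2 : G * E ^ 3 = G - (1 + E + E ^ 2) := by
        have c1 : G * E = G - 1 := by conv_rhs => rw [hGr]
                                      abel
        calc G * E ^ 3 = ((G * E) * E) * E := by noncomm_ring
          _ = _ := by rw [c1, sub_mul, c1, sub_mul, sub_mul, c1]; noncomm_ring
      rw [b1, sub_mul, b2]
      simp only [Finset.sum_range_succ, Finset.sum_range_zero]
      noncomm_ring
    rw [a1]; abel
  have hVm : ∀ u, ∑ v, wt * Real.exp (-(m / 2 * d u v)) ≤ max (V (m / 2)) 0 :=
    fun u => (hV _ (by linarith) u).trans (le_max_left _ _)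
  -- A decaying function of size C₂ wt has ℓ² norm of order √wt: one of the two factors wt in its
  -- square is used up by the volume sum. Two such functions together give the factor wt of a
  -- density.
  have hl2 : ∀ u₀ (f : X → ℂ), (∀ u, ‖f u‖ ≤ C₂ * wt * Real.exp (-(m / 2 * d u₀ u))) →
      l2 f ≤ C₂ * √(wt * max (V (m / 2)) 0) := by
    intro u₀ f hf
    rw [l2_le_iff (by positivity), mul_pow, Real.sq_sqrt (by positivity)]
    calc ∑ u, ‖f u‖ ^ 2 ≤ ∑ u, C₂ ^ 2 * wt * (wt * Real.exp (-(m / 2 * d u₀ u))) := by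
          refine Finset.sum_le_sum fun u _ => ?_
          have h1 : Real.exp (-(m / 2 * d u₀ u)) ≤ 1 := by
            rw [Real.exp_le_one_iff]; have := hd.nonneg u₀ u
            have : 0 ≤ m / 2 * d u₀ u := by positivity
            linarith
          calc ‖f u‖ ^ 2 ≤ (C₂ * wt * Real.exp (-(m / 2 * d u₀ u))) ^ 2 := by
                gcongr; exact hf u
            _ = C₂ ^ 2 * wt * (wt * (Real.exp (-(m / 2 * d u₀ u)) *
                  Real.exp (-(m / 2 * d u₀ u)))) := by ring
            _ ≤ C₂ ^ 2 * wt * (wt * (Real.exp (-(m / 2 * d u₀ u)) * 1)) := by gcongr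
            _ = _ := by ring
      _ ≤ _ := by
          rw [← Finset.mul_sum, mul_assoc]
          gcongr
          exact hVm u₀
  have hpt : PtBd d m₁ (P * wt) (E ^ 3 * G * E ^ 3) := by
    intro u₀ v₀
    -- x is the column v₀ of G E³, so (1 - E) x is the column v₀ of E³. The weighted lower bound
    -- then estimates x, and the entry sought is the pairing of the row u₀ of E³ with x.
    set x : X → ℂ := (G * E ^ 3).mulVec (Pi.single v₀ 1) with hx
    have hx1 : (1 - E).mulVec x = fun u => (E ^ 3) u v₀ := by
      rw [hx, Matrix.mulVec_mulVec, ← mul_assoc, hG1, one_mul]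
      ext u; simp
    have hlw := l2_lower_weighted hd hm hm₁pos.le (by linarith) hC₁ hsmall hE hlow v₀ x
    rw [hx1] at hlw
    have hy := hl2 v₀ (fun u => (Real.exp (m₁ * d u v₀) : ℂ) * (E ^ 3) u v₀) (fun u => by
      rw [norm_mul, Complex.norm_real, Real.norm_eq_abs, abs_of_pos (Real.exp_pos _)]
      calc _ ≤ Real.exp (m₁ * d u v₀) * (C₂ * wt * Real.exp (-(m * d u v₀))) := by
            gcongr; exact hE3 u v₀
        _ = C₂ * wt * (Real.exp (m₁ * d u v₀) * Real.exp (-(m * d u v₀))) := by ring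
        _ ≤ _ := by
            rw [← Real.exp_add, hd.symm v₀ u]
            gcongr
            nlinarith [mul_le_mul_of_nonneg_right hm₁le (hd.nonneg u v₀)])
    have hz := hl2 u₀ (fun u => (Real.exp (m₁ * d u₀ u) : ℂ) * (E ^ 3) u₀ u) (fun u => by
      rw [norm_mul, Complex.norm_real, Real.norm_eq_abs, abs_of_pos (Real.exp_pos _)]
      calc _ ≤ Real.exp (m₁ * d u₀ u) * (C₂ * wt * Real.exp (-(m * d u₀ u))) := by
            gcongr; exact hE3 u₀ u
        _ = C₂ * wt * (Real.exp (m₁ * d u₀ u) * Real.exp (-(m * d u₀ u))) := by ring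
        _ ≤ _ := by
            rw [← Real.exp_add]
            gcongr
            nlinarith [mul_le_mul_of_nonneg_right hm₁le (hd.nonneg u₀ u)])
    have hent : (E ^ 3 * G * E ^ 3) u₀ v₀ = ∑ u, (E ^ 3) u₀ u * x u := by
      have : (E ^ 3 * G * E ^ 3) u₀ v₀ = (E ^ 3 * G * E ^ 3).mulVec (Pi.single v₀ 1) u₀ := by simp
      rw [this, mul_assoc, ← Matrix.mulVec_mulVec]
      rfl
    have hw : Real.exp (m₁ * d u₀ v₀) * ‖(E ^ 3 * G * E ^ 3) u₀ v₀‖ ≤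
        l2 (fun u => (Real.exp (m₁ * d u₀ u) : ℂ) * (E ^ 3) u₀ u) *
          l2 (fun u => (Real.exp (m₁ * d u v₀) : ℂ) * x u) := by
      set f := fun u => (Real.exp (m₁ * d u₀ u) : ℂ) * (E ^ 3) u₀ u with hf
      set g := fun u => (Real.exp (m₁ * d u v₀) : ℂ) * x u with hg
      have e1 : l2 (fun u => (‖f u‖ : ℂ)) = l2 f :=
        le_antisymm (l2_mono fun i => by simp) (l2_mono fun i => by simp)
      have e2 : l2 (fun u => (‖g u‖ : ℂ)) = l2 g :=
        le_antisymm (l2_mono fun i => by simp) (l2_mono fun i => by simp)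
      rw [← e1, ← e2]
      refine le_trans ?_ (norm_sum_mul_le_l2 _ _)
      have e3 : ‖∑ i, (‖f i‖ : ℂ) * (‖g i‖ : ℂ)‖ = ∑ i, ‖f i‖ * ‖g i‖ := by
        simp_rw [← Complex.ofReal_mul, ← Complex.ofReal_sum]
        rw [Complex.norm_real, Real.norm_eq_abs, abs_of_nonneg]
        exact Finset.sum_nonneg fun _ _ => by positivity
      rw [e3, hent]
      calc _ ≤ Real.exp (m₁ * d u₀ v₀) * ∑ u, ‖(E ^ 3) u₀ u * x u‖ := by
            gcongr; exact norm_sum_le _ _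
        _ ≤ _ := by
            rw [Finset.mul_sum]
            refine Finset.sum_le_sum fun u _ => ?_
            simp only [hf, hg, norm_mul, Complex.norm_real, Real.norm_eq_abs,
              abs_of_pos (Real.exp_pos _)]
            have h : Real.exp (m₁ * d u₀ v₀) ≤
                Real.exp (m₁ * d u₀ u) * Real.exp (m₁ * d u v₀) := by
              rw [← Real.exp_add, ← mul_add]
              exact Real.exp_le_exp.2 (mul_le_mul_of_nonneg_left (hd.tri _ _ _) hm₁pos.le)
            calc _ ≤ (Real.exp (m₁ * d u₀ u) * Real.exp (m₁ * d u v₀)) *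
                  (‖(E ^ 3) u₀ u‖ * ‖x u‖) := by gcongr
              _ = _ := by ring
    have hx2 : l2 (fun u => (Real.exp (m₁ * d u v₀) : ℂ) * x u) ≤
        2 / c * (C₂ * √(wt * max (V (m / 2)) 0)) := by
      have : c / 2 * l2 (fun u => (Real.exp (m₁ * d u v₀) : ℂ) * x u) ≤
        C₂ * √(wt * max (V (m / 2)) 0) := hlw.trans hy
      calc _ = 2 / c * (c / 2 * l2 (fun u => (Real.exp (m₁ * d u v₀) : ℂ) * x u)) := by
            field_simp
        _ ≤ _ := by gcongr
    have hfin : Real.exp (m₁ * d u₀ v₀) * ‖(E ^ 3 * G * E ^ 3) u₀ v₀‖ ≤ P * wt := by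
      refine hw.trans ((mul_le_mul hz hx2 (l2_nonneg _) (by positivity)).trans (le_of_eq ?_))
      have : √(wt * max (V (m / 2)) 0) * √(wt * max (V (m / 2)) 0) = wt * max (V (m / 2)) 0 :=
        Real.mul_self_sqrt (by positivity)
      calc _ = 2 / c * C₂ ^ 2 * (√(wt * max (V (m / 2)) 0) * √(wt * max (V (m / 2)) 0)) := by ring
        _ = _ := by rw [this, hP]; ring
    rw [Real.exp_neg, ← div_eq_mul_inv (P * wt), le_div_iff₀ (Real.exp_pos _), mul_comm]
    exact hfin
  rw [hexp]
  refine ExpBd.add ?_ ?_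
  · exact ExpBd.sum _ fun j _ => (hE.mono (by linarith) le_rfl hd.nonneg).pow hd
      (by linarith) hC₁ j
  · refine PtBd.expBd (s := m₁ / 2) hd.symm (by positivity) (wt := wt) ?_ fun u =>
      (hV _ (by linarith) u).trans (le_max_left _ _)
    rwa [add_halves]

end Inverse

end PBS


namespace PBS

/-! ### A rank one perturbation of a diagonal matrix -/

/-- The real part of S⁻¹ is Re S / |S|². -/
theorem inv_re_ge_of_one_le_re {S : ℂ} (h : 1 ≤ S.re) {M : ℝ} (hM : ‖S‖ ≤ M) :
    1 / M ^ 2 ≤ (S⁻¹).re := by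
  have h1 : 1 ≤ ‖S‖ := h.trans (Complex.re_le_norm S)
  rw [Complex.inv_re, Complex.normSq_eq_norm_sq]
  gcongr

/-- Lower bound for `diag(d) + Q w ⊗ w'`, where only the diagonal entry `d o` may be small. -/
theorem l2_le_of_diag_add_rankOne {ι : Type*} [Fintype ι] [DecidableEq ι] (o : ι) {c₀ b₀ q₁ a : ℝ}
    (hc₀ : 0 < c₀) (hb₀ : 0 < b₀) (hq₁ : 0 < q₁)
    {d w w' : ι → ℂ} {b : ι → ℝ} {Q : ℝ} (hQ : q₁ ≤ Q) (hQa : Q ≤ a) (hd : ∀ l, 0 ≤ (d l).re)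
    (hd' : ∀ l, l ≠ o → c₀ ≤ ‖d l‖) (hb : ∀ l, w l * w' l = b l) (hb0 : ∀ l, 0 ≤ b l)
    (hbo : b₀ ≤ b o) (hw : l2 w ≤ 1) (hw' : l2 w' ≤ 1) (x y : ι → ℂ)
    (hxy : ∀ l, y l = d l * x l + Q * w l * ∑ l', w' l' * x l') :
    l2 x ≤ ((1 + a / c₀) * (((1 + a / c₀) ^ 2 / (q₁ * b₀)) * (1 + a / c₀)) + (1 + a / c₀) / c₀)
      * l2 y := by
  have hQ0 : 0 < Q := hq₁.trans_le hQ
  have ha : 0 < a := hQ0.trans_le hQa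
  set c : ℂ := ∑ l', w' l' * x l' with hc
  -- The inverse of the diagonal off the exceptional index; the value 0 at o makes all sums below
  -- run over l ≠ o only.
  set dinv : ι → ℂ := fun l => if l = o then 0 else (d l)⁻¹ with hdinv
  have hdinv_norm : ∀ l, ‖dinv l‖ ≤ 1 / c₀ := by
    intro l
    by_cases hl : l = o
    · simp [hdinv, hl]; positivity
    · simp only [hdinv, hl, if_false, norm_inv]
      rw [one_div]; exact inv_anti₀ hc₀ (hd' l hl)
  have hdinv_re : ∀ l, 0 ≤ (dinv l).re := by
    intro l
    by_cases hl : l = o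
    · simp [hdinv, hl]
    · simp only [hdinv, hl, if_false, Complex.inv_re]
      exact div_nonneg (hd l) (Complex.normSq_nonneg _)
  set Y : ℂ := ∑ l, w' l * (dinv l * y l) with hY
  set σ : ℂ := ∑ l, (b l : ℂ) * dinv l with hσ
  have hl2dy : ∀ z : ι → ℂ, l2 (fun l => dinv l * z l) ≤ l2 z / c₀ := by
    intro z
    rw [l2_le_iff (div_nonneg (l2_nonneg z) hc₀.le), div_pow, l2_sq, Finset.sum_div]
    refine Finset.sum_le_sum fun l _ => ?_
    rw [norm_mul, mul_pow]
    calc _ ≤ (1 / c₀) ^ 2 * ‖z l‖ ^ 2 := by gcongr; exact hdinv_norm l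
      _ = _ := by ring
  have hYn : ‖Y‖ ≤ l2 y / c₀ := by
    refine (norm_sum_mul_le_l2 _ _).trans ?_
    calc _ ≤ 1 * (l2 y / c₀) := by
          gcongr
          · exact l2_nonneg _
          · exact hl2dy y
      _ = _ := one_mul _
  have hσn : ‖σ‖ ≤ 1 / c₀ := by
    have e : σ = ∑ l, w l * (dinv l * w' l) := by
      refine Finset.sum_congr rfl fun l _ => ?_
      rw [← hb l]; ring
    rw [e]
    refine (norm_sum_mul_le_l2 _ _).trans ?_
    calc _ ≤ 1 * (1 / c₀) := by
          gcongr
          · exact l2_nonneg _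
          · refine (hl2dy w').trans ?_
            gcongr
      _ = _ := one_mul _
  have hσre : 0 ≤ σ.re := by
    rw [hσ, Complex.re_sum]
    refine Finset.sum_nonneg fun l _ => ?_
    rw [Complex.re_ofReal_mul]
    exact mul_nonneg (hb0 l) (hdinv_re l)
  -- Solving for x l with l ≠ o and inserting the result into c gives S c = w' o * x o + Y. The real
  -- part of S is at least 1 because 1 / d l has nonnegative real part and w l * w' l ≥ 0.
  set S : ℂ := 1 + Q * σ with hS
  have hSre : 1 ≤ S.re := by
    rw [hS, Complex.add_re, Complex.one_re, Complex.re_ofReal_mul]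
    nlinarith
  have hS1 : 1 ≤ ‖S‖ := hSre.trans (Complex.re_le_norm S)
  have hS0 : S ≠ 0 := by intro h; rw [h, norm_zero] at hS1; linarith
  have hSn : ‖S‖ ≤ 1 + a / c₀ := by
    refine (norm_add_le _ _).trans ?_
    rw [norm_one, norm_mul, Complex.norm_real, Real.norm_eq_abs, abs_of_pos hQ0]
    have : Q * ‖σ‖ ≤ a * (1 / c₀) := by gcongr
    rw [mul_one_div] at this
    linarith
  have hxl : ∀ l, l ≠ o → x l = dinv l * (y l - Q * w l * c) := by
    intro l hl
    have hdl : d l ≠ 0 := by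
      intro h; have := hd' l hl; rw [h, norm_zero] at this; linarith
    simp only [hdinv, hl, if_false]
    rw [hxy l]; field_simp; ring
  have hSc : S * c = w' o * x o + Y := by
    have e1 : ∀ l, w' l * x l =
        (if l = o then w' o * x o else 0) + (w' l * (dinv l * y l) - Q * c * (b l * dinv l)) := by
      intro l
      by_cases hl : l = o
      · subst hl; simp [hdinv]
      · simp only [hl, if_false, zero_add]
        rw [hxl l hl, ← hb l]; ring
    have e2 : c = w' o * x o + (Y - Q * c * σ) := by
      conv_lhs => rw [hc, Finset.sum_congr rfl fun l _ => e1 l]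
      rw [Finset.sum_add_distrib, Finset.sum_sub_distrib, ← Finset.mul_sum]
      simp [hY, hσ]
    rw [hS]
    linear_combination e2
  have hcs : c = (w' o * x o + Y) * S⁻¹ := by
    rw [← hSc]; field_simp
  -- The Schur complement at o: eliminating c leaves the scalar equation T x o = y o - Q w o Y S⁻¹.
  -- Its coefficient has positive real part, even when d o = 0, thanks to b o.
  set T : ℂ := d o + Q * b o * S⁻¹ with hT
  have hTx : T * x o = y o - Q * w o * Y * S⁻¹ := by
    rw [hxy o, hT, hcs, ← hb o]; ring
  have hM0 : 0 < 1 + a / c₀ := by positivity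
  have hTn : q₁ * b₀ / (1 + a / c₀) ^ 2 ≤ ‖T‖ := by
    refine le_trans ?_ (Complex.re_le_norm T)
    have h1 := inv_re_ge_of_one_le_re hSre hSn
    have h2 : (Q * b o * S⁻¹ : ℂ).re = Q * b o * (S⁻¹).re := by
      rw [← Complex.ofReal_mul, Complex.re_ofReal_mul]
    rw [hT, Complex.add_re, h2]
    have h3 : q₁ * b₀ / (1 + a / c₀) ^ 2 ≤ Q * b o * (S⁻¹).re := by
      rw [← mul_one_div]
      have := hb0 o
      gcongr
    linarith [hd o]
  have hwo : ‖w o‖ ≤ 1 := (norm_le_l2 w o).trans hw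
  have hwo' : ‖w' o‖ ≤ 1 := (norm_le_l2 w' o).trans hw'
  have hSi : ‖S⁻¹‖ ≤ 1 := by rw [norm_inv]; exact inv_le_one_of_one_le₀ hS1
  have hy0 := l2_nonneg y
  have hQn : ‖(Q : ℂ)‖ ≤ a := by
    rw [Complex.norm_real, Real.norm_eq_abs, abs_of_pos hQ0]; exact hQa
  have hxo : ‖x o‖ ≤ ((1 + a / c₀) ^ 2 / (q₁ * b₀)) * (1 + a / c₀) * l2 y := by
    have h1 : ‖T‖ * ‖x o‖ ≤ (1 + a / c₀) * l2 y := by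
      rw [← norm_mul, hTx]
      refine (norm_sub_le _ _).trans ?_
      rw [norm_mul, norm_mul, norm_mul]
      have h2 : ‖(Q : ℂ)‖ * ‖w o‖ * ‖Y‖ * ‖S⁻¹‖ ≤ a * 1 * (l2 y / c₀) * 1 := by gcongr
      have h3 := norm_le_l2 y o
      calc _ ≤ l2 y + a * 1 * (l2 y / c₀) * 1 := add_le_add h3 h2
        _ = _ := by ring
    have h2 : q₁ * b₀ / (1 + a / c₀) ^ 2 * ‖x o‖ ≤ (1 + a / c₀) * l2 y :=
      le_trans (by gcongr) h1
    calc ‖x o‖ = (1 + a / c₀) ^ 2 / (q₁ * b₀) * (q₁ * b₀ / (1 + a / c₀) ^ 2 * ‖x o‖) := by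
          field_simp
      _ ≤ (1 + a / c₀) ^ 2 / (q₁ * b₀) * ((1 + a / c₀) * l2 y) := by gcongr
      _ = _ := by ring
  have hcn : ‖c‖ ≤ ‖x o‖ + l2 y / c₀ := by
    rw [hcs, norm_mul]
    calc _ ≤ (‖w' o * x o‖ + ‖Y‖) * 1 := by gcongr; exact norm_add_le _ _
      _ ≤ _ := by
        rw [mul_one, norm_mul]
        have : ‖w' o‖ * ‖x o‖ ≤ 1 * ‖x o‖ := by gcongr
        linarith
  have hx : x = Pi.single o (x o) + fun l => dinv l * (y l - (Q * c) * w l) := by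
    ext l
    by_cases hl : l = o
    · subst hl; simp [hdinv]
    · simp only [Pi.add_apply, Pi.single_apply, hl, if_false, zero_add]
      rw [hxl l hl]; ring
  have hsm : l2 (fun l => (Q * c) * w l) ≤ a * ‖c‖ := by
    rw [l2_le_iff (by positivity)]
    calc ∑ l, ‖(Q * c) * w l‖ ^ 2 = (‖(Q : ℂ)‖ * ‖c‖) ^ 2 * ∑ l, ‖w l‖ ^ 2 := by
          clear_value c
          rw [Finset.mul_sum]
          exact Finset.sum_congr rfl fun l _ => by rw [norm_mul, norm_mul]; ring
      _ ≤ (a * ‖c‖) ^ 2 * 1 := by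
          gcongr
          rw [← l2_sq]; exact pow_le_one₀ (l2_nonneg w) hw
      _ = _ := mul_one _
  have hsingle : l2 (Pi.single o (x o) : ι → ℂ) ≤ ‖x o‖ := by
    rw [l2_le_iff (norm_nonneg _), Finset.sum_eq_single o]
    · simp
    · intro l _ hl; simp [hl]
    · simp
  have hrest : l2 (fun l => dinv l * (y l - (Q * c) * w l)) ≤ (l2 y + a * ‖c‖) / c₀ := by
    refine (hl2dy fun l => y l - (Q * c) * w l).trans ?_
    gcongr
    exact (l2_sub_le y fun l => (Q * c) * w l).trans (by linarith)
  have h1 : l2 x ≤ ‖x o‖ + (l2 y + a * ‖c‖) / c₀ := by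
    conv_lhs => rw [hx]
    exact (l2_add_le _ _).trans (add_le_add hsingle hrest)
  calc l2 x ≤ ‖x o‖ + (l2 y + a * (‖x o‖ + l2 y / c₀)) / c₀ := by
        refine h1.trans ?_; gcongr
    _ = (1 + a / c₀) * ‖x o‖ + (1 + a / c₀) / c₀ * l2 y := by field_simp; ring
    _ ≤ (1 + a / c₀) * (((1 + a / c₀) ^ 2 / (q₁ * b₀)) * (1 + a / c₀) * l2 y) +
        (1 + a / c₀) / c₀ * l2 y := by gcongr
    _ = _ := by ring

end PBS


namespace PBS

noncomputable section

/-! ### Sums of exponentials over residue classes -/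

theorem abs_valMinAbs_intCast_le (N : ℕ) [NeZero N] (z : ℤ) :
    |((z : ZMod N).valMinAbs)| ≤ |z| := by
  have h := ZMod.natAbs_min_of_le_div_two N (z : ZMod N).valMinAbs z (by simp)
    (ZMod.natAbs_valMinAbs_le _)
  rw [Int.abs_eq_natAbs, Int.abs_eq_natAbs]
  exact_mod_cast h

theorem two_mul_abs_valMinAbs_le (N : ℕ) [NeZero N] (x : ZMod N) : 2 * |x.valMinAbs| ≤ N := by
  have := ZMod.valMinAbs_mem_Ioc x
  rcases abs_cases x.valMinAbs with h | h <;> rw [h.1] <;> linarith [this.1, this.2]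

theorem abs_valMinAbs_add_le {N : ℕ} [NeZero N] (a b : ZMod N) :
    |(a + b).valMinAbs| ≤ |a.valMinAbs| + |b.valMinAbs| := by
  have h : a + b = ((a.valMinAbs + b.valMinAbs : ℤ) : ZMod N) := by simp
  rw [h]
  exact (abs_valMinAbs_intCast_le N _).trans (abs_add_le _ _)

theorem abs_valMinAbs_neg {N : ℕ} (a : ZMod N) : |(-a).valMinAbs| = |a.valMinAbs| := by
  rw [Int.abs_eq_natAbs, Int.abs_eq_natAbs, ZMod.natAbs_valMinAbs_neg]

/-- Because of the truncated subtraction the exponents are 0, 0, 1, 2, …, which accounts for the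
additional 1. -/
theorem hasSum_pow_pred {r : ℝ} (h0 : 0 ≤ r) (h1 : r < 1) :
    HasSum (fun n : ℕ => r ^ (n - 1)) (1 + (1 - r)⁻¹) := by
  rw [← hasSum_nat_add_iff' 1]
  simpa using hasSum_geometric_of_lt_one h0 h1

/-- The class consists of the integers v + N i with v the shortest representative. Since 2|v| ≤ N,
these satisfy |v + N i| ≥ |v| + N (|i| - 1) for i ≠ 0, so both half-lines are dominated by geometric
series of ratio exp(-δ N). -/
theorem sum_exp_residue (N : ℕ) [NeZero N] (x : ZMod N) {δ : ℝ} (hδ : 0 < δ) :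
    Summable (fun m : ℤ => if (m : ZMod N) = x then Real.exp (-(δ * |(m : ℝ)|)) else 0) ∧
    ∑' m : ℤ, (if (m : ZMod N) = x then Real.exp (-(δ * |(m : ℝ)|)) else 0) ≤
      3 * Real.exp (-(δ * |(x.valMinAbs : ℝ)|)) / (1 - Real.exp (-(δ * N))) := by
  have hN : 0 < (N : ℝ) := by exact_mod_cast Nat.pos_of_ne_zero (NeZero.ne N)
  set v := x.valMinAbs with hv
  set r := Real.exp (-(δ * N)) with hr
  have hr0 : 0 ≤ r := (Real.exp_pos _).le
  have hr1 : r < 1 := by rw [hr, Real.exp_lt_one_iff]; nlinarith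
  set F : ℤ → ℝ := fun m => if (m : ZMod N) = x then Real.exp (-(δ * |(m : ℝ)|)) else 0 with hF
  set g : ℤ → ℤ := fun i => v + N * i with hg
  have hginj : Function.Injective g := by
    intro i i' h
    have h2 : (N : ℤ) * i = N * i' := by simpa [hg] using h
    exact mul_left_cancel₀ (by exact_mod_cast NeZero.ne N) h2
  have hsupp : ∀ m, m ∉ Set.range g → F m = 0 := by
    intro m hm
    simp only [hF]
    rw [if_neg]
    intro h
    apply hm
    have : ((m - v : ℤ) : ZMod N) = 0 := by simp [h, hv]
    rw [ZMod.intCast_zmod_eq_zero_iff_dvd] at this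
    obtain ⟨i, hi⟩ := this
    exact ⟨i, by simp [hg]; linarith⟩
  have hFg : ∀ i, F (g i) = Real.exp (-(δ * |(v + N * i : ℝ)|)) := by
    intro i
    simp only [hF, hg]
    rw [if_pos (by simp [hv])]
    push_cast; rfl
  have hvN : 2 * |(v : ℝ)| ≤ N := by
    have := two_mul_abs_valMinAbs_le N x
    rw [← hv] at this
    exact_mod_cast this
  set e := Real.exp (-(δ * |(v : ℝ)|)) with he
  have hexp : ∀ (y : ℝ) (k : ℕ), |(v : ℝ)| + N * k ≤ y → Real.exp (-(δ * y)) ≤ e * r ^ k := by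
    intro y k hy
    rw [he, hr, ← Real.exp_nat_mul, ← Real.exp_add]
    refine Real.exp_le_exp.2 ?_
    nlinarith
  have hpos : ∀ n : ℕ, F (g n) ≤ e * r ^ (n - 1) := by
    intro n
    rw [hFg]
    refine hexp _ _ ?_
    rcases n with _ | n
    · simp
    · have h3 : |((N : ℝ) * ((n + 1 : ℕ) : ℝ))| ≤ |(v + N * ((n + 1 : ℕ) : ℝ) : ℝ)| + |(v : ℝ)| := by
        have := abs_sub (v + N * ((n + 1 : ℕ) : ℝ) : ℝ) (v : ℝ)
        rwa [add_sub_cancel_left] at this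
      rw [abs_of_nonneg (by positivity)] at h3
      push_cast at h3 ⊢
      nlinarith
  have hneg : ∀ n : ℕ, F (g (-(n + 1 : ℤ))) ≤ e * r ^ n := by
    intro n
    rw [hFg]
    refine hexp _ _ ?_
    have h3 : |((N : ℝ) * ((n + 1 : ℕ) : ℝ))| ≤
        |(v : ℝ)| + |(v + N * ((-(n + 1 : ℤ) : ℤ) : ℝ) : ℝ)| := by
      have := abs_sub (v : ℝ) (v + N * ((-(n + 1 : ℤ) : ℤ) : ℝ) : ℝ)
      rw [sub_add_cancel_left] at this
      have h4 : -((N : ℝ) * ((-(n + 1 : ℤ) : ℤ) : ℝ)) = N * ((n + 1 : ℕ) : ℝ) := by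
        push_cast; ring
      rwa [h4] at this
    rw [abs_of_nonneg (by positivity)] at h3
    push_cast at h3 ⊢
    nlinarith
  have hF0 : ∀ m, 0 ≤ F m := fun m => by simp only [hF]; split_ifs <;> positivity
  have s1 := (hasSum_pow_pred hr0 hr1).mul_left e
  have s2 := (hasSum_geometric_of_lt_one hr0 hr1).mul_left e
  have t1 : Summable fun n : ℕ => F (g n) := s1.summable.of_nonneg_of_le (fun _ => hF0 _) hpos
  have t2 : Summable fun n : ℕ => F (g (-(n + 1 : ℤ))) :=
    s2.summable.of_nonneg_of_le (fun _ => hF0 _) hneg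
  have hsum : HasSum (fun i => F (g i)) _ := HasSum.of_nat_of_neg_add_one t1.hasSum t2.hasSum
  have hall : HasSum F _ := (hginj.hasSum_iff hsupp).1 hsum
  refine ⟨hall.summable, ?_⟩
  rw [hall.tsum_eq]
  have b1 := hasSum_le hpos t1.hasSum s1
  have b2 := hasSum_le hneg t2.hasSum s2
  have hinv : 1 ≤ (1 - r)⁻¹ := (one_le_inv₀ (by linarith)).2 (by linarith)
  have he0 : 0 ≤ e := (Real.exp_pos _).le
  calc _ ≤ e * (1 + (1 - r)⁻¹) + e * (1 - r)⁻¹ := add_le_add b1 b2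
    _ ≤ e * ((1 - r)⁻¹ + (1 - r)⁻¹) + e * (1 - r)⁻¹ := by gcongr
    _ = _ := by rw [div_eq_mul_inv]; ring

/-- With modulus 1 this bounds sums over a whole cyclic group. With modulus L_ν^j it bounds sums
over a unit sublattice, whose displacements from a fixed fine point lie in a single class. -/
theorem sum_exp_le_of_injective {ι : Type*} [Fintype ι] (N : ℕ) [NeZero N] (x : ZMod N) {δ : ℝ}
    (hδ : 0 < δ) (f : ι → ℤ) (hf : Function.Injective f) (hx : ∀ i, (f i : ZMod N) = x) :
    ∑ i, Real.exp (-(δ * |(f i : ℝ)|)) ≤ 3 / (1 - Real.exp (-(δ * N))) := by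
  classical
  obtain ⟨hs, hle⟩ := sum_exp_residue N x hδ
  have hN : 0 < (N : ℝ) := by exact_mod_cast Nat.pos_of_ne_zero (NeZero.ne N)
  have hr1 : Real.exp (-(δ * N)) < 1 := by rw [Real.exp_lt_one_iff]; nlinarith
  calc _ = ∑ m ∈ Finset.univ.image f,
        (if (m : ZMod N) = x then Real.exp (-(δ * |(m : ℝ)|)) else 0) := by
        rw [Finset.sum_image (fun _ _ _ _ h => hf h)]
        exact Finset.sum_congr rfl fun i _ => by rw [if_pos (hx i)]
    _ ≤ _ := hs.sum_le_tsum _ fun m _ => by split_ifs <;> positivity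
    _ ≤ _ := hle
    _ ≤ _ := by
        have h1 : 0 < 1 - Real.exp (-(δ * N)) := by linarith
        have h2 : Real.exp (-(δ * |(x.valMinAbs : ℝ)|)) ≤ 1 := by
          rw [Real.exp_le_one_iff]; have : 0 ≤ δ * |(x.valMinAbs : ℝ)| := by positivity
          linarith
        gcongr
        linarith

theorem inv_one_sub_exp_neg_le {y : ℝ} (hy : 0 < y) : (1 - Real.exp (-y))⁻¹ ≤ 1 + 1 / y := by
  have h1 : Real.exp (-y) ≤ 1 / (1 + y) := by
    rw [Real.exp_neg, one_div]
    exact inv_anti₀ (by linarith) (by linarith [Real.add_one_le_exp y])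
  have h2 : y / (1 + y) ≤ 1 - Real.exp (-y) := by
    have : y / (1 + y) = 1 - 1 / (1 + y) := by field_simp; ring
    linarith
  calc _ ≤ (y / (1 + y))⁻¹ := inv_anti₀ (by positivity) h2
    _ = _ := by field_simp; ring

theorem sum_exp_valMinAbs_le (S : ℕ) [NeZero S] {δ : ℝ} (hδ : 0 < δ) :
    ∑ z : ZMod S, Real.exp (-(δ * |(z.valMinAbs : ℝ)|)) ≤ 3 * (1 + 1 / δ) := by
  refine (sum_exp_le_of_injective 1 0 hδ (fun z : ZMod S => z.valMinAbs)
    ZMod.injective_valMinAbs (fun _ => Subsingleton.elim _ _)).trans ?_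
  rw [div_eq_mul_inv]
  have := inv_one_sub_exp_neg_le hδ
  simpa using this

theorem sum_prod_pi {ι : Type*} [Fintype ι] [DecidableEq ι] {κ : ι → Type*} [∀ i, Fintype (κ i)]
    {R : Type*} [CommSemiring R] (f : ∀ i, κ i → R) :
    ∑ v : (∀ i, κ i), ∏ i, f i (v i) = ∏ i, ∑ z, f i z := by
  rw [Finset.prod_univ_sum, Fintype.piFinset_univ]

/-! ### The lattice -/

section Lattice

variable {L t s j : ℕ}

/-- The `ℓ¹` distance on the torus. -/
def d1 (u v : Lat L t s j) : ℝ := ∑ ν, eps L j ν * |((u ν - v ν).valMinAbs : ℝ)|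

theorem Ldir_pos (L : ℕ) [NeZero L] (ν : Fin 4) : 0 < Ldir L ν := Nat.pos_of_ne_zero (NeZero.ne _)

theorem eps_pos [NeZero L] (ν : Fin 4) : 0 < eps L j ν := by
  have := Ldir_pos L ν
  unfold eps; positivity

theorem eps_le_one [NeZero L] (ν : Fin 4) : eps L j ν ≤ 1 := by
  have : 1 ≤ (Ldir L ν : ℝ) := by exact_mod_cast Ldir_pos L ν
  unfold eps
  exact inv_le_one_of_one_le₀ (one_le_pow₀ this)

theorem isDist_d1 [NeZero L] : IsDist (d1 : Lat L t s j → Lat L t s j → ℝ) where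
  self u := by simp [d1]
  symm u v := by
    unfold d1
    refine Finset.sum_congr rfl fun ν _ => ?_
    have h : u ν - v ν = -(v ν - u ν) := by ring
    have := abs_valMinAbs_neg (v ν - u ν)
    rw [← h] at this
    congr 1
    exact_mod_cast this
  tri u v w := by
    unfold d1
    rw [← Finset.sum_add_distrib]
    refine Finset.sum_le_sum fun ν _ => ?_
    rw [← mul_add]
    have h : u ν - w ν = (u ν - v ν) + (v ν - w ν) := by ring
    have := abs_valMinAbs_add_le (u ν - v ν) (v ν - w ν)
    rw [← h] at this
    refine mul_le_mul_of_nonneg_left ?_ (eps_pos ν).le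
    exact_mod_cast this

/-- The ℓ¹ distance dominates the Euclidean one, so decay in `d1` is the stronger statement. It is
used throughout because its exponentials factor over the directions. -/
theorem latDist_le_d1 [NeZero L] (u v : Lat L t s j) : latDist u v ≤ d1 u v := by
  unfold latDist d1
  have h0 : ∀ ν, 0 ≤ eps L j ν * |((u ν - v ν).valMinAbs : ℝ)| := fun ν =>
    mul_nonneg (eps_pos ν).le (abs_nonneg _)
  rw [Real.sqrt_le_left (Finset.sum_nonneg fun ν _ => h0 ν)]
  calc _ = ∑ ν, (eps L j ν * |((u ν - v ν).valMinAbs : ℝ)|) ^ 2 := by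
        refine Finset.sum_congr rfl fun ν _ => ?_
        rw [mul_pow, mul_pow, sq_abs]
    _ ≤ _ := Finset.sum_sq_le_sq_sum_of_nonneg fun ν _ => h0 ν

theorem weight_pos [NeZero L] : 0 < weight L j := by
  have : 0 < (L : ℝ) := by exact_mod_cast Nat.pos_of_ne_zero (NeZero.ne L)
  unfold weight; positivity

theorem weight_eq_prod_eps (L j : ℕ) : weight L j = ∏ ν, eps L j ν := by
  rw [Fin.prod_univ_four]
  simp only [weight, eps, Ldir, if_true, Fin.isValue, one_ne_zero, if_false,
    Fin.reduceEq]
  rw [← mul_inv, ← mul_inv, ← mul_inv]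
  congr 1
  push_cast
  ring

/-- The weight of the integral cancels the inverse weight in the kernel, so the norm is a weighted
matrix row or column sum. -/
theorem expNorm_le [NeZero L] {m C : ℝ} (hm : 0 ≤ m) {A : Matrix (Lat L t s j) (Lat L t s j) ℂ}
    (hA : ExpBd d1 m C A) : expNorm m A ≤ C := by
  have hw := weight_pos (L := L) (j := j)
  have key : ∀ u v : Lat L t s j, weight L j * (Real.exp (m * latDist u v) * ‖kernel A u v‖) ≤
      Real.exp (m * d1 u v) * ‖A u v‖ := by
    intro u v
    have h : ‖kernel A u v‖ = (weight L j)⁻¹ * ‖A u v‖ := by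
      rw [kernel, norm_mul, norm_inv, Complex.norm_real, Real.norm_eq_abs, abs_of_pos hw]
    rw [h]
    calc _ = Real.exp (m * latDist u v) * ‖A u v‖ := by field_simp
      _ ≤ _ := by gcongr; exact latDist_le_d1 u v
  unfold expNorm
  refine max_le (ciSup_le fun u => ?_) (ciSup_le fun v => ?_)
  · exact (Finset.sum_le_sum fun v _ => key u v).trans (hA.row u)
  · exact (Finset.sum_le_sum fun u _ => key u v).trans (hA.col v)

/-- A bound for the integral of `exp (-s d)` over the lattice. -/
def volBound (s : ℝ) : ℝ := (3 * (1 + 1 / s)) ^ 4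

/-- The sum factors over directions. In each one the spacing ε compensates the number of points
within unit distance: ε (1 + 1/(σ ε)) = ε + 1/σ ≤ 1 + 1/σ. -/
theorem sum_weight_exp_le [NeZero L] {σ : ℝ} (hσ : 0 < σ) (u : Lat L t s j) :
    ∑ v, weight L j * Real.exp (-(σ * d1 u v)) ≤ volBound σ := by
  have e1 : ∀ v : Lat L t s j, weight L j * Real.exp (-(σ * d1 u v)) =
      ∏ ν, eps L j ν * Real.exp (-(σ * eps L j ν * |((u ν - v ν).valMinAbs : ℝ)|)) := by
    intro v
    rw [Finset.prod_mul_distrib, ← Real.exp_sum, weight_eq_prod_eps, d1, Finset.mul_sum,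
      ← Finset.sum_neg_distrib]
    simp only [mul_assoc]
  simp_rw [e1]
  rw [sum_prod_pi fun ν (z : ZMod (size L t s j ν)) =>
    eps L j ν * Real.exp (-(σ * eps L j ν * |((u ν - z).valMinAbs : ℝ)|))]
  rw [volBound, ← Fin.prod_const]
  refine Finset.prod_le_prod (fun ν _ => Finset.sum_nonneg fun z _ => ?_) fun ν _ => ?_
  · have := eps_pos (L := L) (j := j) ν; positivity
  · have he := eps_pos (L := L) (j := j) ν
    have he1 := eps_le_one (L := L) (j := j) ν
    rw [← Finset.mul_sum]
    have hre := (Equiv.subLeft (u ν)).sum_comp fun z : ZMod (size L t s j ν) =>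
      Real.exp (-(σ * eps L j ν * |(z.valMinAbs : ℝ)|))
    simp only [Equiv.subLeft_apply] at hre
    rw [hre]
    calc _ ≤ eps L j ν * (3 * (1 + 1 / (σ * eps L j ν))) := by
          gcongr; exact sum_exp_valMinAbs_le _ (by positivity)
      _ = 3 * (eps L j ν + 1 / σ) := by field_simp
      _ ≤ _ := by gcongr

/-- The inclusion of the unit lattice. -/
def emb (j : ℕ) (x : Lat L t s 0) : Lat L t s j :=
  fun ν => ((Ldir L ν ^ j * (x ν).val : ℕ) : ZMod (size L t s j ν))

theorem size_eq_mul (L t s j : ℕ) (ν : Fin 4) :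
    size L t s j ν = Ldir L ν ^ j * size L t s 0 ν := by simp [size]

/-- Multiplication by N maps the interval of shortest representatives modulo P into the one modulo N
P. Hence the unit lattice embeds isometrically into the fine one. -/
theorem valMinAbs_mul_intCast {N P M : ℕ} [NeZero N] [NeZero P] [NeZero M] (hM : M = N * P)
    (z : ℤ) : ((N * z : ℤ) : ZMod M).valMinAbs = N * (z : ZMod P).valMinAbs := by
  subst hM
  rw [ZMod.valMinAbs_spec]
  constructor
  · rw [ZMod.intCast_eq_intCast_iff_dvd_sub]
    have : (P : ℤ) ∣ (z : ZMod P).valMinAbs - z := by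
      rw [← ZMod.intCast_eq_intCast_iff_dvd_sub]; simp
    obtain ⟨k, hk⟩ := this
    refine ⟨k, ?_⟩
    push_cast
    linear_combination (N : ℤ) * hk
  · have h := ZMod.valMinAbs_mem_Ioc (z : ZMod P)
    have hN : (0 : ℤ) < N := by exact_mod_cast Nat.pos_of_ne_zero (NeZero.ne N)
    constructor
    · have := mul_lt_mul_of_pos_left h.1 hN
      push_cast; linarith
    · have := mul_le_mul_of_nonneg_left h.2 hN.le
      push_cast; linarith

theorem emb_sub_emb [NeZero L] (x y : Lat L t s 0) (ν : Fin 4) :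
    emb j x ν - emb j y ν = (((Ldir L ν ^ j : ℕ) * ((x ν).val - (y ν).val : ℤ) : ℤ) :
      ZMod (size L t s j ν)) := by
  simp [emb, mul_sub]

theorem d1_emb [NeZero L] (x y : Lat L t s 0) : d1 (emb j x) (emb j y) = d1 x y := by
  unfold d1
  refine Finset.sum_congr rfl fun ν _ => ?_
  rw [emb_sub_emb, valMinAbs_mul_intCast (size_eq_mul L t s j ν)]
  have h : (((x ν).val - (y ν).val : ℤ) : ZMod (size L t s 0 ν)) = x ν - y ν := by
    simp
  rw [h]
  have hL := Ldir_pos L ν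
  have hL' : (0 : ℝ) < Ldir L ν := by exact_mod_cast hL
  push_cast
  rw [abs_mul, abs_of_pos (a := (Ldir L ν : ℝ) ^ j) (by positivity)]
  simp only [eps]
  field_simp

/-- In direction ν the displacements from u to unit lattice points form part of one residue class
modulo L_ν^j. This modulus has physical length 1, so the resulting bound does not depend on the
spacing. -/
theorem sum_exp_emb_le [NeZero L] {σ : ℝ} (hσ : 0 < σ) (u : Lat L t s j) :
    ∑ x : Lat L t s 0, Real.exp (-(σ * d1 u (emb j x))) ≤ volBound σ := by
  have e1 : ∀ x : Lat L t s 0, Real.exp (-(σ * d1 u (emb j x))) =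
      ∏ ν, Real.exp (-(σ * eps L j ν *
        |((u ν - ((Ldir L ν ^ j * (x ν).val : ℕ) : ZMod (size L t s j ν))).valMinAbs : ℝ)|)) := by
    intro v
    rw [← Real.exp_sum, d1, Finset.mul_sum, ← Finset.sum_neg_distrib]
    simp only [mul_assoc]; rfl
  simp_rw [e1]
  rw [sum_prod_pi fun ν (z : ZMod (size L t s 0 ν)) => Real.exp (-(σ * eps L j ν *
        |((u ν - ((Ldir L ν ^ j * z.val : ℕ) : ZMod (size L t s j ν))).valMinAbs : ℝ)|))]
  rw [volBound, ← Fin.prod_const]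
  refine Finset.prod_le_prod (fun ν _ => Finset.sum_nonneg fun z _ => by positivity)
    fun ν _ => ?_
  have he := eps_pos (L := L) (j := j) ν
  have hdvd : Ldir L ν ^ j ∣ size L t s j ν := ⟨_, rfl⟩
  have hLp := Ldir_pos L ν
  have hb := sum_exp_le_of_injective (Ldir L ν ^ j)
    (ZMod.castHom hdvd (ZMod (Ldir L ν ^ j)) (u ν)) (δ := σ * eps L j ν) (by positivity)
    (fun z : ZMod (size L t s 0 ν) =>
      (u ν - ((Ldir L ν ^ j * z.val : ℕ) : ZMod (size L t s j ν))).valMinAbs) ?_ ?_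
  · refine hb.trans ?_
    have : σ * eps L j ν * ((Ldir L ν ^ j : ℕ) : ℝ) = σ := by
      have : (0 : ℝ) < Ldir L ν := by exact_mod_cast hLp
      simp only [eps]; push_cast; field_simp
    rw [this, div_eq_mul_inv]
    gcongr
    exact inv_one_sub_exp_neg_le hσ
  · intro z z' h
    have h2 := ZMod.injective_valMinAbs h
    rw [sub_right_inj, ZMod.natCast_eq_natCast_iff, size_eq_mul] at h2
    have h3 := Nat.ModEq.mul_left_cancel' (by positivity) h2
    rw [← ZMod.natCast_eq_natCast_iff] at h3
    simpa using h3
  · intro z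
    set w := u ν - ((Ldir L ν ^ j * z.val : ℕ) : ZMod (size L t s j ν)) with hw
    have h1 : ((w.valMinAbs : ℤ) : ZMod (Ldir L ν ^ j)) =
        ZMod.castHom hdvd (ZMod (Ldir L ν ^ j)) w := by
      conv_rhs => rw [← ZMod.coe_valMinAbs w, map_intCast]
    rw [h1, hw, map_sub, map_natCast]
    simp

/-! ### Characters -/

/-- The character of the lattice with integer label `z`. -/
def chi [NeZero L] (z : Fin 4 → ℤ) (u : Lat L t s j) : ℂ :=
  ∏ ν, ZMod.stdAddChar ((z ν : ZMod (size L t s j ν)) * u ν)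

/-- The momentum with integer label `z`. -/
def pmom (L t s : ℕ) (z : Fin 4 → ℤ) (ν : Fin 4) : ℝ := 2 * Real.pi * z ν / period L t s ν

theorem chi_add [NeZero L] (z : Fin 4 → ℤ) (u v : Lat L t s j) :
    chi z (u + v) = chi z u * chi z v := by
  simp only [chi, Pi.add_apply, mul_add, AddChar.map_add_eq_mul, Finset.prod_mul_distrib]

theorem norm_chi [NeZero L] (z : Fin 4 → ℤ) (u : Lat L t s j) : ‖chi z u‖ = 1 := by
  simp [chi]

theorem chi_intCast [NeZero L] (z : Fin 4 → ℤ) (x : Fin 4 → ℤ) :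
    chi z (fun ν => (x ν : ZMod (size L t s j ν))) =
      Complex.exp (Complex.I * ((∑ ν, pmom L t s z ν * (eps L j ν * x ν) : ℝ) : ℂ)) := by
  rw [chi, Complex.ofReal_sum, Finset.mul_sum, Complex.exp_sum]
  refine Finset.prod_congr rfl fun ν _ => ?_
  rw [← Int.cast_mul, ZMod.stdAddChar_coe]
  congr 1
  have h1 : (Ldir L ν : ℂ) ≠ 0 := by exact_mod_cast (Ldir_pos L ν).ne'
  have h2 : (period L t s ν : ℂ) ≠ 0 := by exact_mod_cast NeZero.ne (period L t s ν)
  simp only [pmom, eps, size]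
  push_cast
  field_simp

theorem phase_eq_chi [NeZero L] (z : Fin 4 → ℤ) (u : Lat L t s j) :
    phase (pmom L t s z) (pos u) = chi z u := by
  have h : u = fun ν => (((u ν).val : ℤ) : ZMod (size L t s j ν)) := by ext ν; simp
  conv_rhs => rw [h]
  rw [chi_intCast]
  simp [phase, pos]

theorem phase_neg (p x : Fin 4 → ℝ) : phase (-p) x = star (phase p x) := by
  have : star (phase p x) = (starRingEnd ℂ) (phase p x) := rfl
  rw [this, phase, phase, ← Complex.exp_conj]
  simp

theorem chi_emb [NeZero L] (z : Fin 4 → ℤ) (x : Lat L t s 0) : chi z (emb j x) = chi z x := by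
  rw [← phase_eq_chi z x]
  have h : emb j x = fun ν => (((Ldir L ν ^ j * (x ν).val : ℕ) : ℤ) : ZMod (size L t s j ν)) := by
    ext ν; simp [emb]
  rw [h, chi_intCast, phase]
  congr 4 with ν
  have h1 : (Ldir L ν : ℝ) ≠ 0 := by exact_mod_cast (Ldir_pos L ν).ne'
  simp only [pos, eps]
  push_cast
  field_simp

theorem sum_chi_mul_star [NeZero L] (z z' : Fin 4 → ℤ) :
    ∑ u : Lat L t s j, star (chi z' u) * chi z u =
      if ∀ ν, (z ν : ZMod (size L t s j ν)) = z' ν then (Fintype.card (Lat L t s j) : ℂ) else 0 := by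
  have e1 : ∀ u : Lat L t s j, star (chi z' u) * chi z u =
      ∏ ν, ZMod.stdAddChar (u ν * ((z ν : ZMod (size L t s j ν)) - (z' ν : ZMod (size L t s j ν)))) := by
    intro u
    have : star (chi z' u) = (starRingEnd ℂ) (chi z' u) := rfl
    rw [this, chi, chi, map_prod, ← Finset.prod_mul_distrib]
    refine Finset.prod_congr rfl fun ν _ => ?_
    rw [← AddChar.map_neg_eq_conj, ← AddChar.map_add_eq_mul]
    congr 1; ring
  simp_rw [e1]
  rw [sum_prod_pi fun ν (w : ZMod (size L t s j ν)) =>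
    (ZMod.stdAddChar (w * ((z ν : ZMod (size L t s j ν)) - (z' ν : ZMod (size L t s j ν)))) : ℂ)]
  simp_rw [AddChar.sum_mulShift _ (ZMod.isPrimitive_stdAddChar _), sub_eq_zero]
  split_ifs with h
  · simp [h, Fintype.card_pi]
  · push Not at h
    obtain ⟨ν, hν⟩ := h
    exact Finset.prod_eq_zero (Finset.mem_univ ν) (by simp [hν])

variable {ι : Type*} [Fintype ι] [DecidableEq ι]

/-- The matrix whose columns are the characters with the given labels. -/
def charMat (L t s j : ℕ) [NeZero L] (lab : ι → Fin 4 → ℤ) : Matrix (Lat L t s j) ι ℂ :=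
  Matrix.of fun u i => chi (lab i) u

/-- The labels enumerate the dual lattice. -/
structure IsLabel (L t s j : ℕ) [NeZero L] (lab : ι → Fin 4 → ℤ) : Prop where
  inj : ∀ i i', (∀ ν, (lab i ν : ZMod (size L t s j ν)) = lab i' ν) → i = i'
  card : Fintype.card ι = Fintype.card (Lat L t s j)

variable [NeZero L] {lab : ι → Fin 4 → ℤ}

theorem card_ne_zero : (Fintype.card (Lat L t s j) : ℂ) ≠ 0 := by
  exact_mod_cast Fintype.card_ne_zero

theorem charMat_conjTranspose_mul (h : IsLabel L t s j lab) :
    (charMat L t s j lab).conjTranspose * charMat L t s j lab =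
      (Fintype.card (Lat L t s j) : ℂ) • 1 := by
  ext i i'
  rw [Matrix.mul_apply]
  simp only [charMat, Matrix.conjTranspose_apply, Matrix.of_apply, Matrix.smul_apply,
    Matrix.one_apply, smul_eq_mul]
  rw [sum_chi_mul_star]
  by_cases hi : i = i'
  · simp [hi]
  · rw [if_neg, if_neg hi, mul_zero]
    intro h'
    exact hi (h.inj _ _ fun ν => (h' ν).symm)

theorem charMat_mul_conjTranspose (h : IsLabel L t s j lab) :
    charMat L t s j lab * (charMat L t s j lab).conjTranspose =
      (Fintype.card (Lat L t s j) : ℂ) • 1 := by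
  have h1 : ((Fintype.card (Lat L t s j) : ℂ)⁻¹ • (charMat L t s j lab).conjTranspose) *
      charMat L t s j lab = 1 := by
    rw [Matrix.smul_mul, charMat_conjTranspose_mul h, smul_smul, inv_mul_cancel₀ card_ne_zero,
      one_smul]
  rw [Matrix.mul_eq_one_comm_of_card_eq _ _ _ h.card, Matrix.mul_smul] at h1
  rw [← h1, smul_smul, mul_inv_cancel₀ card_ne_zero, one_smul]

/-- A matrix is determined by its action on the characters. -/
theorem eq_of_mul_charMat (h : IsLabel L t s j lab) {κ κ' : Type*} [Fintype κ']
    {A : Matrix κ (Lat L t s j) ℂ} {B : Matrix κ κ' ℂ} {W : Matrix κ' ι ℂ}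
    (hA : A * charMat L t s j lab = B * W) :
    A = (Fintype.card (Lat L t s j) : ℂ)⁻¹ • (B * W * (charMat L t s j lab).conjTranspose) := by
  rw [← hA, Matrix.mul_assoc, charMat_mul_conjTranspose h, Matrix.mul_smul, smul_smul,
    inv_mul_cancel₀ card_ne_zero, one_smul, Matrix.mul_one]

theorem ofReal_l2_sq {Y : Type*} [Fintype Y] (y : Y → ℂ) :
    ((l2 y ^ 2 : ℝ) : ℂ) = star y ⬝ᵥ y := by
  rw [l2_sq, dotProduct]
  push_cast
  refine Finset.sum_congr rfl fun i _ => ?_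
  rw [Pi.star_apply, ← Complex.conj_mul']
  rfl

/-- Plancherel's identity, with characters that are not normalised. -/
theorem l2_conjTranspose_charMat (h : IsLabel L t s j lab) (x : Lat L t s j → ℂ) :
    l2 ((charMat L t s j lab).conjTranspose.mulVec x) =
      √(Fintype.card (Lat L t s j)) * l2 x := by
  have key : l2 ((charMat L t s j lab).conjTranspose.mulVec x) ^ 2 =
      Fintype.card (Lat L t s j) * l2 x ^ 2 := by
    have : ((l2 ((charMat L t s j lab).conjTranspose.mulVec x) ^ 2 : ℝ) : ℂ) =
        ((Fintype.card (Lat L t s j) * l2 x ^ 2 : ℝ) : ℂ) := by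
      rw [ofReal_l2_sq, Complex.ofReal_mul, ofReal_l2_sq, Matrix.star_mulVec, Matrix.conjTranspose_conjTranspose,
        ← Matrix.dotProduct_mulVec, Matrix.mulVec_mulVec, charMat_mul_conjTranspose h]
      simp [Matrix.smul_mulVec]
    exact_mod_cast this
  have h0 : 0 ≤ √(Fintype.card (Lat L t s j)) * l2 x :=
    mul_nonneg (Real.sqrt_nonneg _) (l2_nonneg _)
  rw [← sq_eq_sq₀ (l2_nonneg _) h0, key, mul_pow, Real.sq_sqrt (by positivity)]

/-- The labels `k + ℓ` of the dual lattice of `X_j`. -/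
def labPair (L t s j : ℕ) (i : Lat L t s 0 × Bdual L j) (ν : Fin 4) : ℤ :=
  (i.1 ν).valMinAbs + period L t s ν * (i.2 ν).valMinAbs

/-- The labels of the dual lattice of `X_j` by their shortest representatives. -/
def labMin (L t s j : ℕ) (i : Lat L t s j) (ν : Fin 4) : ℤ := (i ν).valMinAbs

theorem isLabel_labMin : IsLabel L t s j (labMin L t s j) where
  inj i i' h := by ext ν; simpa [labMin] using h ν
  card := rfl

/-- Reduction modulo the period recovers k; the remaining difference, divided by the period, is
determined modulo L_ν^j and recovers ℓ. -/
theorem isLabel_labPair : IsLabel L t s j (labPair L t s j) where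
  inj i i' h := by
    have hsz : ∀ ν, size L t s 0 ν = period L t s ν := fun ν => by simp [size]
    have h1 : i.1 = i'.1 := by
      ext ν
      have h2 := h ν
      rw [ZMod.intCast_eq_intCast_iff_dvd_sub] at h2
      have h3 : (size L t s 0 ν : ℤ) ∣ labPair L t s j i' ν - labPair L t s j i ν :=
        dvd_trans (by rw [size_eq_mul L t s j]; push_cast; exact Dvd.intro_left _ rfl) h2
      have h4 : (size L t s 0 ν : ℤ) ∣ (i'.1 ν).valMinAbs - (i.1 ν).valMinAbs := by
        have h5 : (i'.1 ν).valMinAbs - (i.1 ν).valMinAbs =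
            (labPair L t s j i' ν - labPair L t s j i ν) -
              (size L t s 0 ν : ℤ) * ((i'.2 ν).valMinAbs - (i.2 ν).valMinAbs) := by
          simp only [labPair, congrArg (Nat.cast : ℕ → ℤ) (hsz ν)]; ring
        rw [h5]
        exact dvd_sub h3 (Dvd.intro _ rfl)
      rw [← ZMod.intCast_eq_intCast_iff_dvd_sub] at h4
      simpa using h4
    refine Prod.ext h1 ?_
    ext ν
    have h2 := h ν
    rw [ZMod.intCast_eq_intCast_iff_dvd_sub] at h2
    have h5 : labPair L t s j i' ν - labPair L t s j i ν =
        (period L t s ν : ℤ) * ((i'.2 ν).valMinAbs - (i.2 ν).valMinAbs) := by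
      simp only [labPair, h1]; ring
    rw [h5, size] at h2
    push_cast at h2
    rw [mul_comm ((Ldir L ν : ℤ) ^ j)] at h2
    have h6 := (mul_dvd_mul_iff_left
      (by exact_mod_cast NeZero.ne (period L t s ν) : (period L t s ν : ℤ) ≠ 0)).1 h2
    have h7 : (((Ldir L ν ^ j : ℕ) : ℤ)) ∣ (i'.2 ν).valMinAbs - (i.2 ν).valMinAbs := by
      push_cast; exact h6
    rw [← ZMod.intCast_eq_intCast_iff_dvd_sub] at h7
    simpa using h7
  card := by
    simp only [Fintype.card_prod, Fintype.card_pi, ZMod.card, ← Finset.prod_mul_distrib]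
    refine Finset.prod_congr rfl fun ν _ => ?_
    rw [size_eq_mul L t s j]; ring

theorem kMom_add_lMom (i : Lat L t s 0 × Bdual L j) :
    kMom i.1 + lMom i.2 = pmom L t s (labPair L t s j i) := by
  ext ν
  have h2 : (period L t s ν : ℝ) ≠ 0 := by exact_mod_cast NeZero.ne (period L t s ν)
  simp only [Pi.add_apply, kMom, lMom, pmom, labPair]
  push_cast
  field_simp

end Lattice

theorem kMom_eq {L t s : ℕ} (κ : Lat L t s 0) : kMom κ = pmom L t s (labMin L t s 0 κ) := rfl

end

end PBS


namespace PBS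

noncomputable section

/-! ### The Dirichlet kernel -/

theorem valMinAbs_intCast_eq_self {N : ℕ} [NeZero N] {z : ℤ}
    (hz : 2 * |z| ≤ (N : ℤ) - 1) : (z : ZMod N).valMinAbs = z := by
  rw [ZMod.valMinAbs_spec]
  refine ⟨rfl, ?_⟩
  have h := abs_le.1 (show |z * 2| ≤ (N : ℤ) - 1 by rw [abs_mul]; simpa [mul_comm] using hz)
  exact ⟨by linarith [h.1], by linarith [h.2]⟩

theorem two_mul_abs_valMinAbs_le_of_odd {N : ℕ} [NeZero N] (hN : Odd N) (w : ZMod N) :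
    2 * |w.valMinAbs| ≤ (N : ℤ) - 1 := by
  have h := two_mul_abs_valMinAbs_le N w
  obtain ⟨k, rfl⟩ := hN
  push_cast at h ⊢
  omega

/-- For odd N the shortest representatives are exactly the integers of modulus at most (N - 1) / 2,
which is the floor N / 2. -/
theorem sum_valMinAbs_eq_sum_range {N : ℕ} [NeZero N] (hN : Odd N) (f : ℤ → ℂ) :
    ∑ w : ZMod N, f w.valMinAbs = ∑ i ∈ Finset.range N, f ((i : ℤ) - (N / 2 : ℕ)) := by
  have hNp : 0 < N := Nat.pos_of_ne_zero (NeZero.ne N)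
  obtain ⟨k, hk⟩ := hN
  have hk2 : N / 2 = k := by omega
  have hv : ∀ i ∈ Finset.range N,
      (((i : ℤ) - (N / 2 : ℕ) : ℤ) : ZMod N).valMinAbs = (i : ℤ) - (N / 2 : ℕ) := by
    intro i hi
    rw [Finset.mem_range] at hi
    refine valMinAbs_intCast_eq_self ?_
    rw [hk2]
    rcases abs_cases ((i : ℤ) - (k : ℕ)) with h | h <;> rw [h.1] <;> omega
  symm
  refine Finset.sum_bij (fun i _ => (((i : ℤ) - (N / 2 : ℕ) : ℤ) : ZMod N))
    (fun _ _ => Finset.mem_univ _) ?_ ?_ ?_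
  · intro i hi i' hi' h
    have h2 := congrArg ZMod.valMinAbs h
    rw [hv i hi, hv i' hi'] at h2
    omega
  · intro w _
    have h := two_mul_abs_valMinAbs_le_of_odd ⟨k, hk⟩ w
    have h1 := le_abs_self w.valMinAbs
    have h2 := neg_abs_le w.valMinAbs
    refine ⟨(w.valMinAbs + k).toNat, ?_, ?_⟩
    · rw [Finset.mem_range]; omega
    · rw [hk2]
      have : (((w.valMinAbs + k).toNat : ℤ) - (k : ℕ) : ℤ) = w.valMinAbs := by omega
      rw [this]; simp
  · intro i hi
    rw [hv i hi]

/-- This is the Dirichlet kernel: multiplied by sin(θ / 2), θ = x / N, the symmetric exponential sum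
telescopes. Where the denominator vanishes every exponential equals 1, in agreement with the default
value 1 of `sinRatio`. -/
theorem sinRatio_eq_sum {N : ℕ} [NeZero N] (hN : Odd N) (x : ℝ) :
    ((sinRatio N x : ℝ) : ℂ) =
      (N : ℂ)⁻¹ * ∑ w : ZMod N, Complex.exp (Complex.I * ((x / N * w.valMinAbs : ℝ) : ℂ)) := by
  have hN0 : (N : ℂ) ≠ 0 := by exact_mod_cast NeZero.ne N
  have hNr : (N : ℝ) ≠ 0 := by exact_mod_cast NeZero.ne N
  unfold sinRatio
  split_ifs with h
  · rw [Real.sin_eq_zero_iff] at h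
    obtain ⟨m, hm⟩ := h
    have hx : x / N = m * (2 * Real.pi) := by
      have h2 : x / (2 * N) * 2 = x / N := by field_simp
      rw [← h2, ← hm]; ring
    have : ∀ w : ZMod N, Complex.exp (Complex.I * ((x / N * w.valMinAbs : ℝ) : ℂ)) = 1 := by
      intro w
      rw [Complex.exp_eq_one_iff]
      refine ⟨m * w.valMinAbs, ?_⟩
      rw [hx]; push_cast; ring
    simp only [this]
    simp [hN0]
  · rw [sum_valMinAbs_eq_sum_range hN
      fun z => Complex.exp (Complex.I * ((x / N * z : ℝ) : ℂ))]
    set θ : ℝ := x / N with hθ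
    have hsin : Complex.sin (θ / 2 : ℂ) ≠ 0 := by
      have : (θ / 2 : ℂ) = ((x / (2 * N) : ℝ) : ℂ) := by rw [hθ]; push_cast; field_simp
      rw [this, ← Complex.ofReal_sin]
      exact_mod_cast h
    have hx : x = N * θ := by rw [hθ]; field_simp
    have hkey : Complex.sin (θ / 2 : ℂ) * ∑ i ∈ Finset.range N,
        Complex.exp (Complex.I * ((θ * ((i : ℤ) - (N / 2 : ℕ) : ℤ) : ℝ) : ℂ)) =
        Complex.sin (N * θ / 2 : ℂ) := by
      have h2i : ∀ z : ℂ, Complex.sin z =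
          (Complex.exp (-z * Complex.I) - Complex.exp (z * Complex.I)) * (Complex.I / 2) := by
        intro z; rw [Complex.sin]; ring
      set g : ℕ → ℂ := fun i =>
        -(Complex.exp (Complex.I * (θ * (i - (N / 2 : ℕ) - 1 / 2)))) * (Complex.I / 2) with hg
      have hstep : ∀ i ∈ Finset.range N, Complex.sin (θ / 2 : ℂ) *
          Complex.exp (Complex.I * ((θ * ((i : ℤ) - (N / 2 : ℕ) : ℤ) : ℝ) : ℂ)) =
          g (i + 1) - g i := by
        intro i _
        rw [h2i, hg]
        simp only
        rw [mul_right_comm, sub_mul, ← Complex.exp_add, ← Complex.exp_add, ← sub_mul]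
        have e1 : -(θ / 2 : ℂ) * Complex.I +
            Complex.I * ((θ * ((i : ℤ) - (N / 2 : ℕ) : ℤ) : ℝ) : ℂ) =
            Complex.I * (θ * (i - (N / 2 : ℕ) - 1 / 2)) := by 
          rw [Complex.ofReal_mul, Complex.ofReal_intCast, Int.cast_sub, Int.cast_natCast,
            Int.cast_natCast]
          ring
        have e2 : (θ / 2 : ℂ) * Complex.I +
            Complex.I * ((θ * ((i : ℤ) - (N / 2 : ℕ) : ℤ) : ℝ) : ℂ) =
            Complex.I * (θ * ((i + 1 : ℕ) - (N / 2 : ℕ) - 1 / 2)) := by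
          rw [Complex.ofReal_mul, Complex.ofReal_intCast, Int.cast_sub, Int.cast_natCast,
            Int.cast_natCast, Nat.cast_add, Nat.cast_one]
          ring
        rw [e1, e2]; ring
      rw [Finset.mul_sum, Finset.sum_congr rfl hstep, Finset.sum_range_sub, h2i, hg]
      simp only
      have hN2 : ((N / 2 : ℕ) : ℂ) = (N - 1) / 2 := by
        obtain ⟨k, hk⟩ := hN
        have hk2 : N / 2 = k := by omega
        rw [hk2, hk]; push_cast; ring
      rw [hN2]
      have e1 : Complex.I * (θ * (N - (N - 1) / 2 - 1 / 2)) = (N * θ / 2 : ℂ) * Complex.I := by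
        ring
      have e2 : Complex.I * (θ * ((0 : ℕ) - (N - 1) / 2 - 1 / 2)) =
          -(N * θ / 2 : ℂ) * Complex.I := by push_cast; ring
      rw [e1, e2]; ring
    have hS : ∑ i ∈ Finset.range N,
        Complex.exp (Complex.I * ((θ * ((i : ℤ) - (N / 2 : ℕ) : ℤ) : ℝ) : ℂ)) =
        Complex.sin (N * θ / 2 : ℂ) / Complex.sin (θ / 2 : ℂ) := by
      rw [eq_div_iff hsin, mul_comm]; exact hkey
    rw [hS]
    push_cast
    have e1 : (x : ℂ) / 2 = N * θ / 2 := by rw [hx]; push_cast; ring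
    have e2 : (x : ℂ) / (2 * N) = θ / 2 := by rw [hx]; push_cast; field_simp
    rw [e1, e2]
    field_simp

theorem abs_sinRatio_le_one {N : ℕ} [NeZero N] (hN : Odd N) (x : ℝ) : |sinRatio N x| ≤ 1 := by
  have hN0 : (0 : ℝ) < N := by exact_mod_cast Nat.pos_of_ne_zero (NeZero.ne N)
  rw [← Real.norm_eq_abs, ← Complex.norm_real, sinRatio_eq_sum hN, norm_mul, norm_inv,
    Complex.norm_natCast]
  calc _ ≤ (N : ℝ)⁻¹ * ∑ w : ZMod N, (1 : ℝ) := by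
        gcongr
        refine (norm_sum_le _ _).trans (Finset.sum_le_sum fun w _ => le_of_eq ?_)
        rw [mul_comm, Complex.norm_exp_ofReal_mul_I]
    _ = 1 := by simp [hN0.ne']

/-- The numerator of the second factor cancels the denominator of the first. This is what makes
u_{j+1} the product of u_j and a one-step factor. -/
theorem sinRatio_mul (N M : ℕ) [NeZero N] [NeZero M] (x : ℝ) :
    sinRatio N x * sinRatio M (x / N) = sinRatio (N * M) x := by
  have hN : (N : ℝ) ≠ 0 := by exact_mod_cast NeZero.ne N
  have hM : (M : ℝ) ≠ 0 := by exact_mod_cast NeZero.ne M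
  have e1 : x / N / (2 * M) = x / (2 * ((N * M : ℕ) : ℝ)) := by push_cast; field_simp
  have e2 : x / N / 2 = x / (2 * N) := by field_simp
  have e3 : x / (2 * N) = M * (x / (2 * ((N * M : ℕ) : ℝ))) := by push_cast; field_simp
  have e4 : x / 2 = N * (x / (2 * N)) := by field_simp
  unfold sinRatio
  rw [e1, e2]
  by_cases h1 : Real.sin (x / (2 * ((N * M : ℕ) : ℝ))) = 0
  · have h2 : Real.sin (x / (2 * N)) = 0 := by
      rw [Real.sin_eq_zero_iff] at h1 ⊢
      obtain ⟨m, hm⟩ := h1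
      exact ⟨M * m, by rw [e3, ← hm]; push_cast; ring⟩
    rw [if_pos h1, if_pos h2, if_pos h1, one_mul]
  · by_cases h2 : Real.sin (x / (2 * N)) = 0
    -- The cancelled sine vanishes: the first factor takes its default value 1, but the numerators
    -- of the second factor and of the right-hand side are both 0.
    · have h3 : Real.sin (x / 2) = 0 := by
        rw [Real.sin_eq_zero_iff] at h2 ⊢
        obtain ⟨m, hm⟩ := h2
        exact ⟨N * m, by rw [e4, ← hm]; push_cast; ring⟩
      simp only [h1, h2, h3, if_true, if_false, zero_div, mul_zero]
    · simp only [h1, h2, if_false]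
      push_cast
      field_simp

/-- Jordan's inequality bounds the numerator from below and sin y ≤ y bounds the denominator from
above. -/
theorem two_div_pi_le_sinRatio {N : ℕ} [NeZero N] {x : ℝ} (hx : |x| ≤ Real.pi) :
    2 / Real.pi ≤ sinRatio N x := by
  have hN : (1 : ℝ) ≤ N := by exact_mod_cast Nat.pos_of_ne_zero (NeZero.ne N)
  have hpi := Real.pi_pos
  have key : ∀ y : ℝ, 0 < y → y ≤ Real.pi →
      2 / Real.pi ≤ Real.sin (y / 2) / (N * Real.sin (y / (2 * N))) := by
    intro y hy hyp
    have h1 : 2 / Real.pi * (y / 2) ≤ Real.sin (y / 2) :=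
      Real.mul_le_sin (by positivity) (by linarith)
    have h2 : Real.sin (y / (2 * N)) ≤ y / (2 * N) := Real.sin_le (by positivity)
    have h4 : y / (2 * N) < Real.pi := by
      have : y / (2 * N) ≤ y / 2 := div_le_div_of_nonneg_left hy.le (by norm_num) (by linarith)
      linarith
    have h3 : 0 < Real.sin (y / (2 * N)) := Real.sin_pos_of_pos_of_lt_pi (by positivity) h4
    rw [le_div_iff₀ (by positivity)]
    calc 2 / Real.pi * (N * Real.sin (y / (2 * N))) ≤ 2 / Real.pi * (N * (y / (2 * N))) := by
          gcongr
      _ = 2 / Real.pi * (y / 2) := by field_simp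
      _ ≤ _ := h1
  unfold sinRatio
  split_ifs with h
  · rw [div_le_one hpi]; exact Real.two_le_pi
  · rcases lt_trichotomy x 0 with h0 | h0 | h0
    · have := key (-x) (by linarith) (by rw [abs_of_neg h0] at hx; exact hx)
      rw [neg_div, neg_div, Real.sin_neg, Real.sin_neg, mul_neg, neg_div_neg_eq] at this
      exact this
    · simp [h0] at h
    · exact key x h0 (by rwa [abs_of_pos h0] at hx)

/-- Parseval's identity for the Dirichlet kernel. -/
theorem sum_sinRatio_sq {N : ℕ} [NeZero N] (hN : Odd N) (k : ℝ) :
    ∑ l : ZMod N, sinRatio N (k + 2 * Real.pi * l.valMinAbs) ^ 2 = 1 := by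
  have hN0 : (N : ℂ) ≠ 0 := by exact_mod_cast NeZero.ne N
  set g : ZMod N → ℂ := fun w => Complex.exp (Complex.I * ((k / N * w.valMinAbs : ℝ) : ℂ)) with hg
  have hgn : ∀ w, star (g w) * g w = 1 := by
    intro w
    have h : ‖g w‖ = 1 := by
      simp only [hg]; rw [mul_comm, Complex.norm_exp_ofReal_mul_I]
    have := Complex.conj_mul' (g w)
    rw [h] at this
    simpa using this
  have h1 : ∀ l : ZMod N, ((sinRatio N (k + 2 * Real.pi * l.valMinAbs) : ℝ) : ℂ) =
      (N : ℂ)⁻¹ * ∑ w, g w * ZMod.stdAddChar (l * w) := by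
    intro l
    rw [sinRatio_eq_sum hN]
    congr 1
    refine Finset.sum_congr rfl fun w _ => ?_
    have h2 : l * w = ((l.valMinAbs * w.valMinAbs : ℤ) : ZMod N) := by simp
    rw [h2, ZMod.stdAddChar_coe, hg, ← Complex.exp_add]
    congr 1
    push_cast; field_simp
  have h2 : ((∑ l : ZMod N, sinRatio N (k + 2 * Real.pi * l.valMinAbs) ^ 2 : ℝ) : ℂ) = 1 := by
    push_cast
    have h3 : ∀ l : ZMod N, ((sinRatio N (k + 2 * Real.pi * l.valMinAbs) : ℝ) : ℂ) ^ 2 =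
        (N : ℂ)⁻¹ ^ 2 * ∑ w, ∑ w', star (g w) * g w' * ZMod.stdAddChar (l * (w' - w)) := by
      intro l
      -- The value is real, so one of the two factors of the square may be written through the
      -- conjugate sum; orthogonality of characters then applies.
      have h4 : ((sinRatio N (k + 2 * Real.pi * l.valMinAbs) : ℝ) : ℂ) =
          (N : ℂ)⁻¹ * ∑ w, star (g w) * ZMod.stdAddChar (l * (-w)) := by
        rw [← Complex.conj_ofReal, h1, map_mul, map_sum, map_inv₀, map_natCast]
        congr 1
        refine Finset.sum_congr rfl fun w _ => ?_
        rw [map_mul, ← AddChar.map_neg_eq_conj, mul_neg]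
        rfl
      rw [sq]
      nth_rewrite 1 [h4]
      rw [h1, mul_mul_mul_comm, ← sq, Finset.sum_mul_sum]
      congr 1
      refine Finset.sum_congr rfl fun w _ => Finset.sum_congr rfl fun w' _ => ?_
      rw [mul_mul_mul_comm, ← AddChar.map_add_eq_mul]
      congr 2; ring
    rw [Finset.sum_congr rfl fun l _ => h3 l, ← Finset.mul_sum, Finset.sum_comm]
    have h5 : ∀ w : ZMod N, ∑ l : ZMod N, ∑ w', star (g w) * g w' *
        ZMod.stdAddChar (l * (w' - w)) = N := by
      intro w
      rw [Finset.sum_comm]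
      simp_rw [← Finset.mul_sum, AddChar.sum_mulShift _ (ZMod.isPrimitive_stdAddChar _),
        sub_eq_zero]
      rw [Finset.sum_eq_single w]
      · rw [if_pos rfl, hgn]; simp
      · intro b _ hb; simp [hb]
      · simp
    rw [Finset.sum_congr rfl fun w _ => h5 w]
    rw [Finset.sum_const, Finset.card_univ, ZMod.card, nsmul_eq_mul]
    field_simp
  exact_mod_cast h2

theorem inv_card_mul_sum_exp {N : ℕ} [NeZero N] (hN : Odd N) (p e : ℝ) :
    (Fintype.card (ZMod N) : ℂ)⁻¹ *
      ∑ z : ZMod N, Complex.exp (Complex.I * ((p : ℂ) * ((e : ℂ) * ((z.valMinAbs : ℤ) : ℂ)))) =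
        ((sinRatio N (N * e * p) : ℝ) : ℂ) := by
  have hN0 : (N : ℂ) ≠ 0 := by exact_mod_cast NeZero.ne N
  rw [sinRatio_eq_sum hN, ZMod.card]
  congr 1
  refine Finset.sum_congr rfl fun z _ => ?_
  congr 2
  push_cast
  field_simp

/-! ### Averages over windows -/

section Window

variable {L t s j : ℕ}

theorem odd_Ldir (hL : Odd L) (ν : Fin 4) : Odd (Ldir L ν) := by
  unfold Ldir; split_ifs
  · exact hL.pow
  · exact hL

/-- The translation by `c`. -/
def tr (c : Lat L t s j) : Matrix (Lat L t s j) (Lat L t s j) ℂ :=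
  Matrix.of fun u v => if v = u + c then 1 else 0

/-- The number of points in direction `ν` of the window with directions `D`. -/
def winSize (L j : ℕ) (D : Finset (Fin 4)) (ν : Fin 4) : ℕ := if ν ∈ D then Ldir L ν ^ j else 1

instance instNeZeroWinSize (L j : ℕ) [NeZero L] (D : Finset (Fin 4)) (ν : Fin 4) :
    NeZero (winSize L j D ν) := by
  unfold winSize; split_ifs <;> infer_instance

/-- The displacements in the window with directions `D`. -/
def winPt (t s : ℕ) (D : Finset (Fin 4)) (w : ∀ ν, ZMod (winSize L j D ν)) : Lat L t s j :=
  fun ν => (((w ν).valMinAbs : ℤ) : ZMod (size L t s j ν))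

/-- The average over the window with directions `D`. -/
def winAvg (L t s j : ℕ) [NeZero L] (D : Finset (Fin 4)) : Matrix (Lat L t s j) (Lat L t s j) ℂ :=
  (Fintype.card (∀ ν, ZMod (winSize L j D ν)) : ℂ)⁻¹ • ∑ w, tr (winPt t s D w)

variable [NeZero L]

theorem expBd_tr {m R : ℝ} (hm : 0 ≤ m) (c : Lat L t s j) (hc : d1 0 c ≤ R) :
    ExpBd d1 m (Real.exp (m * R)) (tr c) := by
  have hd : ∀ u : Lat L t s j, d1 u (u + c) = d1 0 c := by
    intro u; simp [d1]
  constructor <;> intro u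
  · rw [Finset.sum_eq_single (u + c)]
    · rw [hd]; simp only [tr, Matrix.of_apply, if_true, norm_one, mul_one]; gcongr
    · intro v _ hv; simp [tr, hv]
    · simp
  · rw [Finset.sum_eq_single (u - c)]
    · have := hd (u - c)
      rw [sub_add_cancel] at this
      simp only [this, tr, Matrix.of_apply, Matrix.transpose_apply, sub_add_cancel, if_true, norm_one,
        mul_one]
      gcongr
    · intro v _ hv
      have : u ≠ v + c := fun h => hv (by rw [h]; abel)
      simp [tr, this]
    · simp

theorem tr_mul_charMat {ι : Type*} [Fintype ι] [DecidableEq ι] (lab : ι → Fin 4 → ℤ)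
    (c : Lat L t s j) :
    tr c * charMat L t s j lab = charMat L t s j lab * Matrix.diagonal fun i => chi (lab i) c := by
  ext u i
  rw [Matrix.mul_diagonal, Matrix.mul_apply, Finset.sum_eq_single (u + c)]
  · simp [tr, charMat, chi_add]
  · intro v _ hv; simp [tr, hv]
  · simp

theorem winSize_le (D : Finset (Fin 4)) (ν : Fin 4) : winSize L j D ν ≤ Ldir L ν ^ j := by
  unfold winSize; split_ifs
  · exact le_rfl
  · exact Nat.one_le_pow _ _ (Ldir_pos L ν)

/-- Each of the four directions contributes at most half a unit. -/
theorem d1_intCast_le (z : Fin 4 → ℤ) (hz : ∀ ν, 2 * |z ν| ≤ (Ldir L ν : ℤ) ^ j) :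
    d1 (0 : Lat L t s j) (fun ν => (z ν : ZMod (size L t s j ν))) ≤ 2 := by
  unfold d1
  have : ∀ ν : Fin 4, eps L j ν * |(((0 : Lat L t s j) ν -
      (z ν : ZMod (size L t s j ν))).valMinAbs : ℝ)| ≤ 1 / 2 := by
    intro ν
    have h1 : |(((0 : Lat L t s j) ν - (z ν : ZMod (size L t s j ν))).valMinAbs : ℝ)| ≤ |(z ν : ℝ)| := by
      rw [Pi.zero_apply, zero_sub]
      have h2 := abs_valMinAbs_neg (z ν : ZMod (size L t s j ν))
      have h3 := abs_valMinAbs_intCast_le (size L t s j ν) (z ν)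
      rw [← h2] at h3
      exact_mod_cast h3
    have h4 : 2 * |(z ν : ℝ)| ≤ (Ldir L ν : ℝ) ^ j := by exact_mod_cast hz ν
    have hL : (0 : ℝ) < Ldir L ν := by exact_mod_cast Ldir_pos L ν
    calc _ ≤ eps L j ν * ((Ldir L ν : ℝ) ^ j / 2) := by
          have := eps_pos (L := L) (j := j) ν
          gcongr; linarith
      _ = 1 / 2 := by simp only [eps]; field_simp
  calc _ ≤ ∑ ν : Fin 4, (1 / 2 : ℝ) := Finset.sum_le_sum fun ν _ => this ν
    _ = 2 := by simp; norm_num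

theorem d1_winPt_le (D : Finset (Fin 4)) (w : ∀ ν, ZMod (winSize L j D ν)) :
    d1 0 (winPt t s D w) ≤ 2 := by
  refine d1_intCast_le (fun ν => (w ν).valMinAbs) fun ν => ?_
  refine (two_mul_abs_valMinAbs_le _ (w ν)).trans ?_
  exact_mod_cast winSize_le D ν

/-- The operator is an average of translations by distances at most 2. -/
theorem expBd_winAvg {m : ℝ} (hm : 0 ≤ m) (D : Finset (Fin 4)) :
    ExpBd d1 m (Real.exp (2 * m)) (winAvg L t s j D) := by
  have h := (ExpBd.sum Finset.univ fun w (_ : w ∈ Finset.univ) =>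
    expBd_tr hm (winPt (L := L) (j := j) t s D w) (d1_winPt_le D w)).smul
      (Fintype.card (∀ ν, ZMod (winSize L j D ν)) : ℂ)⁻¹
  refine h.mono le_rfl (le_of_eq ?_) isDist_d1.nonneg
  have hc : (Fintype.card (∀ ν, ZMod (winSize L j D ν)) : ℝ) ≠ 0 := by
    exact_mod_cast Fintype.card_ne_zero
  rw [norm_inv, Complex.norm_natCast, Finset.sum_const, Finset.card_univ, nsmul_eq_mul, mul_comm m,
    ← mul_assoc, inv_mul_cancel₀ hc, one_mul]

theorem winAvg_mul_charMat (hL : Odd L) {ι : Type*} [Fintype ι] [DecidableEq ι]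
    (lab : ι → Fin 4 → ℤ) (D : Finset (Fin 4)) :
    winAvg L t s j D * charMat L t s j lab = charMat L t s j lab * Matrix.diagonal fun i =>
      ((∏ ν ∈ D, uFactor L j (pmom L t s (lab i)) ν : ℝ) : ℂ) := by
  rw [winAvg, Matrix.smul_mul, Matrix.sum_mul]
  simp_rw [tr_mul_charMat]
  rw [← Matrix.mul_sum, ← Matrix.mul_smul]
  congr 1
  ext i i'
  rw [Matrix.smul_apply, Matrix.sum_apply]
  by_cases hi : i = i'
  · subst hi
    simp only [Matrix.diagonal_apply_eq]
    have h1 : ∀ w : ∀ ν, ZMod (winSize L j D ν), chi (lab i) (winPt t s D w) =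
        ∏ ν, Complex.exp (Complex.I *
          ((pmom L t s (lab i) ν * (eps L j ν * (w ν).valMinAbs) : ℝ) : ℂ)) := by
      intro w
      have h2 := chi_intCast (t := t) (s := s) (j := j) (L := L) (lab i) fun ν => (w ν).valMinAbs
      rw [Complex.ofReal_sum, Finset.mul_sum, Complex.exp_sum] at h2
      exact h2
    simp_rw [h1]
    rw [sum_prod_pi fun ν (z : ZMod (winSize L j D ν)) => Complex.exp (Complex.I *
          ((pmom L t s (lab i) ν * (eps L j ν * z.valMinAbs) : ℝ) : ℂ))]
    rw [Fintype.card_pi, smul_eq_mul]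
    push_cast
    rw [← Finset.prod_inv_distrib, ← Finset.prod_mul_distrib, ← Finset.prod_subset
      (Finset.subset_univ D)]
    · refine Finset.prod_congr rfl fun ν hν => ?_
      have hw : winSize L j D ν = Ldir L ν ^ j := by simp [winSize, hν]
      have hLd : (Ldir L ν : ℝ) ≠ 0 := by exact_mod_cast (Ldir_pos L ν).ne'
      rw [inv_card_mul_sum_exp (by rw [hw]; exact (odd_Ldir hL ν).pow), hw, uFactor]
      congr 2
      simp only [eps]
      push_cast
      field_simp
    -- Outside D the window is a single point, and its factor is 1.
    · intro ν _ hν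
      have hw : winSize L j D ν = 1 := by simp [winSize, hν]
      rw [inv_card_mul_sum_exp (by rw [hw]; exact odd_one), hw]
      simp [sinRatio]
  · simp [Matrix.diagonal_apply_ne _ hi]

theorem winPt_univ_injective : Function.Injective (winPt (L := L) (j := j) t s Finset.univ) := by
  intro w w' h
  ext ν
  have h1 := congrFun h ν
  simp only [winPt] at h1
  rw [ZMod.intCast_eq_intCast_iff_dvd_sub] at h1
  have hw : winSize L j Finset.univ ν = Ldir L ν ^ j := by simp [winSize]
  have h2 : ((winSize L j Finset.univ ν : ℕ) : ℤ) ∣ (w' ν).valMinAbs - (w ν).valMinAbs := by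
    refine dvd_trans ?_ h1
    rw [congrArg (Nat.cast : ℕ → ℤ) hw]
    exact Int.natCast_dvd_natCast.2 ⟨_, rfl⟩
  rw [← ZMod.intCast_eq_intCast_iff_dvd_sub] at h2
  simpa using h2

/-- The displacements in the full window are distinct points of the torus, so each matrix entry
receives at most one translation. There are weight⁻¹ of them, all of length at most 2. -/
theorem ptBd_winAvg {m : ℝ} (hm : 0 ≤ m) :
    PtBd d1 m (Real.exp (2 * m) * weight L j) (winAvg L t s j Finset.univ) := by
  intro u v
  have hcard : (Fintype.card (∀ ν, ZMod (winSize L j Finset.univ ν)) : ℝ)⁻¹ = weight L j := by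
    rw [weight_eq_prod_eps, Fintype.card_pi]
    push_cast
    rw [← Finset.prod_inv_distrib]
    refine Finset.prod_congr rfl fun ν _ => ?_
    rw [ZMod.card]
    simp [winSize, eps]
  rw [winAvg, Matrix.smul_apply, norm_smul, norm_inv, Complex.norm_natCast, hcard,
    Matrix.sum_apply, mul_comm (Real.exp (2 * m)), mul_assoc]
  have hwp := weight_pos (L := L) (j := j)
  gcongr
  by_cases hex : ∃ w, v = u + winPt (L := L) (j := j) t s Finset.univ w
  · obtain ⟨w, hw⟩ := hex
    rw [Finset.sum_eq_single w]
    · simp only [tr, Matrix.of_apply, hw, if_true, norm_one]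
      rw [← Real.exp_add]
      refine Real.one_le_exp ?_
      have h1 := d1_winPt_le (t := t) (s := s) Finset.univ w
      have h2 : d1 u (u + winPt t s Finset.univ w) = d1 0 (winPt t s Finset.univ w) := by simp [d1]
      rw [h2]
      nlinarith
    · intro w' _ hne
      simp only [tr, Matrix.of_apply]
      rw [if_neg]
      rw [hw]
      intro h
      exact hne (winPt_univ_injective (add_left_cancel h)).symm
    · simp
  · push Not at hex
    rw [Finset.sum_eq_zero]
    · simp; positivity
    · intro w _; simp [tr, hex w]

end Window

end

end PBS


namespace PBS

noncomputable section

/-! ### Fourier multipliers -/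

section Multiplier

variable {L t s j : ℕ} [NeZero L] {ι : Type*} [Fintype ι] [DecidableEq ι] {lab : ι → Fin 4 → ℤ}

/-- The Fourier multiplier with symbol `f`. -/
def mulMat (L t s j : ℕ) [NeZero L] (lab : ι → Fin 4 → ℤ) (f : ι → ℂ) :
    Matrix (Lat L t s j) (Lat L t s j) ℂ :=
  (Fintype.card (Lat L t s j) : ℂ)⁻¹ •
    (charMat L t s j lab * Matrix.diagonal f * (charMat L t s j lab).conjTranspose)

theorem eq_mulMat (h : IsLabel L t s j lab) {f : ι → ℂ}
    {A : Matrix (Lat L t s j) (Lat L t s j) ℂ}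
    (hA : A * charMat L t s j lab = charMat L t s j lab * Matrix.diagonal f) :
    A = mulMat L t s j lab f := eq_of_mul_charMat h hA

theorem mulMat_mul_charMat (h : IsLabel L t s j lab) (f : ι → ℂ) :
    mulMat L t s j lab f * charMat L t s j lab = charMat L t s j lab * Matrix.diagonal f := by
  rw [mulMat, Matrix.smul_mul, Matrix.mul_assoc, charMat_conjTranspose_mul h, Matrix.mul_smul,
    smul_smul, inv_mul_cancel₀ card_ne_zero, one_smul, Matrix.mul_one]

theorem conjTranspose_mul_mulMat (h : IsLabel L t s j lab) (f : ι → ℂ) :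
    (charMat L t s j lab).conjTranspose * mulMat L t s j lab f =
      Matrix.diagonal f * (charMat L t s j lab).conjTranspose := by
  rw [mulMat, Matrix.mul_smul, ← Matrix.mul_assoc, ← Matrix.mul_assoc, charMat_conjTranspose_mul h,
    Matrix.smul_mul, Matrix.smul_mul, smul_smul, inv_mul_cancel₀ card_ne_zero, one_smul,
    Matrix.one_mul]

theorem mulMat_mul (h : IsLabel L t s j lab) (f g : ι → ℂ) :
    mulMat L t s j lab f * mulMat L t s j lab g = mulMat L t s j lab (f * g) := by
  refine eq_mulMat h ?_
  rw [Matrix.mul_assoc, mulMat_mul_charMat h, ← Matrix.mul_assoc, mulMat_mul_charMat h,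
    Matrix.mul_assoc, Matrix.diagonal_mul_diagonal]
  rfl

theorem mulMat_one (h : IsLabel L t s j lab) : mulMat L t s j lab 1 = 1 := by
  refine (eq_mulMat h ?_).symm
  have : (Matrix.diagonal 1 : Matrix ι ι ℂ) = 1 := Matrix.diagonal_one
  rw [this, Matrix.one_mul, Matrix.mul_one]

theorem mulMat_pow (h : IsLabel L t s j lab) (f : ι → ℂ) (k : ℕ) :
    mulMat L t s j lab f ^ k = mulMat L t s j lab (f ^ k) := by
  induction k with
  | zero => simp [mulMat_one h]
  | succ k ih => rw [pow_succ, ih, mulMat_mul h, pow_succ]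

theorem mulMat_add (f g : ι → ℂ) :
    mulMat L t s j lab (f + g) = mulMat L t s j lab f + mulMat L t s j lab g := by
  have : Matrix.diagonal (f + g) = Matrix.diagonal f + Matrix.diagonal g :=
    (Matrix.diagonal_add f g).symm
  rw [mulMat, mulMat, mulMat, this, Matrix.mul_add, Matrix.add_mul, smul_add]

theorem mulMat_smul (c : ℂ) (f : ι → ℂ) :
    mulMat L t s j lab (c • f) = c • mulMat L t s j lab f := by
  rw [mulMat, mulMat, Matrix.diagonal_smul, Matrix.mul_smul, Matrix.smul_mul, smul_comm]

theorem mulMat_sub (f g : ι → ℂ) :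
    mulMat L t s j lab (f - g) = mulMat L t s j lab f - mulMat L t s j lab g := by
  have h1 := mulMat_add (L := L) (t := t) (s := s) (j := j) (lab := lab) f ((-1 : ℂ) • g)
  rw [mulMat_smul] at h1
  simpa [sub_eq_add_neg] using h1

theorem mulMat_sum {κ : Type*} (S : Finset κ) (f : κ → ι → ℂ) :
    mulMat L t s j lab (∑ k ∈ S, f k) = ∑ k ∈ S, mulMat L t s j lab (f k) := by
  classical
  induction S using Finset.induction_on with
  | empty => simp [mulMat]
  | insert a S ha ih => rw [Finset.sum_insert ha, Finset.sum_insert ha, mulMat_add, ih]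

theorem mulMat_apply (f : ι → ℂ) (u v : Lat L t s j) :
    mulMat L t s j lab f u v =
      (Fintype.card (Lat L t s j) : ℂ)⁻¹ * ∑ i, f i * chi (lab i) (u - v) := by
  rw [mulMat, Matrix.smul_apply, smul_eq_mul, Matrix.mul_apply]
  congr 1
  refine Finset.sum_congr rfl fun i _ => ?_
  rw [Matrix.mul_diagonal]
  simp only [charMat, Matrix.conjTranspose_apply, Matrix.of_apply]
  have h1 : chi (lab i) (u - v) * chi (lab i) v = chi (lab i) u := by
    rw [← chi_add, sub_add_cancel]
  have h2 : chi (lab i) v * star (chi (lab i) v) = 1 := by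
    have := Complex.mul_conj' (chi (lab i) v)
    rw [norm_chi] at this
    simpa using this
  rw [← h1]
  linear_combination f i * chi (lab i) (u - v) * h2

theorem l2_mulMat_lower (h : IsLabel L t s j lab) {f : ι → ℂ} {c : ℝ} (hc : 0 ≤ c)
    (hf : ∀ i, c ≤ ‖f i‖) (x : Lat L t s j → ℂ) :
    c * l2 x ≤ l2 ((mulMat L t s j lab f).mulVec x) := by
  have hcard : 0 < √(Fintype.card (Lat L t s j) : ℝ) :=
    Real.sqrt_pos.2 (by exact_mod_cast Fintype.card_pos)
  refine le_of_mul_le_mul_left ?_ hcard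
  rw [← l2_conjTranspose_charMat h, Matrix.mulVec_mulVec, conjTranspose_mul_mulMat h,
    ← Matrix.mulVec_mulVec, mul_left_comm, ← l2_conjTranspose_charMat h]
  set y := (charMat L t s j lab).conjTranspose.mulVec x
  refine le_of_sq_le_sq ?_ (l2_nonneg _)
  rw [mul_pow, l2_sq, l2_sq, Finset.mul_sum]
  refine Finset.sum_le_sum fun i _ => ?_
  rw [Matrix.mulVec_diagonal, norm_mul, mul_pow]
  gcongr
  exact hf i

end Multiplier

/-! ### Operators from the fine to the unit lattice -/

section Coarse

variable {L t s j : ℕ} [NeZero L]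

/-- The matrix of the restriction of momenta `k + ℓ ↦ k` with weights `w`. -/
def selMat (w : Lat L t s 0 × Bdual L j → ℂ) :
    Matrix (Lat L t s 0) (Lat L t s 0 × Bdual L j) ℂ :=
  Matrix.of fun κ i => if i.1 = κ then w i else 0

/-- The operator `φ ↦ ψ` with `ψ^(k) = ∑ ℓ, w(k, ℓ) φ^(k + ℓ)`. -/
def coarse (w : Lat L t s 0 × Bdual L j → ℂ) : Matrix (Lat L t s 0) (Lat L t s j) ℂ :=
  (Fintype.card (Lat L t s j) : ℂ)⁻¹ • (charMat L t s 0 (labMin L t s 0) * selMat w *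
    (charMat L t s j (labPair L t s j)).conjTranspose)

/-- The multiplier on the unit lattice with symbol `f`. -/
abbrev mulUnit (f : Lat L t s 0 → ℂ) : Matrix (Lat L t s 0) (Lat L t s 0) ℂ :=
  mulMat L t s 0 (labMin L t s 0) f

/-- Aliasing: ℓ is a multiple of 2π in each component, so the momenta k + ℓ and k cannot be
distinguished on the unit lattice. -/
theorem chi_labPair_unit (i : Lat L t s 0 × Bdual L j) (x : Lat L t s 0) :
    chi (labPair L t s j i) x = chi (labMin L t s 0 i.1) x := by
  unfold chi
  refine Finset.prod_congr rfl fun ν _ => ?_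
  congr 2
  have h : ((period L t s ν : ℕ) : ZMod (size L t s 0 ν)) = 0 := by
    have : period L t s ν = size L t s 0 ν := by simp [size]
    rw [congrArg (Nat.cast : ℕ → ZMod (size L t s 0 ν)) this]
    simp
  simp [labPair, labMin, h]

theorem eq_coarse {A : Matrix (Lat L t s 0) (Lat L t s j) ℂ} {w : Lat L t s 0 × Bdual L j → ℂ}
    (h : ∀ i x, ∑ u, A x u * chi (labPair L t s j i) u = w i * chi (labPair L t s j i) x) :
    A = coarse w := by
  refine eq_of_mul_charMat isLabel_labPair ?_
  ext x i
  rw [Matrix.mul_apply, Matrix.mul_apply, Finset.sum_eq_single i.1]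
  · simp only [charMat, selMat, Matrix.of_apply, if_true]
    rw [h, chi_labPair_unit, mul_comm]
  · intro κ _ hκ
    simp [selMat, hκ.symm]
  · simp

/-- Evaluating a translation invariant operator only at unit lattice points keeps its symbol. Kernel
bounds for averaging operators thereby reduce to kernel bounds for multipliers on the fine lattice.
-/
theorem submatrix_emb_eq_coarse {G : Matrix (Lat L t s j) (Lat L t s j) ℂ}
    {w : Lat L t s 0 × Bdual L j → ℂ}
    (hG : G * charMat L t s j (labPair L t s j) =
      charMat L t s j (labPair L t s j) * Matrix.diagonal w) :
    G.submatrix (emb j) id = coarse w := by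
  refine eq_coarse fun i x => ?_
  have := congrFun (congrFun hG (emb j x)) i
  rw [Matrix.mul_apply, Matrix.mul_diagonal] at this
  simp only [charMat, Matrix.of_apply] at this
  rw [chi_emb] at this
  simpa [mul_comm] using this

theorem weight_mul_card : weight L j * Fintype.card (Lat L t s j) = Fintype.card (Lat L t s 0) := by
  rw [weight_eq_prod_eps, Fintype.card_pi, Fintype.card_pi]
  push_cast
  rw [← Finset.prod_mul_distrib]
  refine Finset.prod_congr rfl fun ν _ => ?_
  have hL : (Ldir L ν : ℝ) ≠ 0 := by exact_mod_cast (Ldir_pos L ν).ne'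
  rw [ZMod.card, ZMod.card, size_eq_mul L t s j, eps]
  push_cast
  field_simp

theorem weight_mul_card' : ((weight L j : ℝ) : ℂ) * (Fintype.card (Lat L t s j) : ℂ) =
    Fintype.card (Lat L t s 0) := by
  exact_mod_cast congrArg (fun x : ℝ => (x : ℂ)) (weight_mul_card (L := L) (t := t) (s := s))

theorem weight_ne_zero : ((weight L j : ℝ) : ℂ) ≠ 0 := by
  exact_mod_cast weight_pos.ne'

theorem selMat_mul_conjTranspose (w v : Lat L t s 0 × Bdual L j → ℂ) :
    selMat w * (selMat v).conjTranspose =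
      Matrix.diagonal fun κ => ∑ l, w (κ, l) * star (v (κ, l)) := by
  ext κ κ'
  rw [Matrix.mul_apply, Fintype.sum_prod_type]
  simp only [selMat, Matrix.conjTranspose_apply, Matrix.of_apply]
  by_cases h : κ = κ'
  · subst h
    rw [Matrix.diagonal_apply_eq, Finset.sum_eq_single κ]
    · simp
    · intro b _ hb; simp [hb]
    · simp
  · rw [Matrix.diagonal_apply_ne _ h]
    refine Finset.sum_eq_zero fun b _ => Finset.sum_eq_zero fun l _ => ?_
    by_cases hb : b = κ
    · simp [hb, h]
    · simp [hb]

theorem coarse_conjTranspose (v : Lat L t s 0 × Bdual L j → ℂ) :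
    (coarse v).conjTranspose = (Fintype.card (Lat L t s j) : ℂ)⁻¹ •
      (charMat L t s j (labPair L t s j) * (selMat v).conjTranspose *
        (charMat L t s 0 (labMin L t s 0)).conjTranspose) := by
  rw [coarse, Matrix.conjTranspose_smul, Matrix.conjTranspose_mul, Matrix.conjTranspose_mul,
    Matrix.conjTranspose_conjTranspose, Matrix.mul_assoc]
  simp

/-- Orthogonality of the fine characters leaves, for each k, the sum over the fibre ℓ; the
normalisations match because weight times the number of fine points is the number of unit points. -/
theorem coarse_mul_conjTranspose (w v : Lat L t s 0 × Bdual L j → ℂ) :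
    ((weight L j : ℝ) : ℂ)⁻¹ • (coarse w * (coarse v).conjTranspose) =
      mulUnit fun κ => ∑ l, w (κ, l) * star (v (κ, l)) := by
  rw [coarse_conjTranspose, coarse, mulUnit, mulMat, ← selMat_mul_conjTranspose, Matrix.smul_mul,
    Matrix.mul_smul, smul_smul, smul_smul]
  set E := charMat L t s j (labPair L t s j)
  set E0 := charMat L t s 0 (labMin L t s 0)
  have h : E0 * selMat w * E.conjTranspose * (E * (selMat v).conjTranspose * E0.conjTranspose) =
      (Fintype.card (Lat L t s j) : ℂ) •
        (E0 * (selMat w * (selMat v).conjTranspose) * E0.conjTranspose) := by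
    calc _ = E0 * selMat w * (E.conjTranspose * E) *
          ((selMat v).conjTranspose * E0.conjTranspose) := by simp only [Matrix.mul_assoc]
      _ = _ := by
        rw [charMat_conjTranspose_mul isLabel_labPair, Matrix.mul_smul, Matrix.mul_one,
          Matrix.smul_mul]
        simp only [Matrix.mul_assoc]
  rw [h, smul_smul]
  congr 1
  have h1 := weight_mul_card' (L := L) (j := j) (t := t) (s := s)
  have h2 := weight_ne_zero (L := L) (j := j)
  have h3 := card_ne_zero (L := L) (j := j) (t := t) (s := s)
  rw [← h1]
  field_simp

/-- The lower bound on `ℓ²` for `D + Q^+ 𝔔 Q^-`, from the bounds in each fibre. -/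
theorem l2_lower_of_fibre {d : Lat L t s 0 × Bdual L j → ℂ} {v w : Lat L t s 0 × Bdual L j → ℂ}
    {Q : Lat L t s 0 → ℂ} {C : ℝ} (hC : 0 ≤ C)
    (hfib : ∀ κ (x y : Bdual L j → ℂ),
      (∀ l, y l = d (κ, l) * x l + Q κ * star (v (κ, l)) * ∑ l', w (κ, l') * x l') →
      l2 x ≤ C * l2 y) (x : Lat L t s j → ℂ) :
    l2 x ≤ C * l2 ((mulMat L t s j (labPair L t s j) d + ((weight L j : ℝ) : ℂ)⁻¹ •
      ((coarse v).conjTranspose * mulUnit Q * coarse w)).mulVec x) := by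
  set E := charMat L t s j (labPair L t s j) with hE
  set E0 := charMat L t s 0 (labMin L t s 0) with hE0
  set K := mulMat L t s j (labPair L t s j) d + ((weight L j : ℝ) : ℂ)⁻¹ •
      ((coarse v).conjTranspose * mulUnit Q * coarse w) with hK
  have h1 := weight_mul_card' (L := L) (j := j) (t := t) (s := s)
  have h2 := weight_ne_zero (L := L) (j := j)
  have h3 := card_ne_zero (L := L) (j := j) (t := t) (s := s)
  -- The Fourier transform intertwines K with a matrix that is block diagonal in k: in each block a
  -- diagonal matrix plus a rank one matrix. The volume factors cancel by `weight_mul_card'`.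
  have hEK : E.conjTranspose * K =
      (Matrix.diagonal d + (selMat v).conjTranspose * Matrix.diagonal Q * selMat w) *
        E.conjTranspose := by
    rw [hK, Matrix.mul_add, conjTranspose_mul_mulMat isLabel_labPair, Matrix.add_mul]
    congr 1
    rw [coarse_conjTranspose, coarse, mulUnit, mulMat, ← hE, ← hE0]
    have : E.conjTranspose * (E * (selMat v).conjTranspose * E0.conjTranspose *
        (E0 * Matrix.diagonal Q * E0.conjTranspose) * (E0 * selMat w * E.conjTranspose)) =
        ((Fintype.card (Lat L t s j) : ℂ) * Fintype.card (Lat L t s 0) *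
          Fintype.card (Lat L t s 0)) •
        ((selMat v).conjTranspose * Matrix.diagonal Q * selMat w * E.conjTranspose) := by
      calc _ = (E.conjTranspose * E) * (selMat v).conjTranspose * (E0.conjTranspose * E0) *
            Matrix.diagonal Q * (E0.conjTranspose * E0) * selMat w * E.conjTranspose := by
              simp only [Matrix.mul_assoc]
        _ = _ := by
          rw [charMat_conjTranspose_mul isLabel_labPair, charMat_conjTranspose_mul isLabel_labMin]
          simp only [Matrix.smul_mul, Matrix.mul_smul, Matrix.one_mul, Matrix.mul_one, smul_smul]
          congr 1; ring
    simp only [Matrix.smul_mul, Matrix.mul_smul, smul_smul]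
    rw [this, smul_smul]
    conv_rhs => rw [← one_smul ℂ ((selMat v).conjTranspose * _ * _ * _)]
    congr 1
    have h4 := card_ne_zero (L := L) (j := 0) (t := t) (s := s)
    rw [← h1] at h4 ⊢
    field_simp
  set X := E.conjTranspose.mulVec x with hX
  set Y := E.conjTranspose.mulVec (K.mulVec x) with hY
  have hYX : Y = (Matrix.diagonal d + (selMat v).conjTranspose * Matrix.diagonal Q *
      selMat w).mulVec X := by
    rw [hY, Matrix.mulVec_mulVec, hEK, ← Matrix.mulVec_mulVec]
  have hfibre : ∀ κ l, Y (κ, l) = d (κ, l) * X (κ, l) +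
      Q κ * star (v (κ, l)) * ∑ l', w (κ, l') * X (κ, l') := by
    intro κ l
    rw [hYX, Matrix.add_mulVec, Pi.add_apply, Matrix.mulVec_diagonal, ← Matrix.mulVec_mulVec,
      ← Matrix.mulVec_mulVec]
    congr 1
    rw [Matrix.mulVec, dotProduct, Finset.sum_eq_single κ]
    · rw [Matrix.mulVec_diagonal]
      simp only [Matrix.conjTranspose_apply, selMat, Matrix.of_apply, if_true]
      rw [Matrix.mulVec, dotProduct, Fintype.sum_prod_type, Finset.sum_eq_single κ]
      · simp only [Matrix.of_apply, if_true]; ring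
      · intro b _ hb; simp [hb]
      · simp
    · intro κ' _ hκ
      simp [selMat, hκ.symm]
    · simp
  have hsum : ∀ Z : Lat L t s 0 × Bdual L j → ℂ, l2 Z ^ 2 = ∑ κ, l2 (fun l => Z (κ, l)) ^ 2 := by
    intro Z
    rw [l2_sq, Fintype.sum_prod_type]
    exact Finset.sum_congr rfl fun κ _ => (l2_sq _).symm
  have hXY : l2 X ≤ C * l2 Y := by
    refine le_of_sq_le_sq ?_ (mul_nonneg hC (l2_nonneg _))
    rw [mul_pow, hsum, hsum, Finset.mul_sum]
    refine Finset.sum_le_sum fun κ _ => ?_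
    rw [← mul_pow]
    exact pow_le_pow_left₀ (l2_nonneg _) (hfib κ _ _ (hfibre κ)) 2
  rw [hX, hY, l2_conjTranspose_charMat isLabel_labPair,
    l2_conjTranspose_charMat isLabel_labPair] at hXY
  have hcard : 0 < √(Fintype.card (Lat L t s j) : ℝ) :=
    Real.sqrt_pos.2 (by exact_mod_cast Fintype.card_pos)
  refine le_of_mul_le_mul_left ?_ hcard
  linarith

/-- The distance between a point of the unit lattice and a point of the fine lattice. -/
def dEmb (x : Lat L t s 0) (u : Lat L t s j) : ℝ := d1 (emb j x) u

/-- The bounds on the kernel of an averaging operator. -/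
structure CoarseBd (C : ℝ) (A : Matrix (Lat L t s 0) (Lat L t s j) ℂ) : Prop where
  row : RowBd dEmb 1 C A
  pt : PtBd dEmb 1 (C * weight L j) A

theorem coarseBd_submatrix {C : ℝ} {G : Matrix (Lat L t s j) (Lat L t s j) ℂ}
    (h1 : ExpBd d1 1 C G) (h2 : PtBd d1 1 (C * weight L j) G) :
    CoarseBd C (G.submatrix (emb j) id) :=
  ⟨fun x => h1.row (emb j x), fun x u => h2 (emb j x) u⟩

/-- The bound for the kernels of the averaging operators. -/
def avgBound (q : ℕ) : ℝ := Real.exp 2 ^ (q + 2)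

theorem avgBound_pos (q : ℕ) : 0 < avgBound q := by unfold avgBound; positivity

/-- Averaging operators that contain one full window average. -/
theorem coarseBd_window {q a : ℕ} (ha : a + 1 ≤ q) {c : Lat L t s j} (hc : d1 0 c ≤ 2)
    (D : Finset (Fin 4)) : CoarseBd (avgBound q)
      ((tr c * winAvg L t s j Finset.univ ^ a * winAvg L t s j Finset.univ *
        winAvg L t s j D).submatrix (emb j) id) := by
  have he : (0 : ℝ) ≤ Real.exp 2 := (Real.exp_pos _).le
  have b1 : ExpBd d1 1 (Real.exp 2) (tr c) := by
    simpa using expBd_tr (m := 1) (by norm_num) c hc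
  have b2 : ∀ D, ExpBd d1 1 (Real.exp 2) (winAvg L t s j D) := fun D => by
    simpa using expBd_winAvg (L := L) (t := t) (s := s) (j := j) (m := 1) (by norm_num) D
  have b3 := (b2 Finset.univ).pow isDist_d1 (by norm_num) he a
  have b4 := b1.mul (by norm_num) he (by positivity) isDist_d1.tri b3
  have b5 : PtBd d1 1 (Real.exp 2 * weight L j) (winAvg L t s j Finset.univ) := by
    simpa using ptBd_winAvg (L := L) (t := t) (s := s) (j := j) (m := 1) (by norm_num)
  have hw := weight_pos (L := L) (j := j)
  -- The distinguished full window supplies the density; all other factors enter only through their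
  -- row and column sums.
  have b6 := PtBd.rowBd_mul (by norm_num) (by positivity) isDist_d1.tri b4.row b5
  have b7 := b6.mul_expBd (by norm_num) (by positivity) isDist_d1.tri (b2 D)
  have b8 := (b4.mul (by norm_num) (by positivity) he isDist_d1.tri (b2 Finset.univ)).mul
    (by norm_num) (by positivity) he isDist_d1.tri (b2 D)
  -- One factor e² for the translation and for each of the a + 2 windows, and a + 3 ≤ q + 2.
  have hle : Real.exp 2 * Real.exp 2 ^ a * Real.exp 2 * Real.exp 2 ≤ avgBound q := by
    rw [avgBound]
    calc _ = Real.exp 2 ^ (a + 1 + 2) := by ring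
      _ ≤ _ := pow_le_pow_right₀ (Real.one_le_exp (by norm_num)) (by omega)
  refine coarseBd_submatrix (b8.mono le_rfl hle isDist_d1.nonneg)
    (b7.mono le_rfl ?_ (by positivity) isDist_d1.nonneg)
  calc _ = Real.exp 2 * Real.exp 2 ^ a * Real.exp 2 * Real.exp 2 * weight L j := by ring
    _ ≤ _ := by gcongr

end Coarse

/-! ### The block spin averaging operators -/

section Averaging

variable {L t s : ℕ}

/-- The support of `box`. -/
def boxSet (L : ℕ) [NeZero L] : Finset (Fin 4 → ℤ) :=
  Finset.univ.image fun (w : ∀ ν, ZMod (Ldir L ν)) ν => (w ν).valMinAbs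

theorem mem_boxSet [NeZero L] (hL : Odd L) (x : Fin 4 → ℤ) :
    x ∈ boxSet L ↔ ∀ ν, 2 * |x ν| ≤ (Ldir L ν : ℤ) - 1 := by
  simp only [boxSet, Finset.mem_image, Finset.mem_univ, true_and]
  constructor
  · rintro ⟨w, rfl⟩ ν
    exact two_mul_abs_valMinAbs_le_of_odd (odd_Ldir hL ν) (w ν)
  · intro h
    exact ⟨fun ν => (x ν : ZMod (Ldir L ν)), funext fun ν => valMinAbs_intCast_eq_self (h ν)⟩

theorem box_eq_ite [NeZero L] (hL : Odd L) (x : Fin 4 → ℤ) :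
    box L x = if x ∈ boxSet L then 1 else 0 := by
  simp only [box, mem_boxSet hL]

/-- `e ^ (i θ · x)`. -/
def planeWave (θ : Fin 4 → ℝ) (x : Fin 4 → ℤ) : ℂ :=
  Complex.exp (Complex.I * ((∑ ν, θ ν * x ν : ℝ) : ℂ))

theorem planeWave_add (θ : Fin 4 → ℝ) (x y : Fin 4 → ℤ) :
    planeWave θ (x + y) = planeWave θ x * planeWave θ y := by
  rw [planeWave, planeWave, planeWave, ← Complex.exp_add]
  congr 1
  simp only [Pi.add_apply]
  push_cast
  rw [← mul_add, ← Finset.sum_add_distrib]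
  congr 1
  exact Finset.sum_congr rfl fun ν _ => by ring

theorem norm_planeWave (θ : Fin 4 → ℝ) (x : Fin 4 → ℤ) : ‖planeWave θ x‖ = 1 := by
  rw [planeWave, mul_comm, Complex.norm_exp_ofReal_mul_I]

theorem sum_boxSet [NeZero L] (hL : Odd L) (θ : Fin 4 → ℝ) :
    ∑ x ∈ boxSet L, planeWave θ x =
      (L : ℂ) ^ 5 * ((∏ ν, sinRatio (Ldir L ν) (Ldir L ν * θ ν) : ℝ) : ℂ) := by
  have hL5 : (L : ℂ) ^ 5 = ∏ ν, (Ldir L ν : ℂ) := by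
    rw [Fin.prod_univ_four]
    simp only [Ldir, if_true, Fin.isValue, one_ne_zero, if_false, Fin.reduceEq]
    push_cast; ring
  rw [boxSet, Finset.sum_image]
  · have h1 : ∀ w : ∀ ν, ZMod (Ldir L ν), planeWave θ (fun ν => (w ν).valMinAbs) =
        ∏ ν, Complex.exp (Complex.I * ((θ ν * (w ν).valMinAbs : ℝ) : ℂ)) := by
      intro w
      rw [planeWave, Complex.ofReal_sum, Finset.mul_sum, Complex.exp_sum]
    simp_rw [h1]
    rw [sum_prod_pi fun ν (z : ZMod (Ldir L ν)) =>
      Complex.exp (Complex.I * ((θ ν * z.valMinAbs : ℝ) : ℂ)), hL5, Complex.ofReal_prod,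
      ← Finset.prod_mul_distrib]
    refine Finset.prod_congr rfl fun ν _ => ?_
    have h0 : (Ldir L ν : ℂ) ≠ 0 := by exact_mod_cast (Ldir_pos L ν).ne'
    have h0' : (Ldir L ν : ℝ) ≠ 0 := by exact_mod_cast (Ldir_pos L ν).ne'
    rw [sinRatio_eq_sum (odd_Ldir hL ν), ← mul_assoc, mul_inv_cancel₀ h0, one_mul]
    refine Finset.sum_congr rfl fun z _ => ?_
    rw [mul_div_cancel_left₀ _ h0']
  · intro w _ w' _ h
    ext ν
    exact ZMod.injective_valMinAbs (congrFun h ν)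

theorem convPow_succ_eq [NeZero L] (hL : Odd L) (m : ℕ) (x : Fin 4 → ℤ) :
    convPow (box L) (m + 1) x = ∑ y ∈ boxSet L, convPow (box L) m (x - y) := by
  simp only [convPow]
  rw [tsum_eq_sum (s := boxSet L)]
  · exact Finset.sum_congr rfl fun y hy => by rw [box_eq_ite hL, if_pos hy, one_mul]
  · intro y hy; rw [box_eq_ite hL, if_neg hy, zero_mul]

/-- The Fourier series turns convolution powers into powers. Convolution with the box is a finite
sum of translates, so no question of interchanging limits arises in the induction. -/
theorem hasSum_convPow [NeZero L] (hL : Odd L) (θ : Fin 4 → ℝ) (m : ℕ) :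
    HasSum (fun x => ((convPow (box L) m x : ℝ) : ℂ) * planeWave θ x)
      ((∑ x ∈ boxSet L, planeWave θ x) ^ m) := by
  induction m with
  | zero =>
    have : (fun x => ((convPow (box L) 0 x : ℝ) : ℂ) * planeWave θ x) =
        fun x => if x = 0 then 1 else 0 := by
      ext x
      by_cases h : x = 0
      · simp [convPow, h, planeWave]
      · simp [convPow, h]
    rw [this, pow_zero]
    exact hasSum_ite_eq 0 1
  | succ m ih =>
    have h1 : ∀ y ∈ boxSet L, HasSum
        (fun x => ((convPow (box L) m (x - y) : ℝ) : ℂ) * planeWave θ x)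
        ((∑ x ∈ boxSet L, planeWave θ x) ^ m * planeWave θ y) := by
      intro y _
      have h2 := ((Equiv.subRight y).hasSum_iff.2 ih).mul_right (planeWave θ y)
      convert! h2 using 2 with x
      simp only [Function.comp, Equiv.subRight_apply]
      rw [mul_assoc, ← planeWave_add, sub_add_cancel]
    have h3 := hasSum_sum h1
    rw [← Finset.mul_sum, ← pow_succ] at h3
    convert! h3 using 2 with x
    rw [convPow_succ_eq hL]
    push_cast
    rw [Finset.sum_mul]

theorem hasSum_profile [NeZero L] (hL : Odd L) (q : ℕ) (θ : Fin 4 → ℝ) :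
    HasSum (fun x => ((profile L q x : ℝ) : ℂ) * planeWave θ x)
      (((∏ ν, sinRatio (Ldir L ν) (Ldir L ν * θ ν) : ℝ) : ℂ) ^ q) := by
  have h := (hasSum_convPow hL θ q).mul_left ((L : ℂ) ^ (5 * q))⁻¹
  have hL0 : (L : ℂ) ≠ 0 := by exact_mod_cast NeZero.ne L
  convert! h using 1
  · ext x; simp only [profile]; push_cast; ring
  · rw [sum_boxSet hL, mul_pow, ← pow_mul, ← mul_assoc, inv_mul_cancel₀ (pow_ne_zero _ hL0),
      one_mul]

theorem chi_incl [NeZero L] {j : ℕ} (z : Fin 4 → ℤ) (y : Lat L t s j) :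
    chi z (incl y) = chi z y := by
  rw [← phase_eq_chi z y]
  have h : incl y = fun ν => (((Ldir L ν * (y ν).val : ℕ) : ℤ) : ZMod (size L t s (j + 1) ν)) := by
    ext ν; simp [incl]
  rw [h, chi_intCast, phase]
  congr 4 with ν
  have h1 : (Ldir L ν : ℝ) ≠ 0 := by exact_mod_cast (Ldir_pos L ν).ne'
  simp only [pos, eps]
  push_cast
  field_simp
  ring

/-- Characters are eigenvectors of translations, so averaging multiplies them by the Fourier series
of the profile at the corresponding momentum. On the coarser lattice the character is the one with
the same label. -/
theorem sum_Qstep_mul_chi [NeZero L] (hL : Odd L) (q j : ℕ) (z : Fin 4 → ℤ) (y : Lat L t s j) :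
    ∑ u, Qstep L q t s j y u * chi z u =
      ((∏ ν, sinRatio (Ldir L ν) (eps L j ν * pmom L t s z ν) : ℝ) : ℂ) ^ q * chi z y := by
  set θ : Fin 4 → ℝ := fun ν => pmom L t s z ν * eps L (j + 1) ν with hθ
  have hp := hasSum_profile hL q θ
  have hsum : ∀ u : Lat L t s (j + 1), HasSum (fun x : Fin 4 → ℤ =>
      (if (∀ ν, incl y ν + (x ν : ZMod (size L t s (j + 1) ν)) = u ν)
        then ((profile L q x : ℝ) : ℂ) else 0) * chi z u) (Qstep L q t s j y u * chi z u) := by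
    intro u
    have hs : Summable fun x : Fin 4 → ℤ =>
        (if (∀ ν, incl y ν + (x ν : ZMod (size L t s (j + 1) ν)) = u ν)
          then ((profile L q x : ℝ) : ℂ) else 0) := by
      refine Summable.of_norm_bounded hp.summable.norm fun x => ?_
      rw [norm_mul, norm_planeWave, mul_one]
      split_ifs
      · exact le_rfl
      · simp
    exact hs.hasSum.mul_right _
  have h1 := hasSum_sum fun u (_ : u ∈ Finset.univ) => hsum u
  have h2 := hp.mul_right (chi z y)
  -- For every displacement x exactly one point u of the torus contributes, so the periodised sum
  -- unfolds to a sum over all of ℤ⁴.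
  have heq : (fun x : Fin 4 → ℤ => ∑ u : Lat L t s (j + 1),
      (if (∀ ν, incl y ν + (x ν : ZMod (size L t s (j + 1) ν)) = u ν)
        then ((profile L q x : ℝ) : ℂ) else 0) * chi z u) =
      fun x => ((profile L q x : ℝ) : ℂ) * planeWave θ x * chi z y := by
    ext x
    rw [Finset.sum_eq_single (incl y + fun ν => (x ν : ZMod (size L t s (j + 1) ν)))]
    · rw [if_pos (fun ν => by rw [Pi.add_apply]), chi_add, chi_incl, chi_intCast]
      have : planeWave θ x = Complex.exp (Complex.I *
          ((∑ ν, pmom L t s z ν * (eps L (j + 1) ν * x ν) : ℝ) : ℂ)) := by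
        simp only [planeWave, hθ, mul_assoc]
      rw [this]; ring
    · intro u _ hu
      rw [if_neg, zero_mul]
      intro h
      exact hu (funext fun ν => (h ν).symm)
    · simp
  rw [heq] at h1
  rw [h1.unique h2]
  congr 4 with ν
  congr 1
  have h0' : (Ldir L ν : ℝ) ≠ 0 := by exact_mod_cast (Ldir_pos L ν).ne'
  simp only [hθ, eps]
  field_simp
  ring

/-- The one-step symbols multiply up to u_j^q by the composition rule `sinRatio_mul`. -/
theorem sum_Qn_mul_chi [NeZero L] (hL : Odd L) (q j : ℕ) (z : Fin 4 → ℤ) (x : Lat L t s 0) :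
    ∑ u, Qn L q t s j x u * chi z u =
      ((un L j (pmom L t s z) : ℝ) : ℂ) ^ q * chi z x := by
  induction j with
  | zero =>
    have : un L 0 (pmom L t s z) = 1 := by
      rw [un]
      refine Finset.prod_eq_one fun ν _ => ?_
      by_cases h : Real.sin (pmom L t s z ν / 2) = 0
      · simp [uFactor, sinRatio, h]
      · simp [uFactor, sinRatio, h]
    rw [this]
    simp [Qn, Matrix.one_apply]
  | succ j ih =>
    rw [Qn]
    simp_rw [Matrix.mul_apply, Finset.sum_mul]
    rw [Finset.sum_comm]
    simp_rw [mul_assoc, ← Finset.mul_sum, sum_Qstep_mul_chi hL]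
    simp_rw [mul_left_comm (Qn L q t s j x _), ← Finset.mul_sum]
    rw [ih, ← mul_assoc, ← mul_pow]
    congr 2
    rw [← Complex.ofReal_mul, un, un, mul_comm, ← Finset.prod_mul_distrib]
    congr 1
    refine Finset.prod_congr rfl fun ν _ => ?_
    rw [uFactor, uFactor, pow_succ, ← sinRatio_mul, eps]
    congr 2
    push_cast
    rw [div_eq_inv_mul]

end Averaging

end

end PBS


namespace PBS

noncomputable section

/-! ### Symbols and kernel bounds of the averaging operators, and the symbol of 𝔔_n. -/

section Symbols

variable {L t s n : ℕ} [NeZero L]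

/-- The momentum `k + ℓ`. -/
abbrev mom (i : Lat L t s 0 × Bdual L n) : Fin 4 → ℝ := pmom L t s (labPair L t s n i)

/-- The symbol of `Q_n`. -/
def symQ (L q t s n : ℕ) (i : Lat L t s 0 × Bdual L n) : ℂ := ((un L n (mom i) : ℝ) : ℂ) ^ q

/-- The symbol of `Q_{n,ν}^(-)`. -/
def symMinus (L q t s n : ℕ) (ν : Fin 4) (i : Lat L t s 0 × Bdual L n) : ℂ :=
  zetaMinus L n ν (kMom i.1) (lMom i.2) * ((unMinus L n ν (mom i) : ℝ) : ℂ) *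
    ((un L n (mom i) : ℝ) : ℂ) ^ (q - 1)

/-- The complex conjugate of the symbol of `Q_{n,ν}^(+)`. -/
def symPlus (L q t s n : ℕ) (ν : Fin 4) (i : Lat L t s 0 × Bdual L n) : ℂ :=
  zetaMinus L n ν (kMom i.1) (lMom i.2) * ((unPlus L n ν (mom i) : ℝ) : ℂ) *
    ((un L n (mom i) : ℝ) : ℂ) ^ (q - 1)

theorem star_zetaPlus (ν : Fin 4) (k ℓ : Fin 4 → ℝ) :
    star (zetaPlus L n ν k ℓ) = zetaMinus L n ν k ℓ := by
  change (starRingEnd ℂ) (zetaPlus L n ν k ℓ) = _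
  rw [zetaPlus, zetaMinus, map_mul, map_mul, ← Complex.exp_conj, ← Complex.exp_conj,
    Complex.conj_ofReal]
  simp only [map_mul, map_neg, Complex.conj_I, Complex.conj_ofReal, neg_mul, neg_neg]
  ring

/-- The half period shift in direction `ν`. -/
def halfShift (L t s n : ℕ) (ν : Fin 4) : Lat L t s n :=
  fun ν' => (((if ν' = ν then ((Ldir L ν ^ n / 2 : ℕ) : ℤ) else 0 : ℤ)) : ZMod (size L t s n ν'))

theorem d1_halfShift_le (ν : Fin 4) : d1 0 (halfShift L t s n ν) ≤ 2 := by
  refine d1_intCast_le (fun ν' => if ν' = ν then ((Ldir L ν ^ n / 2 : ℕ) : ℤ) else 0) fun ν' => ?_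
  split_ifs with h
  · subst h
    rw [abs_of_nonneg (by positivity)]
    have : 2 * (Ldir L ν' ^ n / 2) ≤ Ldir L ν' ^ n := Nat.mul_div_le _ _
    exact_mod_cast this
  · simp

/-- Since ℓ_ν is in 2πℤ, sin(ℓ_ν / 2) = 0 and the cosine equals exp(i ℓ_ν / 2). Hence ζ⁻ = exp(i (1
- ε)(k + ℓ)_ν / 2), the symbol of a translation by (L_ν^n - 1) / 2 lattice steps, an integer because
L is odd. In particular ζ⁻ has modulus 1 and costs only a bounded displacement. -/
theorem zetaMinus_eq_chi (hL : Odd L) (ν : Fin 4) (i : Lat L t s 0 × Bdual L n) :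
    zetaMinus L n ν (kMom i.1) (lMom i.2) = chi (labPair L t s n i) (halfShift L t s n ν) := by
  have h1 := chi_intCast (L := L) (t := t) (s := s) (j := n) (labPair L t s n i)
    fun ν' => if ν' = ν then ((Ldir L ν ^ n / 2 : ℕ) : ℤ) else 0
  rw [show chi (labPair L t s n i) (halfShift L t s n ν) = _ from h1, Finset.sum_eq_single ν]
  · have hcos : ((Real.cos (lMom i.2 ν / 2) : ℝ) : ℂ) =
        Complex.exp (Complex.I * ((lMom i.2 ν / 2 : ℝ) : ℂ)) := by
      have h2 : lMom i.2 ν / 2 = (i.2 ν).valMinAbs * Real.pi := by simp only [lMom]; ring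
      have h3 : Real.sin (lMom i.2 ν / 2) = 0 := by rw [h2]; exact Real.sin_int_mul_pi _
      rw [mul_comm, Complex.exp_mul_I, ← Complex.ofReal_cos, ← Complex.ofReal_sin, h3]
      simp
    rw [zetaMinus, hcos, ← Complex.exp_add, ← Complex.exp_add, ← congrFun (kMom_add_lMom i) ν]
    congr 1
    have hN : ((Ldir L ν ^ n / 2 : ℕ) : ℝ) = ((Ldir L ν : ℝ) ^ n - 1) / 2 := by
      obtain ⟨k, hk⟩ := (odd_Ldir hL ν).pow (n := n)
      have hk2 : Ldir L ν ^ n / 2 = k := by omega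
      have hk3 : (Ldir L ν : ℝ) ^ n = 2 * k + 1 := by exact_mod_cast hk
      rw [hk2, hk3]; ring
    have hLd : (Ldir L ν : ℝ) ≠ 0 := by exact_mod_cast (Ldir_pos L ν).ne'
    have he : eps L n ν * ((Ldir L ν ^ n / 2 : ℕ) : ℝ) = (1 - eps L n ν) / 2 := by
      rw [hN, eps]; field_simp
    simp only [if_true, Int.cast_natCast]
    rw [he]
    simp only [Pi.add_apply]
    push_cast
    ring
  · intro ν' _ h; simp [h]
  · simp

theorem norm_zetaMinus (hL : Odd L) (ν : Fin 4) (i : Lat L t s 0 × Bdual L n) :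
    ‖zetaMinus L n ν (kMom i.1) (lMom i.2)‖ = 1 := by
  rw [zetaMinus_eq_chi hL, norm_chi]

theorem volume_eq_card : volume L t s = Fintype.card (Lat L t s 0) := by
  rw [volume, Fintype.card_pi]
  push_cast
  refine Finset.prod_congr rfl fun ν _ => ?_
  rw [ZMod.card]; simp [size]

theorem QnMinus_eq_coarse (q : ℕ) (ν : Fin 4) :
    QnMinus L q t s n ν = coarse (symMinus L q t s n ν) := by
  ext x u
  simp only [QnMinus, Matrix.of_apply, coarse, Matrix.smul_apply, smul_eq_mul]
  have h1 : ((volume L t s : ℝ) : ℂ)⁻¹ =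
      (Fintype.card (Lat L t s n) : ℂ)⁻¹ * ((weight L n : ℝ) : ℂ)⁻¹ := by
    rw [volume_eq_card, ← mul_inv, mul_comm, weight_mul_card']
    simp
  rw [h1, mul_assoc, Matrix.mul_assoc, Matrix.mul_apply, Finset.mul_sum]
  congr 1
  refine Finset.sum_congr rfl fun κ _ => ?_
  rw [Matrix.mul_apply, Fintype.sum_prod_type, Finset.sum_eq_single κ, kMom_eq, phase_eq_chi]
  · rw [Finset.mul_sum, Finset.mul_sum, Finset.mul_sum]
    refine Finset.sum_congr rfl fun l _ => ?_
    have h2 := kMom_add_lMom (L := L) (t := t) (s := s) (κ, l)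
    simp only at h2
    rw [← kMom_eq, h2, phase_neg, phase_eq_chi]
    simp only [charMat, selMat, Matrix.of_apply, Matrix.conjTranspose_apply, if_true, symMinus]
    have := weight_ne_zero (L := L) (j := n)
    field_simp
  · intro b _ hb; simp [selMat, hb]
  · simp

theorem QnPlus_eq_coarse (q : ℕ) (ν : Fin 4) : QnPlus L q t s n ν =
    ((weight L n : ℝ) : ℂ)⁻¹ • (coarse (symPlus L q t s n ν)).conjTranspose := by
  ext u x
  rw [coarse_conjTranspose, smul_smul]
  simp only [QnPlus, Matrix.of_apply, Matrix.smul_apply, smul_eq_mul]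
  have h1 : ((volume L t s : ℝ) : ℂ)⁻¹ =
      ((weight L n : ℝ) : ℂ)⁻¹ * (Fintype.card (Lat L t s n) : ℂ)⁻¹ := by
    rw [volume_eq_card, ← mul_inv, weight_mul_card']
    simp
  rw [h1, Matrix.mul_apply]
  congr 1
  refine Finset.sum_congr rfl fun κ _ => ?_
  rw [Matrix.mul_apply, Fintype.sum_prod_type, Finset.sum_eq_single κ, Finset.sum_mul]
  · refine Finset.sum_congr rfl fun l _ => ?_
    have h2 := kMom_add_lMom (L := L) (t := t) (s := s) (κ, l)
    simp only at h2
    rw [h2, phase_neg, phase_eq_chi]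
    conv_lhs => rw [kMom_eq κ, phase_eq_chi, ← kMom_eq]
    simp only [charMat, selMat, Matrix.of_apply, Matrix.conjTranspose_apply, if_true, symPlus,
      star_mul', ← star_zetaPlus, star_star, star_pow]
    have h3 : ∀ r : ℝ, star (r : ℂ) = r := fun r => Complex.conj_ofReal r
    rw [h3, h3]
  · intro b _ hb; simp [selMat, hb]
  · simp

theorem Qn_eq_coarse (hL : Odd L) (q : ℕ) : Qn L q t s n = coarse (symQ L q t s n) :=
  eq_coarse fun i x => sum_Qn_mul_chi hL q n (labPair L t s n i) x

/-- The averaging kernels are real, so the adjoint for the bilinear product agrees with the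
Hermitian one. -/
theorem Qn_map_conj (q j : ℕ) : (Qn L q t s j).map (starRingEnd ℂ) = Qn L q t s j := by
  induction j with
  | zero => simp [Qn]
  | succ j ih =>
    rw [Qn, Matrix.map_mul, ih]
    congr 1
    ext y u
    simp only [Matrix.map_apply, Qstep, Matrix.of_apply]
    have : (∑' x : Fin 4 → ℤ, if (∀ ν, incl y ν + (x ν : ZMod (size L t s (j + 1) ν)) = u ν)
        then ((profile L q x : ℝ) : ℂ) else 0) =
        ((∑' x : Fin 4 → ℤ, if (∀ ν, incl y ν + (x ν : ZMod (size L t s (j + 1) ν)) = u ν)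
        then profile L q x else 0 : ℝ) : ℂ) := by
      rw [Complex.ofReal_tsum]
      congr 1; ext x; split_ifs <;> simp
    rw [this, Complex.conj_ofReal]

theorem QnStar_eq_coarse (hL : Odd L) (q : ℕ) : QnStar L q t s n =
    ((weight L n : ℝ) : ℂ)⁻¹ • (coarse (symQ L q t s n)).conjTranspose := by
  rw [QnStar, ← Qn_eq_coarse hL]
  congr 1
  conv_lhs => rw [← Qn_map_conj]
  rfl

/-! Kernel bounds for the averaging operators. -/

theorem mul_charMat_comp {A B : Matrix (Lat L t s n) (Lat L t s n) ℂ} {ι : Type*} [Fintype ι]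
    [DecidableEq ι] {E : Matrix (Lat L t s n) ι ℂ} {f g : ι → ℂ}
    (hA : A * E = E * Matrix.diagonal f) (hB : B * E = E * Matrix.diagonal g) :
    A * B * E = E * Matrix.diagonal fun i => f i * g i := by
  rw [Matrix.mul_assoc, hB, ← Matrix.mul_assoc, hA, Matrix.mul_assoc, Matrix.diagonal_mul_diagonal]

theorem pow_mul_charMat {A : Matrix (Lat L t s n) (Lat L t s n) ℂ} {ι : Type*} [Fintype ι]
    [DecidableEq ι] {E : Matrix (Lat L t s n) ι ℂ} {f : ι → ℂ}
    (hA : A * E = E * Matrix.diagonal f) (k : ℕ) :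
    A ^ k * E = E * Matrix.diagonal fun i => f i ^ k := by
  induction k with
  | zero =>
    have : (Matrix.diagonal fun _ : ι => (1 : ℂ)) = 1 := Matrix.diagonal_one
    simp [this]
  | succ k ih =>
    rw [pow_succ, mul_charMat_comp ih hA]
    simp only [pow_succ]

/-- The symbol factors into those of a translation, of a + 1 full windows and of a window in the
directions D. -/
theorem coarseBd_of_symbol (hL : Odd L) {q a : ℕ} (ha : a + 1 ≤ q) {c : Lat L t s n}
    (hc : d1 0 c ≤ 2) (D : Finset (Fin 4)) {w : Lat L t s 0 × Bdual L n → ℂ}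
    (hw : ∀ i, w i = chi (labPair L t s n i) c * ((un L n (mom i) : ℝ) : ℂ) ^ a *
      ((un L n (mom i) : ℝ) : ℂ) * ((∏ ν ∈ D, uFactor L n (mom i) ν : ℝ) : ℂ)) :
    CoarseBd (avgBound q) (coarse w) := by
  have h := mul_charMat_comp (mul_charMat_comp (mul_charMat_comp
    (tr_mul_charMat (labPair L t s n) c)
    (pow_mul_charMat (winAvg_mul_charMat hL (labPair L t s n) Finset.univ) a))
    (winAvg_mul_charMat hL (labPair L t s n) Finset.univ))
    (winAvg_mul_charMat hL (labPair L t s n) D)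
  have h2 := coarseBd_window (L := L) (t := t) (s := s) ha hc D
  rw [submatrix_emb_eq_coarse h] at h2
  convert h2 using 2
  ext i
  exact hw i

theorem coarseBd_symQ (hL : Odd L) {q : ℕ} (hq : 1 ≤ q) :
    CoarseBd (avgBound q) (coarse (symQ L q t s n)) := by
  refine coarseBd_of_symbol hL (a := q - 1) (by omega) (c := 0) (by simp [d1]) ∅ fun i => ?_
  have : chi (labPair L t s n i) (0 : Lat L t s n) = 1 := by simp [chi]
  rw [this, one_mul, ← pow_succ, Nat.sub_add_cancel hq]
  simp [symQ]

theorem coarseBd_symMinus (hL : Odd L) {q : ℕ} (hq : 1 ≤ q) (ν : Fin 4) :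
    CoarseBd (avgBound q) (coarse (symMinus L q t s n ν)) := by
  refine coarseBd_of_symbol hL (a := q - 1) (by omega) (d1_halfShift_le ν) {ν} fun i => ?_
  rw [symMinus, zetaMinus_eq_chi hL, unMinus, Finset.prod_singleton]
  push_cast [un]
  ring

/-- One of the q - 1 factors u_n must serve as the full window providing the density, whence q ≥ 2;
u⁺ is a window in the directions other than ν. -/
theorem coarseBd_symPlus (hL : Odd L) {q : ℕ} (hq : 2 ≤ q) (ν : Fin 4) :
    CoarseBd (avgBound q) (coarse (symPlus L q t s n ν)) := by
  refine coarseBd_of_symbol hL (a := q - 2) (by omega) (d1_halfShift_le ν)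
    (Finset.univ.erase ν) fun i => ?_
  obtain ⟨r, rfl⟩ : ∃ r, q = r + 2 := ⟨q - 2, by omega⟩
  rw [symPlus, zetaMinus_eq_chi hL, unPlus]
  simp only [Nat.add_sub_cancel, show r + 2 - 1 = r + 1 from rfl, pow_succ]
  ring

/-! Bounds on the symbols. -/

theorem abs_uFactor_le_one (hL : Odd L) (p : Fin 4 → ℝ) (ν : Fin 4) : |uFactor L n p ν| ≤ 1 :=
  abs_sinRatio_le_one (odd_Ldir hL ν).pow _

theorem abs_prod_uFactor_le_one (hL : Odd L) (p : Fin 4 → ℝ) (D : Finset (Fin 4)) :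
    |∏ ν ∈ D, uFactor L n p ν| ≤ 1 := by
  rw [Finset.abs_prod]
  exact Finset.prod_le_one (fun _ _ => abs_nonneg _) fun ν _ => abs_uFactor_le_one hL p ν

/-- Parseval for the Dirichlet kernel, one direction at a time. It normalises the two vectors of the
rank one part of every fibre. -/
theorem sum_un_sq (hL : Odd L) (κ : Lat L t s 0) :
    ∑ l : Bdual L n, un L n (mom (κ, l)) ^ 2 = 1 := by
  have h1 : ∀ l : Bdual L n, un L n (mom (κ, l)) ^ 2 =
      ∏ ν, sinRatio (Ldir L ν ^ n) (kMom κ ν + 2 * Real.pi * (l ν).valMinAbs) ^ 2 := by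
    intro l
    rw [mom, ← kMom_add_lMom, un, ← Finset.prod_pow]
    rfl
  simp_rw [h1]
  rw [sum_prod_pi fun ν (z : ZMod (Ldir L ν ^ n)) =>
    sinRatio (Ldir L ν ^ n) (kMom κ ν + 2 * Real.pi * z.valMinAbs) ^ 2]
  exact Finset.prod_eq_one fun ν _ => sum_sinRatio_sq (odd_Ldir hL ν).pow _

theorem l2_le_one_of_le_un (hL : Odd L) {w : Lat L t s 0 × Bdual L n → ℂ}
    (hw : ∀ i, ‖w i‖ ≤ |un L n (mom i)|) (κ : Lat L t s 0) : l2 (fun l => w (κ, l)) ≤ 1 := by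
  rw [l2_le_iff zero_le_one, one_pow, ← sum_un_sq hL κ]
  refine Finset.sum_le_sum fun l _ => ?_
  rw [← sq_abs (un L n _)]
  gcongr
  exact hw _

/-- The conditions on the symbols of a pair of averaging operators `Q^+`, `Q^-`. -/
structure SymPair (q : ℕ) (v w : Lat L t s 0 × Bdual L n → ℂ) : Prop where
  left : ∀ i, ‖v i‖ ≤ |un L n (mom i)|
  right : ∀ i, ‖w i‖ ≤ |un L n (mom i)|
  mul : ∀ i, star (v i) * w i = ((un L n (mom i) ^ (2 * q) : ℝ) : ℂ)
  bd_left : CoarseBd (avgBound q) (coarse v)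
  bd_right : CoarseBd (avgBound q) (coarse w)

theorem abs_un_le_one (hL : Odd L) (p : Fin 4 → ℝ) : |un L n p| ≤ 1 :=
  abs_prod_uFactor_le_one hL p Finset.univ

theorem symPair_symQ (hL : Odd L) {q : ℕ} (hq : 1 ≤ q) :
    SymPair q (symQ L q t s n) (symQ L q t s n) := by
  have h : ∀ i, ‖symQ L q t s n i‖ ≤ |un L n (mom i)| := fun i => by
    rw [symQ, norm_pow, Complex.norm_real, Real.norm_eq_abs]
    exact pow_le_of_le_one (abs_nonneg _) (abs_un_le_one hL _) (by omega)
  refine ⟨h, h, fun i => ?_, coarseBd_symQ hL hq, coarseBd_symQ hL hq⟩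
  have h3 : ∀ r : ℝ, star (r : ℂ) = r := fun r => Complex.conj_ofReal r
  rw [symQ, star_pow, h3]
  push_cast; ring

theorem symPair_symPlus_symMinus (hL : Odd L) {q : ℕ} (hq : 2 ≤ q) (ν : Fin 4) :
    SymPair q (symPlus L q t s n ν) (symMinus L q t s n ν) := by
  have h3 : ∀ r : ℝ, star (r : ℂ) = r := fun r => Complex.conj_ofReal r
  refine ⟨fun i => ?_, fun i => ?_, fun i => ?_, coarseBd_symPlus hL hq ν,
    coarseBd_symMinus hL (by omega) ν⟩
  · rw [symPlus, norm_mul, norm_mul, norm_zetaMinus hL, one_mul, norm_pow, Complex.norm_real,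
      Complex.norm_real, Real.norm_eq_abs, Real.norm_eq_abs]
    calc _ ≤ 1 * |un L n (mom i)| ^ (q - 1) := by
          gcongr; exact abs_prod_uFactor_le_one hL _ _
      _ ≤ _ := by
          rw [one_mul]
          exact pow_le_of_le_one (abs_nonneg _) (abs_un_le_one hL _) (by omega)
  · rw [symMinus, norm_mul, norm_mul, norm_zetaMinus hL, one_mul, norm_pow, Complex.norm_real,
      Complex.norm_real, Real.norm_eq_abs, Real.norm_eq_abs, unMinus, abs_mul,
      show ∏ ν', uFactor L n (mom i) ν' = un L n (mom i) from rfl]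
    calc _ ≤ 1 * |un L n (mom i)| * 1 := by
          gcongr
          · exact abs_uFactor_le_one hL _ _
          · exact pow_le_one₀ (abs_nonneg _) (abs_un_le_one hL _)
      _ = _ := by ring
  · have hz : star (zetaMinus L n ν (kMom i.1) (lMom i.2)) *
        zetaMinus L n ν (kMom i.1) (lMom i.2) = 1 := by
      have := Complex.conj_mul' (zetaMinus L n ν (kMom i.1) (lMom i.2))
      rw [norm_zetaMinus hL] at this
      simpa using this
    -- The factor s_ν missing in u⁺ is the additional one in u⁻, so the product of the symbols is
    -- the same as for Q_n^* and Q_n.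
    have hu : unPlus L n ν (mom i) * unMinus L n ν (mom i) = un L n (mom i) ^ 2 := by
      rw [unMinus, ← mul_assoc, unPlus, Finset.prod_erase_mul _ _ (Finset.mem_univ ν), un, sq]
    obtain ⟨r, rfl⟩ : ∃ r, q = r + 1 := ⟨q - 1, by omega⟩
    rw [symPlus, symMinus, star_mul', star_mul', star_pow, h3, h3]
    have hu' : ((unPlus L n ν (mom i) : ℝ) : ℂ) * ((unMinus L n ν (mom i) : ℝ) : ℂ) =
        ((un L n (mom i) : ℝ) : ℂ) ^ 2 := by exact_mod_cast congrArg (fun x : ℝ => (x : ℂ)) hu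
    simp only [Nat.add_sub_cancel]
    push_cast
    set U := ((un L n (mom i) : ℝ) : ℂ)
    linear_combination ((unPlus L n ν (mom i) : ℝ) : ℂ) * ((unMinus L n ν (mom i) : ℝ) : ℂ) *
      U ^ (2 * r) * hz + U ^ (2 * r) * hu'

/-! The operator `𝔔_n`. -/

/-- `∑ ℓ, u_j(k + ℓ) ^ (2 q)`. -/
def sumUn (L q t s j : ℕ) [NeZero L] (κ : Lat L t s 0) : ℝ :=
  ∑ l : Bdual L j, un L j (mom (κ, l)) ^ (2 * q)

theorem sumUn_nonneg (q j : ℕ) (κ : Lat L t s 0) : 0 ≤ sumUn L q t s j κ :=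
  Finset.sum_nonneg fun l _ => by rw [pow_mul]; positivity

theorem sumUn_le_one (hL : Odd L) {q : ℕ} (hq : 1 ≤ q) (j : ℕ) (κ : Lat L t s 0) :
    sumUn L q t s j κ ≤ 1 := by
  rw [sumUn, ← sum_un_sq (n := j) hL κ]
  refine Finset.sum_le_sum fun l _ => ?_
  rw [pow_mul]
  refine pow_le_of_le_one (sq_nonneg _) ?_ (by omega)
  rw [← sq_abs]
  exact pow_le_one₀ (abs_nonneg _) (abs_un_le_one hL _)

theorem Qn_mul_QnStar (hL : Odd L) {q : ℕ} (hq : 1 ≤ q) (j : ℕ) :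
    Qn L q t s j * QnStar L q t s j = mulUnit fun κ => ((sumUn L q t s j κ : ℝ) : ℂ) := by
  rw [QnStar_eq_coarse hL, Qn_eq_coarse hL, Matrix.mul_smul, coarse_mul_conjTranspose]
  congr 1
  ext κ
  rw [sumUn, Complex.ofReal_sum]
  refine Finset.sum_congr rfl fun l _ => ?_
  rw [mul_comm]
  exact (symPair_symQ hL hq).mul (κ, l)

/-- The symbol of `1 + ∑ L ^ (-2 j) Q_j Q_j^*`. -/
def denom (L q t s n : ℕ) [NeZero L] (κ : Lat L t s 0) : ℝ :=
  1 + ∑ j ∈ Finset.Ico 1 n, ((L : ℝ) ^ (2 * j))⁻¹ * sumUn L q t s j κ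

theorem one_le_denom (q : ℕ) (κ : Lat L t s 0) : 1 ≤ denom L q t s n κ := by
  have : 0 ≤ ∑ j ∈ Finset.Ico 1 n, ((L : ℝ) ^ (2 * j))⁻¹ * sumUn L q t s j κ :=
    Finset.sum_nonneg fun j _ => mul_nonneg (by positivity) (sumUn_nonneg q j κ)
  unfold denom; linarith

theorem sum_inv_pow_le (hL : 2 ≤ (L : ℝ)) (n : ℕ) :
    ∑ j ∈ Finset.Ico 1 n, ((L : ℝ) ^ (2 * j))⁻¹ ≤ 1 := by
  calc _ ≤ ∑ j ∈ Finset.Ico 1 n, (1 / 2 : ℝ) ^ j := by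
        refine Finset.sum_le_sum fun j _ => ?_
        rw [one_div, inv_pow]
        gcongr
        calc (2 : ℝ) ^ j ≤ 2 ^ (2 * j) := pow_le_pow_right₀ (by norm_num) (by omega)
          _ ≤ _ := by gcongr
    -- The full geometric series contains the term 1 of index 0, which does not belong to the sum.
    _ ≤ ∑' j : ℕ, (1 / 2 : ℝ) ^ j - 1 := by
        have h := summable_geometric_two.sum_le_tsum (insert 0 (Finset.Ico 1 n))
          (fun _ _ => by positivity)
        rw [Finset.sum_insert (by simp)] at h
        simp only [pow_zero] at h
        linarith
    _ = 1 := by rw [tsum_geometric_two]; norm_num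

theorem denom_le_two (hL : Odd L) (hL2 : 2 ≤ (L : ℝ)) {q : ℕ} (hq : 1 ≤ q) (κ : Lat L t s 0) :
    denom L q t s n κ ≤ 2 := by
  have h : ∑ j ∈ Finset.Ico 1 n, ((L : ℝ) ^ (2 * j))⁻¹ * sumUn L q t s j κ ≤
      ∑ j ∈ Finset.Ico 1 n, ((L : ℝ) ^ (2 * j))⁻¹ :=
    Finset.sum_le_sum fun j _ => mul_le_of_le_one_right (by positivity) (sumUn_le_one hL hq j κ)
  have := sum_inv_pow_le hL2 n
  unfold denom; linarith

theorem one_add_sum_eq_mulUnit (hL : Odd L) {q : ℕ} (hq : 1 ≤ q) (n : ℕ) :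
    1 + ∑ j ∈ Finset.Ico 1 n, ((L : ℂ) ^ (2 * j))⁻¹ • (Qn L q t s j * QnStar L q t s j) =
      mulUnit fun κ => ((denom L q t s n κ : ℝ) : ℂ) := by
  have h : (fun κ => ((denom L q t s n κ : ℝ) : ℂ)) = 1 + ∑ j ∈ Finset.Ico 1 n,
      ((L : ℂ) ^ (2 * j))⁻¹ • fun κ : Lat L t s 0 => ((sumUn L q t s j κ : ℝ) : ℂ) := by
    ext κ
    simp [denom, Finset.sum_apply]
  rw [h, mulUnit, mulMat_add, mulMat_one isLabel_labMin, mulMat_sum]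
  simp_rw [mulMat_smul, Qn_mul_QnStar hL hq]

theorem fQ_eq_mulUnit (hL : Odd L) {q : ℕ} (hq : 1 ≤ q) (a : ℝ) (n : ℕ) :
    fQ L q t s a n = mulUnit fun κ => ((a / denom L q t s n κ : ℝ) : ℂ) := by
  rw [fQ, one_add_sum_eq_mulUnit hL hq]
  have h : (mulUnit fun κ : Lat L t s 0 => ((denom L q t s n κ : ℝ) : ℂ))⁻¹ =
      mulUnit fun κ => ((denom L q t s n κ : ℝ) : ℂ)⁻¹ := by
    refine Matrix.inv_eq_right_inv ?_
    rw [mulUnit, mulMat_mul isLabel_labMin, ← mulMat_one isLabel_labMin]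
    congr 1
    ext κ
    have : ((denom L q t s n κ : ℝ) : ℂ) ≠ 0 := by
      have := one_le_denom (n := n) q κ
      exact_mod_cast (by linarith : (0 : ℝ) < denom L q t s n κ).ne'
    simp [this]
  rw [h, mulUnit, ← mulMat_smul]
  congr 1
  ext κ
  simp [div_eq_mul_inv]

end Symbols

/-- `𝔔_n` has an exponentially decaying kernel, uniformly in the lattice. -/
theorem exists_expBd_fQ {q : ℕ} (hq : 1 ≤ q) {a : ℝ} (ha : 0 < a) :
    ∃ m C : ℝ, 0 < m ∧ m ≤ 1 / 2 ∧ 0 ≤ C ∧ ∀ (L : ℕ) [NeZero L], Odd L → 2 ≤ (L : ℝ) →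
      ∀ t s n : ℕ, ExpBd d1 m C (fQ L q t s a n) := by
  have hA := avgBound_pos q
  have hV : 0 ≤ volBound (1 / 2) := by unfold volBound; positivity
  set P : ℝ := avgBound q * avgBound q with hP
  have hP0 : 0 ≤ P := by positivity
  set C₁ : ℝ := P * volBound (1 / 2) with hC₁
  have hC₁0 : 0 ≤ C₁ := by positivity
  -- On the unit lattice points have weight 1. The lower bound is c = 1 because 1 - E has symbol
  -- `denom` ≥ 1, and C₁² P bounds E² times the density of E.
  obtain ⟨m', C, hm', hm'le, hC, hcore⟩ := exists_expBd_inv_one_sub (m := 1 / 2) (C₁ := C₁)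
    (C₂ := C₁ ^ 2 * P) (c := 1) (by norm_num) hC₁0 (by positivity) one_pos volBound
  refine ⟨m', a * C, hm', hm'le, by positivity, ?_⟩
  intro L _ hL hL2 t s n
  set E : Matrix (Lat L t s 0) (Lat L t s 0) ℂ :=
    -∑ j ∈ Finset.Ico 1 n, ((L : ℂ) ^ (2 * j))⁻¹ • (Qn L q t s j * QnStar L q t s j) with hE
  have hdist : IsDist (d1 : Lat L t s 0 → Lat L t s 0 → ℝ) := isDist_d1
  have h1E : 1 + ∑ j ∈ Finset.Ico 1 n,
      ((L : ℂ) ^ (2 * j))⁻¹ • (Qn L q t s j * QnStar L q t s j) = 1 - E := by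
    rw [hE, sub_neg_eq_add]
  have hQQ : ∀ j, PtBd (d1 : Lat L t s 0 → Lat L t s 0 → ℝ) 1 P
      (Qn L q t s j * QnStar L q t s j) := by
    intro j
    rw [QnStar_eq_coarse hL, Qn_eq_coarse hL]
    obtain ⟨hrow, hpt⟩ := coarseBd_symQ (t := t) (s := s) (n := j) hL hq
    have hw := weight_pos (L := L) (j := j)
    -- The inverse weight in the adjoint cancels the weight in the density of Q_j, leaving a bound
    -- of order 1 with respect to the unit lattice.
    have hpt' : PtBd (fun (u : Lat L t s j) (x : Lat L t s 0) => dEmb x u) 1 (avgBound q)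
        (((weight L j : ℝ) : ℂ)⁻¹ • (coarse (symQ L q t s j)).conjTranspose) := by
      intro u x
      rw [Matrix.smul_apply, norm_smul, Matrix.conjTranspose_apply, norm_star, norm_inv,
        Complex.norm_real, Real.norm_eq_abs, abs_of_pos hw]
      calc _ ≤ (weight L j)⁻¹ * (avgBound q * weight L j * Real.exp (-(1 * dEmb x u))) := by
            gcongr; exact hpt x u
        _ = _ := by field_simp
    refine PtBd.rowBd_mul (d := dEmb) (d' := fun (u : Lat L t s j) x => dEmb x u) (by norm_num)
      hA.le (fun x u y => ?_) hrow hpt'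
    have := isDist_d1.tri (emb j x) u (emb j y)
    rw [d1_emb, isDist_d1.symm u (emb j y)] at this
    exact this
  have hEpt : PtBd (d1 : Lat L t s 0 → Lat L t s 0 → ℝ) 1 P E := by
    have h1 := PtBd.sum (Finset.Ico 1 n) fun j (_ : j ∈ Finset.Ico 1 n) =>
      (hQQ j).smul ((L : ℂ) ^ (2 * j))⁻¹
    have h2 : ∑ j ∈ Finset.Ico 1 n, ‖((L : ℂ) ^ (2 * j))⁻¹‖ * P ≤ P := by
      rw [← Finset.sum_mul]
      refine mul_le_of_le_one_left hP0 ?_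
      simpa using sum_inv_pow_le hL2 n
    have h3 := h1.mono le_rfl h2 (by positivity) hdist.nonneg
    intro x y
    rw [hE, Matrix.neg_apply, norm_neg]
    exact h3 x y
  have hwt0 : weight L 0 = 1 := by simp [weight]
  have hvol : ∀ σ, 0 < σ → ∀ x : Lat L t s 0, ∑ y, 1 * Real.exp (-(σ * d1 x y)) ≤ volBound σ := by
    intro σ hσ x
    have := sum_weight_exp_le hσ x
    rwa [hwt0] at this
  have hEexp : ExpBd (d1 : Lat L t s 0 → Lat L t s 0 → ℝ) (1 / 2) C₁ E := by
    refine PtBd.expBd (s := 1 / 2) (wt := 1) hdist.symm hP0 ?_ (hvol _ (by norm_num))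
    norm_num
    exact hEpt
  have hE3 : PtBd (d1 : Lat L t s 0 → Lat L t s 0 → ℝ) (1 / 2) (C₁ ^ 2 * P * 1) (E ^ 3) := by
    rw [mul_one, pow_succ]
    exact PtBd.rowBd_mul (by norm_num) hP0 hdist.tri
      (hEexp.pow hdist (by norm_num) hC₁0 2).row
      (hEpt.mono (by norm_num) le_rfl hP0 hdist.nonneg)
  have hlow : ∀ x, 1 * l2 x ≤ l2 ((1 - E).mulVec x) := by
    intro x
    rw [← h1E, one_add_sum_eq_mulUnit hL hq]
    refine l2_mulMat_lower isLabel_labMin zero_le_one (fun κ => ?_) x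
    have := one_le_denom (n := n) q κ
    rw [Complex.norm_real, Real.norm_eq_abs]
    exact this.trans (le_abs_self _)
  obtain ⟨_, hinv⟩ := hcore d1 1 E hdist one_pos hvol hEexp hE3 hlow
  rw [fQ, h1E]
  have := hinv.smul (a : ℂ)
  rwa [Complex.norm_real, Real.norm_eq_abs, abs_of_pos ha] at this

/-- The operators `Q^+ 𝔔_n Q^-` have exponentially decaying bounded kernels. -/
theorem exists_ptBd_averaging {q : ℕ} (hq : 1 ≤ q) {a : ℝ} (ha : 0 < a) :
    ∃ m C : ℝ, 0 < m ∧ m ≤ 1 / 2 ∧ 0 ≤ C ∧ ∀ (L : ℕ) [NeZero L], Odd L → 2 ≤ (L : ℝ) →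
      ∀ (t s n : ℕ) (v w : Lat L t s 0 × Bdual L n → ℂ), SymPair q v w →
        PtBd d1 m (C * weight L n) (((weight L n : ℝ) : ℂ)⁻¹ • (coarse v).conjTranspose *
          fQ L q t s a n * coarse w) := by
  obtain ⟨m, C, hm, hm2, hC, hf⟩ := exists_expBd_fQ hq ha
  have hA := avgBound_pos q
  have hV : 0 ≤ volBound (1 / 2) := by unfold volBound; positivity
  refine ⟨m, avgBound q * volBound (1 / 2) * (C * avgBound q), hm, hm2, by positivity, ?_⟩
  intro L _ hL hL2 t s n v w hvw
  have hw := weight_pos (L := L) (j := n)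
  have hdn : ∀ (x : Lat L t s 0) (u : Lat L t s n), 0 ≤ dEmb x u := fun x u =>
    isDist_d1.nonneg _ _
  have h1 : PtBd (dEmb : Lat L t s 0 → Lat L t s n → ℝ) m (C * (avgBound q * weight L n))
      (fQ L q t s a n * coarse w) := by
    refine PtBd.rowBd_mul hm.le (by positivity) (fun x y u => ?_) (hf L hL hL2 t s n).row
      (hvw.bd_right.pt.mono (by linarith) le_rfl (by positivity) hdn)
    have := isDist_d1.tri (emb n x) (emb n y) u
    rwa [d1_emb] at this
  -- The adjoint maps from the unit lattice, where sums carry no weight. Its entries are of order 1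
  -- and are summed over unit lattice points near u, so the density comes from the right factor
  -- alone.
  have h2 : RowBd (fun (u : Lat L t s n) (x : Lat L t s 0) => dEmb x u) m
      (avgBound q * volBound (1 / 2)) (((weight L n : ℝ) : ℂ)⁻¹ • (coarse v).conjTranspose) := by
    refine RowBd.mono (m := 1 / 2) hm2 le_rfl (fun u x => hdn x u) ?_
    refine PtBd.rowBd (s := 1 / 2) (wt := 1) hA.le ?_ fun u => ?_
    · intro u x
      rw [Matrix.smul_apply, norm_smul, Matrix.conjTranspose_apply, norm_star, norm_inv,
        Complex.norm_real, Real.norm_eq_abs, abs_of_pos hw]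
      calc _ ≤ (weight L n)⁻¹ * (avgBound q * weight L n * Real.exp (-(1 * dEmb x u))) := by
            gcongr; exact hvw.bd_left.pt x u
        _ = _ := by norm_num; field_simp
    · have := sum_exp_emb_le (σ := 1 / 2) (by norm_num) u
      simp only [one_mul, dEmb]
      simpa only [isDist_d1.symm u] using this
  rw [Matrix.mul_assoc]
  have h3 := PtBd.rowBd_mul (d'' := (d1 : Lat L t s n → Lat L t s n → ℝ)) hm.le (by positivity)
    (fun u x v => ?_) h2 h1
  · convert h3 using 1; ring
  · have := isDist_d1.tri u (emb n x) v
    rwa [isDist_d1.symm u (emb n x)] at this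

theorem two_mul_abs_labMin_le (L t s : ℕ) [NeZero L] (κ : Lat L t s 0) (ν : Fin 4) :
    |kMom κ ν| ≤ Real.pi := by
  have h := two_mul_abs_valMinAbs_le _ (κ ν)
  have hp : (0 : ℝ) < period L t s ν := by
    exact_mod_cast Nat.pos_of_ne_zero (NeZero.ne (period L t s ν))
  have h2 : 2 * |((κ ν).valMinAbs : ℝ)| ≤ period L t s ν := by
    have h3 : (2 * |(κ ν).valMinAbs| : ℤ) ≤ period L t s ν := by simpa [size] using h
    exact_mod_cast h3
  have hpi := Real.pi_pos
  rw [kMom, abs_div, abs_mul, abs_of_pos (by positivity : 0 < 2 * Real.pi), abs_of_pos hp,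
    div_le_iff₀ hp]
  nlinarith

/-- The `ℓ²` lower bound for `D + Q^+ 𝔔_n Q^-`. -/
theorem exists_l2_lower {q : ℕ} (hq : 1 ≤ q) {a c₀ : ℝ} (ha : 0 < a) (hc₀ : 0 < c₀) :
    ∃ C : ℝ, 0 < C ∧ ∀ (L : ℕ) [NeZero L], Odd L → 2 ≤ (L : ℝ) →
      ∀ (t s n : ℕ) (v w : Lat L t s 0 × Bdual L n → ℂ), SymPair q v w →
      ∀ d : Lat L t s 0 × Bdual L n → ℂ, (∀ i, 0 ≤ (d i).re) →
      (∀ κ l, l ≠ 0 → c₀ ≤ ‖d (κ, l)‖) → ∀ x : Lat L t s n → ℂ,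
        l2 x ≤ C * l2 ((mulMat L t s n (labPair L t s n) d +
          ((weight L n : ℝ) : ℂ)⁻¹ • (coarse v).conjTranspose *
          fQ L q t s a n * coarse w).mulVec x) := by
  have hpi := Real.pi_pos
  -- Each of the four factors of u_n is at least 2 / π on the Brillouin zone, and the rank one part
  -- contains u_n^(2q).
  set b₀ : ℝ := (2 / Real.pi) ^ (4 * (2 * q)) with hb₀
  have hb0 : 0 < b₀ := by positivity
  -- The constant of `l2_le_of_diag_add_rankOne` with q₁ = a / 2: since `denom` lies between 1 and
  -- 2, the symbol of 𝔔_n lies between a / 2 and a.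
  set C : ℝ := (1 + a / c₀) * (((1 + a / c₀) ^ 2 / (a / 2 * b₀)) * (1 + a / c₀)) +
    (1 + a / c₀) / c₀ with hC
  have hC0 : 0 < C := by positivity
  refine ⟨C, hC0, ?_⟩
  intro L _ hL hL2 t s n v w hvw d hd hd' x
  have h := l2_lower_of_fibre (L := L) (t := t) (s := s) (j := n) (d := d) (v := v) (w := w)
    (Q := fun κ => ((a / denom L q t s n κ : ℝ) : ℂ)) hC0.le ?_ x
  · rw [fQ_eq_mulUnit hL hq, Matrix.smul_mul, Matrix.smul_mul]
    exact h
  · intro κ x y hxy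
    have h1 := one_le_denom (n := n) q κ
    have h2 := denom_le_two (n := n) hL hL2 hq κ
    refine l2_le_of_diag_add_rankOne (0 : Bdual L n) (b := fun l => un L n (mom (κ, l)) ^ (2 * q))
      (w := fun l => star (v (κ, l))) (w' := fun l => w (κ, l)) (d := fun l => d (κ, l))
      hc₀ hb0 (half_pos ha) (Q := a / denom L q t s n κ) ?_ ?_ (fun l => hd _) (fun l => hd' κ l)
      (fun l => hvw.mul (κ, l)) (fun l => ?_) ?_ ?_ (l2_le_one_of_le_un hL hvw.right κ) x y hxy
    · gcongr
    · exact div_le_self ha.le h1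
    · simp only [pow_mul]; positivity
    · have hk : ∀ ν, 2 / Real.pi ≤ uFactor L n (mom (κ, (0 : Bdual L n))) ν := by
        intro ν
        refine two_div_pi_le_sinRatio ?_
        rw [mom, ← kMom_add_lMom]
        simpa [lMom] using two_mul_abs_labMin_le L t s κ ν
      have hu : (2 / Real.pi) ^ 4 ≤ un L n (mom (κ, (0 : Bdual L n))) := by
        rw [un, ← Fin.prod_const]
        exact Finset.prod_le_prod (fun _ _ => by positivity) fun ν _ => hk ν
      rw [hb₀, pow_mul]
      gcongr
    · have := l2_le_one_of_le_un hL hvw.left κ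
      refine le_trans (le_of_eq ?_) this
      exact le_antisymm (l2_mono fun i => by simp) (l2_mono fun i => by simp)

end

end PBS


namespace PBS

noncomputable section

/-! ### Entire functions of several variables -/

section Entire

variable {f : (Fin 3 → ℂ) → ℂ}

theorem hasDerivAt_line (hf : Differentiable ℂ f) (p e : Fin 3 → ℂ) (z : ℂ) :
    HasDerivAt (fun z : ℂ => f (p + z • e)) (fderiv ℂ f (p + z • e) e) z := by
  have h1 : HasDerivAt (fun z : ℂ => p + z • e) e z := by
    simpa using ((hasDerivAt_id z).smul_const e).const_add p
  exact (hf _).hasFDerivAt.comp_hasDerivAt z h1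

theorem differentiable_line (hf : Differentiable ℂ f) (p e : Fin 3 → ℂ) :
    Differentiable ℂ fun z : ℂ => f (p + z • e) := fun z =>
  (hasDerivAt_line hf p e z).differentiableAt

/-- Cauchy's estimate on the complex line through p in direction v, on the circle of radius 1 / ‖v‖.
-/
theorem norm_fderiv_le (hf : Differentiable ℂ f) (p : Fin 3 → ℂ) {M : ℝ}
    (hM : ∀ x, ‖x - p‖ ≤ 1 → ‖f x‖ ≤ M) : ‖fderiv ℂ f p‖ ≤ M := by
  have hM0 : 0 ≤ M := (norm_nonneg _).trans (hM p (by simp))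
  refine ContinuousLinearMap.opNorm_le_bound _ hM0 fun v => ?_
  rcases eq_or_ne v 0 with rfl | hv
  · simp
  have hv0 : 0 < ‖v‖ := norm_pos_iff.2 hv
  have h := (hasDerivAt_line hf p v 0).deriv
  rw [zero_smul, add_zero] at h
  rw [← h]
  have := Complex.norm_deriv_le_of_forall_mem_sphere_norm_le (c := 0) (R := 1 / ‖v‖) (C := M)
    (by positivity) (differentiable_line hf p v).diffContOnCl fun z hz => hM _ ?_
  · simpa [div_div_eq_mul_div] using this
  · have hz' : ‖z‖ = 1 / ‖v‖ := by simpa using hz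
    rw [add_sub_cancel_left, norm_smul, hz']
    field_simp
    exact le_rfl

theorem exists_bound_closedBall (hf : Differentiable ℂ f) (p : Fin 3 → ℂ) (r : ℝ) :
    ∃ M, ∀ x, ‖x - p‖ ≤ r → ‖f x‖ ≤ M := by
  obtain ⟨M, hM⟩ := (isCompact_closedBall p r).exists_bound_of_continuousOn hf.continuous.continuousOn
  exact ⟨M, fun x hx => hM x (by simpa [dist_eq_norm] using hx)⟩

/-- Directional derivatives of an entire function are entire. -/
theorem differentiable_fderiv_apply (hf : Differentiable ℂ f) (e : Fin 3 → ℂ) :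
    Differentiable ℂ fun p => fderiv ℂ f p e := by
  -- Cauchy's formula expresses the directional derivative as an integral of values of f, which may
  -- be differentiated in p under the integral sign.
  have hrep : (fun p => fderiv ℂ f p e) = fun p => (2 * Real.pi * Complex.I : ℂ)⁻¹ •
      ∫ θ in (0 : ℝ)..2 * Real.pi, (deriv (circleMap 0 1) θ * ((circleMap 0 1 θ - 0) ^ 2)⁻¹) •
        f (p + circleMap 0 1 θ • e) := by
    funext p
    have h := (hasDerivAt_line hf p e 0).deriv
    rw [zero_smul, add_zero] at h
    rw [← h, ← Complex.two_pi_I_inv_smul_circleIntegral_sub_sq_inv_smul_of_differentiable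
      isOpen_univ (Set.subset_univ (Metric.closedBall (0 : ℂ) 1))
      (differentiable_line hf p e).differentiableOn (by simp), circleIntegral]
    simp only [smul_smul]
  rw [hrep]
  intro p₀
  refine DifferentiableAt.const_smul (R := ℂ) (F := ℂ) ?_ _
  -- The radius adds up the distance 1 of x from p₀, the unit ball used in `norm_fderiv_le`, and the
  -- displacement along e.
  obtain ⟨M, hM⟩ := exists_bound_closedBall hf p₀ (2 + ‖e‖)
  have hc1 : Continuous fun θ => deriv (circleMap 0 1) θ * ((circleMap 0 1 θ - 0) ^ 2)⁻¹ := by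
    simp only [deriv_circleMap]
    refine ((continuous_circleMap 0 1).mul continuous_const).mul (Continuous.inv₀ ?_ ?_)
    · exact ((continuous_circleMap 0 1).sub continuous_const).pow 2
    · intro θ; simp
  have hc2 : ∀ x : Fin 3 → ℂ, Continuous fun θ => x + circleMap 0 1 θ • e := fun x =>
    continuous_const.add ((continuous_circleMap 0 1).smul continuous_const)
  have hcF : ∀ x, Continuous fun θ => (deriv (circleMap 0 1) θ * ((circleMap 0 1 θ - 0) ^ 2)⁻¹) •
      f (x + circleMap 0 1 θ • e) := fun x => hc1.smul (hf.continuous.comp (hc2 x))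
  refine (intervalIntegral.hasFDerivAt_integral_of_dominated_of_fderiv_le (𝕜 := ℂ)
    (s := Metric.ball p₀ 1) (bound := fun _ => M)
    (F' := fun x θ => (deriv (circleMap 0 1) θ * ((circleMap 0 1 θ - 0) ^ 2)⁻¹) •
      fderiv ℂ f (x + circleMap 0 1 θ • e)) (Metric.ball_mem_nhds _ one_pos)
    (Filter.Eventually.of_forall fun x => (hcF x).aestronglyMeasurable)
    ((hcF p₀).intervalIntegrable _ _) ?_ ?_ ?_ ?_).differentiableAt
  · refine (Measurable.aestronglyMeasurable ?_)
    exact hc1.measurable.smul ((measurable_fderiv ℂ f).comp (hc2 p₀).measurable)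
  · refine Filter.Eventually.of_forall fun θ _ x hx => ?_
    rw [norm_smul]
    have h1 : ‖deriv (circleMap 0 1) θ * ((circleMap 0 1 θ - 0) ^ 2)⁻¹‖ = 1 := by simp
    rw [h1, one_mul]
    refine norm_fderiv_le hf _ fun y hy => hM y ?_
    have hx' : ‖x - p₀‖ < 1 := by simpa [dist_eq_norm] using hx
    have h2 : ‖circleMap 0 1 θ • e‖ = ‖e‖ := by rw [norm_smul]; simp
    calc ‖y - p₀‖ = ‖(y - (x + circleMap 0 1 θ • e)) + (x - p₀) + circleMap 0 1 θ • e‖ := by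
          congr 1; abel
      _ ≤ 1 + 1 + ‖e‖ := by
          refine (norm_add_le _ _).trans (add_le_add ((norm_add_le _ _).trans
            (add_le_add hy hx'.le)) h2.le)
      _ = 2 + ‖e‖ := by ring
  · exact intervalIntegrable_const
  · refine Filter.Eventually.of_forall fun θ _ x _ => ?_
    have h1 : HasFDerivAt (fun x : Fin 3 → ℂ => x + circleMap 0 1 θ • e)
        (ContinuousLinearMap.id ℂ _) x := (hasFDerivAt_id x).add_const _
    exact HasFDerivAt.const_smul (R := ℂ) (F := ℂ) ((hf _).hasFDerivAt.comp x h1) _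

end Entire

/-! ### Taylor estimates in one variable -/

section Taylor

variable {f : ℂ → ℂ} {R M : ℝ}

theorem norm_deriv_le_of_norm_le (hf : Differentiable ℂ f)
    (h : ∀ z, ‖z‖ ≤ R + 1 → ‖f z‖ ≤ M) (z : ℂ) (hz : ‖z‖ ≤ R) : ‖deriv f z‖ ≤ M := by
  have := Complex.norm_deriv_le_of_forall_mem_sphere_norm_le (c := z) (R := 1) (C := M)
    one_pos hf.diffContOnCl fun w hw => h w ?_
  · simpa using this
  · have hw' : ‖w - z‖ = 1 := by simpa [dist_eq_norm] using hw
    calc ‖w‖ = ‖z + (w - z)‖ := by congr 1; ring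
      _ ≤ R + 1 := (norm_add_le _ _).trans (add_le_add hz hw'.le)

theorem norm_sub_le_of_norm_deriv_le {g g' : ℂ → ℂ} (hg : ∀ z, HasDerivAt g (g' z) z) {z : ℂ}
    (h : ∀ w, ‖w‖ ≤ ‖z‖ → ‖g' w‖ ≤ M) : ‖g z - g 0‖ ≤ M * ‖z‖ := by
  have := (convex_closedBall (0 : ℂ) ‖z‖).norm_image_sub_le_of_norm_hasDerivWithin_le
    (fun w _ => (hg w).hasDerivWithinAt) (fun w hw => h w (by simpa using hw))
    (x := 0) (y := z) (by simp) (by simp)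
  simpa using this

theorem norm_taylor_one_le (hf : Differentiable ℂ f)
    (h : ∀ z, ‖z‖ ≤ R → ‖deriv (deriv f) z‖ ≤ M) (z : ℂ) (hz : ‖z‖ ≤ R) :
    ‖f z - f 0 - z * deriv f 0‖ ≤ M * ‖z‖ ^ 2 := by
  have hd1 : Differentiable ℂ (deriv f) := hf.deriv
  have h1 : ∀ w, ‖w‖ ≤ ‖z‖ → ‖deriv f w - deriv f 0‖ ≤ M * ‖z‖ := fun w hw =>
    (norm_sub_le_of_norm_deriv_le (fun x => (hd1 x).hasDerivAt)
      fun x hx => h x (hx.trans (hw.trans hz))).trans (by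
        have : 0 ≤ M := (norm_nonneg _).trans (h z hz)
        gcongr)
  have := norm_sub_le_of_norm_deriv_le (g := fun w => f w - w * deriv f 0)
    (g' := fun w => deriv f w - deriv f 0) (z := z) (fun w => by
      have h2 := (hf w).hasDerivAt.sub ((hasDerivAt_id' w).mul_const (deriv f 0))
      rw [one_mul] at h2
      exact h2) h1
  calc ‖f z - f 0 - z * deriv f 0‖ = ‖f z - z * deriv f 0 - (f 0 - 0 * deriv f 0)‖ := by
        congr 1; ring
    _ ≤ _ := this
    _ = _ := by ring

theorem norm_taylor_two_le (hf : Differentiable ℂ f)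
    (h : ∀ z, ‖z‖ ≤ R → ‖deriv (deriv (deriv f)) z‖ ≤ M) (z : ℂ) (hz : ‖z‖ ≤ R) :
    ‖f z - f 0 - z * deriv f 0 - z ^ 2 / 2 * deriv (deriv f) 0‖ ≤ M * ‖z‖ ^ 3 := by
  have hd1 : Differentiable ℂ (deriv f) := hf.deriv
  have h1 : ∀ w, ‖w‖ ≤ ‖z‖ →
      ‖deriv f w - deriv f 0 - w * deriv (deriv f) 0‖ ≤ M * ‖z‖ ^ 2 := fun w hw =>
    (norm_taylor_one_le hd1 h w (hw.trans hz)).trans (by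
        have : 0 ≤ M := (norm_nonneg _).trans (h z hz)
        gcongr)
  have := norm_sub_le_of_norm_deriv_le
    (g := fun w => f w - w * deriv f 0 - w ^ 2 / 2 * deriv (deriv f) 0)
    (g' := fun w => deriv f w - deriv f 0 - w * deriv (deriv f) 0) (z := z) (fun w => by
      have h2 := ((hf w).hasDerivAt.sub ((hasDerivAt_id' w).mul_const (deriv f 0))).sub
        ((((hasDerivAt_id' w).pow 2).div_const 2).mul_const (deriv (deriv f) 0))
      have h3 : deriv f w - 1 * deriv f 0 - ((2 : ℕ) * w ^ (2 - 1) * 1 / 2) * deriv (deriv f) 0 =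
          deriv f w - deriv f 0 - w * deriv (deriv f) 0 := by norm_num
      rw [← h3]
      exact h2) h1
  calc _ = ‖f z - z * deriv f 0 - z ^ 2 / 2 * deriv (deriv f) 0 -
        (f 0 - 0 * deriv f 0 - 0 ^ 2 / 2 * deriv (deriv f) 0)‖ := by congr 1; ring
    _ ≤ _ := this
    _ = _ := by ring

end Taylor

end

end PBS


namespace PBS

noncomputable section

/-! ### The Fourier transform of the Hamiltonian -/

/-- A real momentum as a complex one. -/
def cvec (p : Fin 3 → ℝ) : Fin 3 → ℂ := fun i => (p i : ℂ)

theorem norm_cvec (p : Fin 3 → ℝ) : ‖cvec p‖ = ‖p‖ := by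
  simp only [Pi.norm_def, cvec]
  congr 2
  funext i
  exact NNReal.eq (by simp)

theorem continuous_cvec : Continuous cvec :=
  continuous_pi fun i => Complex.continuous_ofReal.comp (continuous_apply i)

theorem clm_apply_eq_sum (A : (Fin 3 → ℂ) →L[ℂ] ℂ) (v : Fin 3 → ℂ) :
    A v = ∑ j, v j * A (Pi.single j 1) := by
  conv_lhs => rw [← Finset.univ_sum_single v, map_sum]
  refine Finset.sum_congr rfl fun j _ => ?_
  rw [← smul_eq_mul, ← map_smul, ← Pi.single_smul, smul_eq_mul, mul_one]

variable {h : (Fin 3 → ℤ) → ℂ} {hhat : (Fin 3 → ℂ) → ℂ}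

/-- The second derivative along a line is the quadratic form of the Hessian, which connects the
one-variable Taylor formula with its positive definiteness. -/
theorem deriv_deriv_line (hf : Differentiable ℂ hhat) (v : Fin 3 → ℂ) :
    deriv (deriv fun z : ℂ => hhat (0 + z • v)) 0 =
      ∑ j, v j * ∑ i, v i *
        fderiv ℂ (fun p => fderiv ℂ hhat p (Pi.single j 1)) 0 (Pi.single i 1) := by
  have h1 : (deriv fun z : ℂ => hhat (0 + z • v)) =
      fun z => ∑ j, v j * fderiv ℂ hhat (0 + z • v) (Pi.single j 1) := by
    funext z
    rw [(hasDerivAt_line hf 0 v z).deriv, clm_apply_eq_sum]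
  rw [h1]
  refine HasDerivAt.deriv (HasDerivAt.fun_sum fun j _ => HasDerivAt.const_mul (v j) ?_)
  have h2 := hasDerivAt_line (differentiable_fderiv_apply hf (Pi.single j 1)) 0 v 0
  rw [clm_apply_eq_sum, zero_smul, add_zero] at h2
  exact h2

namespace IsHamiltonian

theorem exists_hessian_lower (H : IsHamiltonian h hhat) : ∃ c : ℝ, 0 < c ∧ ∀ v : Fin 3 → ℝ,
    ‖v‖ = 1 → c ≤ (deriv (deriv fun z : ℂ => hhat (0 + z • cvec v)) 0).re := by
  set A : Matrix (Fin 3) (Fin 3) ℝ := Matrix.of fun i j : Fin 3 =>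
    (fderiv ℂ (fun p => fderiv ℂ hhat p (Pi.single j 1)) 0 (Pi.single i 1)).re with hA
  have h1 : ∀ v : Fin 3 → ℝ, (deriv (deriv fun z : ℂ => hhat (0 + z • cvec v)) 0).re =
      v ⬝ᵥ A.mulVec v := by
    intro v
    rw [deriv_deriv_line H.entire, Complex.re_sum, dotProduct]
    simp only [cvec, Complex.re_ofReal_mul, Complex.re_sum, Matrix.mulVec, dotProduct, hA,
      Matrix.of_apply, Finset.mul_sum]
    rw [Finset.sum_comm]
    refine Finset.sum_congr rfl fun i _ => Finset.sum_congr rfl fun j _ => by ring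
  have hcont : Continuous fun v : Fin 3 → ℝ => v ⬝ᵥ A.mulVec v := by
    simp only [dotProduct, Matrix.mulVec]
    fun_prop
  have hne : (Metric.sphere (0 : Fin 3 → ℝ) 1).Nonempty := NormedSpace.sphere_nonempty.2 zero_le_one
  obtain ⟨v₀, hv₀, hmin⟩ := (isCompact_sphere (0 : Fin 3 → ℝ) 1).exists_isMinOn hne
    hcont.continuousOn
  refine ⟨v₀ ⬝ᵥ A.mulVec v₀, ?_, fun v hv => ?_⟩
  · have hne0 : v₀ ≠ 0 := by
      rintro rfl
      simp at hv₀
    simpa using H.hessian.dotProduct_mulVec_pos hne0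
  · rw [h1]
    exact hmin (by simpa using hv)

/-- Along the ray through p the value and the first derivative vanish at 0, so Taylor's formula
leaves the Hessian and a cubic remainder. -/
theorem exists_lower_near (H : IsHamiltonian h hhat) : ∃ c r : ℝ, 0 < c ∧ 0 < r ∧
    ∀ p : Fin 3 → ℝ, ‖p‖ ≤ r → c * ‖p‖ ^ 2 ≤ (hhat (cvec p)).re := by
  obtain ⟨c, hc, hlow⟩ := H.exists_hessian_lower
  -- A bound on the third derivative in the unit disc uses three Cauchy estimates, each costing one
  -- unit of radius.
  obtain ⟨M, hM⟩ := exists_bound_closedBall H.entire 0 4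
  have hM0 : 0 ≤ M := (norm_nonneg _).trans (hM 0 (by simp))
  -- The quadratic term gives c / 2; for ‖p‖ ≤ c / (4 (M + 1)) the cubic remainder takes away at
  -- most c / 4.
  refine ⟨c / 4, min 1 (c / (4 * (M + 1))), by positivity, by positivity, fun p hp => ?_⟩
  rcases eq_or_ne p 0 with rfl | hp0
  · have : cvec 0 = 0 := by funext i; simp [cvec]
    simp [this, H.zero]
  have hn : 0 < ‖p‖ := norm_pos_iff.2 hp0
  set v : Fin 3 → ℝ := ‖p‖⁻¹ • p with hv
  have hv1 : ‖v‖ = 1 := by rw [hv, norm_smul]; simp [hn.ne']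
  set g : ℂ → ℂ := fun z => hhat (0 + z • cvec v) with hg
  have hgd : Differentiable ℂ g := differentiable_line H.entire 0 _
  have hb : ∀ z : ℂ, ‖z‖ ≤ 1 + 1 + 1 + 1 → ‖g z‖ ≤ M := fun z hz => hM _ (by
    rw [zero_add, sub_zero, norm_smul, norm_cvec, hv1]; linarith)
  have hb3 : ∀ z : ℂ, ‖z‖ ≤ 1 → ‖deriv (deriv (deriv g)) z‖ ≤ M :=
    norm_deriv_le_of_norm_le hgd.deriv.deriv (norm_deriv_le_of_norm_le hgd.deriv
      (norm_deriv_le_of_norm_le hgd hb))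
  have ht : ‖((‖p‖ : ℝ) : ℂ)‖ = ‖p‖ := by simp
  have hT := norm_taylor_two_le hgd hb3 ((‖p‖ : ℝ) : ℂ) (by
    rw [ht]; exact hp.trans (min_le_left _ _))
  have hgp : g ((‖p‖ : ℝ) : ℂ) = hhat (cvec p) := by
    simp only [hg, zero_add]
    congr 1
    funext i
    simp only [cvec, hv, Pi.smul_apply, smul_eq_mul]
    rw [← Complex.ofReal_mul, mul_inv_cancel_left₀ hn.ne']
  have hg0 : g 0 = 0 := by simp [hg, H.zero]
  have hg1 : deriv g 0 = 0 := by
    rw [hg, (hasDerivAt_line H.entire 0 _ 0).deriv, clm_apply_eq_sum]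
    simp [H.gradient]
  rw [hgp, hg0, hg1, ht] at hT
  have hre := (Complex.abs_re_le_norm _).trans hT
  have hre2 : (hhat (cvec p) - 0 - ((‖p‖ : ℝ) : ℂ) * 0 -
      ((‖p‖ : ℝ) : ℂ) ^ 2 / 2 * deriv (deriv g) 0).re =
      (hhat (cvec p)).re - ‖p‖ ^ 2 / 2 * (deriv (deriv g) 0).re := by
    rw [show ((‖p‖ : ℝ) : ℂ) ^ 2 / 2 = ((‖p‖ ^ 2 / 2 : ℝ) : ℂ) by push_cast; ring,
      Complex.sub_re, Complex.re_ofReal_mul]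
    simp
  rw [hre2] at hre
  have h1 := (abs_le.1 hre).1
  have h2 : c ≤ (deriv (deriv g) 0).re := hlow v hv1
  have h3 : ‖p‖ * (4 * (M + 1)) ≤ c :=
    (le_div_iff₀ (by positivity)).1 (hp.trans (min_le_right _ _))
  have h4 : ‖p‖ ^ 2 / 2 * c ≤ ‖p‖ ^ 2 / 2 * (deriv (deriv g) 0).re := by gcongr
  have h5 : M * ‖p‖ ^ 3 ≤ c / 4 * ‖p‖ ^ 2 := by
    have : M * ‖p‖ ≤ c / 4 := by nlinarith
    calc M * ‖p‖ ^ 3 = (M * ‖p‖) * ‖p‖ ^ 2 := by ring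
      _ ≤ _ := by gcongr
  nlinarith

/-- The Fourier transform is bounded below by a quadratic form on the Brillouin zone. -/
theorem exists_lower (H : IsHamiltonian h hhat) : ∃ c : ℝ, 0 < c ∧
    ∀ p : Fin 3 → ℝ, ‖p‖ ≤ Real.pi → c * ∑ i, p i ^ 2 ≤ (hhat (cvec p)).re := by
  suffices hs : ∃ c : ℝ, 0 < c ∧
      ∀ p : Fin 3 → ℝ, ‖p‖ ≤ Real.pi → c * ‖p‖ ^ 2 ≤ (hhat (cvec p)).re by
    obtain ⟨c, hc, hl⟩ := hs
    refine ⟨c / 3, by positivity, fun p hp => le_trans ?_ (hl p hp)⟩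
    have : ∑ i, p i ^ 2 ≤ ∑ _i : Fin 3, ‖p‖ ^ 2 := Finset.sum_le_sum fun i _ => by
      rw [← sq_abs (p i)]
      have := norm_le_pi_norm p i
      rw [Real.norm_eq_abs] at this
      gcongr
    rw [Finset.sum_const, Finset.card_univ, Fintype.card_fin, nsmul_eq_mul] at this
    push_cast at this
    nlinarith
  obtain ⟨c, r, hc, hr, hl⟩ := H.exists_lower_near
  have hpi := Real.pi_pos
  have hcont : Continuous fun p : Fin 3 → ℝ => (hhat (cvec p)).re :=
    Complex.continuous_re.comp (H.entire.continuous.comp continuous_cvec)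
  -- Away from 0 compactness gives a positive minimum, since 0 is the only point of 2πℤ³ in the
  -- closed zone ‖p‖ ≤ π.
  set S : Set (Fin 3 → ℝ) := Metric.closedBall 0 Real.pi ∩ {p | r ≤ ‖p‖} with hS
  have hScomp : IsCompact S := (isCompact_closedBall 0 Real.pi).inter_right
    (isClosed_le continuous_const continuous_norm)
  have hpos : ∀ p ∈ S, 0 < (hhat (cvec p)).re := by
    intro p hp
    refine H.pos p ?_
    rintro ⟨z, hz⟩
    have hp1 : ‖p‖ ≤ Real.pi := by simpa using hp.1
    have hp0 : p = 0 := by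
      funext i
      have h1 := (norm_le_pi_norm p i).trans hp1
      rw [hz i, Real.norm_eq_abs, abs_mul, abs_of_pos (by positivity : 0 < 2 * Real.pi)] at h1
      have h2 : |(z i : ℝ)| < 1 := by nlinarith
      have h3 : z i = 0 := Int.abs_lt_one_iff.1 (by exact_mod_cast h2)
      rw [hz i, h3]; simp
    have h2 : r ≤ ‖p‖ := hp.2
    rw [hp0, norm_zero] at h2
    linarith
  rcases S.eq_empty_or_nonempty with hemp | hne
  · refine ⟨c, hc, fun p hp => hl p ?_⟩
    by_contra hcon
    have : p ∈ S := ⟨by simpa using hp, (not_le.1 hcon).le⟩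
    rw [hemp] at this
    exact this
  · obtain ⟨p₀, hp₀, hmin⟩ := hScomp.exists_isMinOn hne hcont.continuousOn
    have hm := hpos p₀ hp₀
    refine ⟨min c ((hhat (cvec p₀)).re / Real.pi ^ 2), by positivity, fun p hp => ?_⟩
    rcases le_total ‖p‖ r with hpr | hpr
    · refine le_trans ?_ (hl p hpr)
      gcongr
      exact min_le_left _ _
    · have h1 : (hhat (cvec p₀)).re ≤ (hhat (cvec p)).re := hmin ⟨by simpa using hp, hpr⟩
      refine le_trans ?_ h1
      calc _ ≤ (hhat (cvec p₀)).re / Real.pi ^ 2 * Real.pi ^ 2 := by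
            gcongr
            exact min_le_right _ _
        _ = _ := by field_simp

/-- Shifting one momentum component into the complex plane lowers the real part of the Fourier
transform at most quadratically. -/
theorem exists_shift_lower (H : IsHamiltonian h hhat) : ∃ C : ℝ, 0 < C ∧
    ∀ (p : Fin 3 → ℝ) (i : Fin 3) (δ : ℝ), ‖p‖ ≤ Real.pi → |δ| ≤ 2 →
      (hhat (cvec p)).re - C * δ ^ 2 ≤
        (hhat (cvec p + (δ * Complex.I) • Pi.single i 1)).re := by
  -- The momentum has norm at most π, the shift at most 2, and the two Cauchy estimates need one
  -- unit each.
  obtain ⟨M, hM⟩ := exists_bound_closedBall H.entire 0 (Real.pi + 4)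
  have hpi := Real.pi_pos
  have hM0 : 0 ≤ M := (norm_nonneg _).trans (hM 0 (by simp; positivity))
  refine ⟨M + 1, by positivity, fun p i δ hp hδ => ?_⟩
  set g : ℂ → ℂ := fun z => hhat (cvec p + z • Pi.single i 1) with hg
  have hgd : Differentiable ℂ g := differentiable_line H.entire _ _
  have hb : ∀ z : ℂ, ‖z‖ ≤ 2 + 1 + 1 → ‖g z‖ ≤ M := fun z hz => hM _ (by
    rw [sub_zero]
    refine (norm_add_le _ _).trans ?_
    rw [norm_cvec, norm_smul, Pi.norm_single, norm_one, mul_one]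
    linarith)
  have hb2 : ∀ z : ℂ, ‖z‖ ≤ 2 → ‖deriv (deriv g) z‖ ≤ M :=
    norm_deriv_le_of_norm_le hgd.deriv (norm_deriv_le_of_norm_le hgd hb)
  have hz : ‖(δ : ℂ) * Complex.I‖ = |δ| := by simp
  have hT := norm_taylor_one_le hgd hb2 ((δ : ℂ) * Complex.I) (by rw [hz]; exact hδ)
  rw [hz, sq_abs] at hT
  -- On real momenta the transform is real, so its derivative is real and the linear term i δ g'(0)
  -- does not affect the real part.
  have him : (deriv g 0).im = 0 := by
    have h1 : HasDerivAt (fun x : ℝ => (g x).im) (deriv g 0).im 0 := by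
      have h2 : HasDerivAt (fun x : ℝ => g x) (deriv g 0) 0 := by
        have h3 : HasDerivAt g (deriv g 0) ((0 : ℝ) : ℂ) := by
          simpa using (hgd 0).hasDerivAt
        exact h3.comp_ofReal
      exact (Complex.imCLM.hasFDerivAt.comp_hasDerivAt (0 : ℝ) h2)
    have h2 : (fun x : ℝ => (g x).im) = fun _ => 0 := by
      funext x
      have : cvec p + (x : ℂ) • Pi.single i 1 = cvec (p + x • Pi.single i 1) := by
        funext k
        simp only [cvec, Pi.add_apply, Pi.smul_apply, smul_eq_mul, Pi.single_apply]
        split_ifs <;> simp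
      simp only [hg, this]
      exact H.real _
    rw [h2] at h1
    exact h1.unique (hasDerivAt_const _ _)
  have hre := (abs_le.1 ((Complex.abs_re_le_norm _).trans hT)).1
  have h2 : ((δ : ℂ) * Complex.I * deriv g 0).re = 0 := by
    rw [mul_assoc, Complex.re_ofReal_mul, Complex.I_mul_re, him]; simp
  rw [Complex.sub_re, Complex.sub_re, h2] at hre
  have hg0 : g 0 = hhat (cvec p) := by simp [hg]
  rw [hg0] at hre
  have : (g ((δ : ℂ) * Complex.I)).re = (hhat (cvec p + ((δ : ℂ) * Complex.I) • Pi.single i 1)).re :=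
    rfl
  nlinarith [sq_nonneg δ]

/-- The Fourier transform is periodic in each component, also at complex values of it. -/
theorem periodic (H : IsHamiltonian h hhat) (p : Fin 3 → ℝ) (i : Fin 3) (z : ℂ) :
    hhat (cvec p + (z + 2 * Real.pi) • Pi.single i 1) = hhat (cvec p + z • Pi.single i 1) := by
  have hper : ∀ r : Fin 3 → ℝ, hhat (cvec (r + (2 * Real.pi) • Pi.single i 1)) = hhat (cvec r) := by
    intro r
    refine (H.fourier _).unique ?_
    convert H.fourier r using 3 with x
    on_goal 2 => rfl
    have h1 : ∑ k, (r + (2 * Real.pi) • Pi.single i (1 : ℝ) : Fin 3 → ℝ) k * (x k : ℝ) =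
        ∑ k, r k * x k + 2 * Real.pi * x i := by
      simp only [Pi.add_apply, Pi.smul_apply, smul_eq_mul, Pi.single_apply, add_mul,
        Finset.sum_add_distrib]
      simp
    rw [h1, Complex.exp_eq_exp_iff_exists_int]
    exact ⟨-x i, by push_cast; ring⟩
  have hcv : ∀ x : ℝ, cvec p + (x : ℂ) • Pi.single i 1 = cvec (p + x • Pi.single i 1) := by
    intro x
    funext k
    simp only [cvec, Pi.add_apply, Pi.smul_apply, smul_eq_mul, Pi.single_apply]
    split_ifs <;> simp
  set F : ℂ → ℂ := fun z => hhat (cvec p + (z + 2 * Real.pi) • Pi.single i 1) with hF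
  set G : ℂ → ℂ := fun z => hhat (cvec p + z • Pi.single i 1) with hG
  have hGd : Differentiable ℂ G := differentiable_line H.entire _ _
  have hFd : Differentiable ℂ F := hGd.comp (differentiable_id.add_const _)
  have hreal : ∀ x : ℝ, F x = G x := by
    intro x
    have e1 : ((x : ℂ) + 2 * Real.pi) = ((x + 2 * Real.pi : ℝ) : ℂ) := by push_cast; ring
    simp only [hF, hG]
    rw [e1, hcv, hcv, add_smul, ← add_assoc, hper]
  -- Both sides are entire in z and agree on the real line, which accumulates at 0; the identity
  -- theorem extends periodicity to complex z.
  have hfreq : ∃ᶠ w in nhdsWithin (0 : ℂ) {0}ᶜ, F w = G w := by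
    have ht : Filter.Tendsto (fun x : ℝ => (x : ℂ)) (nhdsWithin 0 {0}ᶜ) (nhdsWithin 0 {0}ᶜ) := by
      refine tendsto_nhdsWithin_iff.2 ⟨?_, ?_⟩
      · exact (Complex.continuous_ofReal.tendsto' 0 0 (by simp)).mono_left nhdsWithin_le_nhds
      · filter_upwards [self_mem_nhdsWithin] with x hx
        simpa using hx
    exact ht.frequently (Filter.Eventually.of_forall hreal).frequently
  have := AnalyticOnNhd.eq_of_frequently_eq (z₀ := 0)
    (fun z _ => hFd.analyticAt z) (fun z _ => hGd.analyticAt z) hfreq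
  exact congrFun this z

end IsHamiltonian

end

end PBS


namespace PBS

noncomputable section

/-! ### Discrete Fourier sums of periodic entire functions -/

section Periodic

variable {f : ℂ → ℂ}

open Complex in
-- Cauchy's theorem on a rectangle: the two vertical sides cancel by periodicity, the exponential
-- with integer frequency being periodic too.
theorem integral_shift (hf : Differentiable ℂ f) (hper : ∀ z, f (z + 2 * Real.pi) = f z) (m : ℤ)
    (y : ℝ) : ∫ t in (-Real.pi)..Real.pi, f t * exp (-(I * m * t)) =
      ∫ t in (-Real.pi)..Real.pi, f (t + y * I) * exp (-(I * m * (t + y * I))) := by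
  have hg : Differentiable ℂ fun z => f z * exp (-(I * m * z)) :=
    hf.mul (((differentiable_id.const_mul (I * m)).neg).cexp)
  have h := integral_boundary_rect_eq_zero_of_differentiableOn
    (fun z => f z * exp (-(I * m * z))) (-Real.pi : ℂ) (Real.pi + y * I) hg.differentiableOn
  have hside : ∀ y' : ℝ, f (Real.pi + y' * I) * exp (-(I * m * (Real.pi + y' * I))) =
      f (-Real.pi + y' * I) * exp (-(I * m * (-Real.pi + y' * I))) := by
    intro y'
    have e1 : (Real.pi : ℂ) + y' * I = (-Real.pi + y' * I) + 2 * Real.pi := by ring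
    have e2 : -(I * m * (Real.pi + y' * I)) =
        -(I * m * (-Real.pi + y' * I)) + ((-m : ℤ) : ℂ) * (2 * Real.pi * I) := by
      push_cast; ring
    rw [e2, Complex.exp_add, exp_int_mul_two_pi_mul_I, mul_one, e1, hper]
  simp only [neg_re, ofReal_re, add_re, mul_re, I_re, mul_zero, ofReal_im, I_im, mul_one, sub_self,
    add_zero, neg_im, neg_zero, ofReal_zero, zero_mul, add_im, mul_im, zero_add, ofReal_neg,
    hside] at h
  rw [add_sub_cancel_right] at h
  exact sub_eq_zero.1 h

open Complex in
theorem norm_integral_mul_exp_le (hf : Differentiable ℂ f)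
    (hper : ∀ z, f (z + 2 * Real.pi) = f z) {δ J : ℝ}
    (hJ : ∀ σ : ℝ, σ = δ ∨ σ = -δ → ∫ t in (-Real.pi)..Real.pi, ‖f (t + σ * I)‖ ≤ J) (m : ℤ) :
    ‖∫ t in (-Real.pi)..Real.pi, f t * exp (-(I * m * t))‖ ≤ J * Real.exp (-(δ * |(m : ℝ)|)) := by
  -- The line is shifted to the side on which exp(-i m z) decays.
  obtain ⟨y, hy, hym⟩ : ∃ y : ℝ, (y = δ ∨ y = -δ) ∧ m * y = -(δ * |(m : ℝ)|) := by
    rcases le_total 0 (m : ℝ) with hm | hm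
    · exact ⟨-δ, Or.inr rfl, by rw [abs_of_nonneg hm]; ring⟩
    · exact ⟨δ, Or.inl rfl, by rw [abs_of_nonpos hm]; ring⟩
  rw [integral_shift hf hper m y]
  have hpi := Real.pi_pos
  refine (intervalIntegral.norm_integral_le_integral_norm (by linarith)).trans ?_
  have h1 : ∀ t : ℝ, ‖f (t + y * I) * exp (-(I * m * (t + y * I)))‖ =
      ‖f (t + y * I)‖ * Real.exp (-(δ * |(m : ℝ)|)) := by
    intro t
    rw [norm_mul, Complex.norm_exp, ← hym]
    congr 2
    simp
  simp only [h1]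
  rw [intervalIntegral.integral_mul_const]
  gcongr
  exact hJ y hy

/-- The discrete Fourier transform of the restriction to a finite group of a periodic entire
function decays exponentially. -/
theorem norm_dft_le (hf : Differentiable ℂ f) (hper : ∀ z, f (z + 2 * Real.pi) = f z) {δ J : ℝ}
    (hδ : 0 < δ)
    (hJ : ∀ σ : ℝ, σ = δ ∨ σ = -δ →
      ∫ t in (-Real.pi)..Real.pi, ‖f (t + σ * Complex.I)‖ ≤ J) (S : ℕ) [NeZero S] (x : ZMod S) :
    ‖(S : ℂ)⁻¹ * ∑ r : ZMod S, f ((2 * Real.pi * r.valMinAbs / S : ℝ) : ℂ) *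
        ZMod.stdAddChar (r * x)‖ ≤
      J / (2 * Real.pi) * (3 * Real.exp (-(δ * |(x.valMinAbs : ℝ)|)) / (1 - Real.exp (-(δ * S)))) := by
  classical
  have hpi := Real.pi_pos
  have : Fact (0 < 2 * Real.pi) := ⟨by positivity⟩
  have hS : (S : ℂ) ≠ 0 := by exact_mod_cast NeZero.ne S
  have hperR : Function.Periodic (fun t : ℝ => f t) (2 * Real.pi) := fun t => by
    have := hper t
    push_cast; exact this
  have hcont : Continuous (hperR.lift : AddCircle (2 * Real.pi) → ℂ) :=
    continuous_coinduced_dom.2 (hf.continuous.comp Complex.continuous_ofReal)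
  set F : C(AddCircle (2 * Real.pi), ℂ) := ⟨hperR.lift, hcont⟩ with hF
  have hFc : ∀ t : ℝ, F (t : AddCircle (2 * Real.pi)) = f t := fun t => rfl
  set A : ℤ → ℂ := fun m => fourierCoeff F m with hA
  have hAb : ∀ m, ‖A m‖ ≤ J / (2 * Real.pi) * Real.exp (-(δ * |(m : ℝ)|)) := by
    intro m
    have h1 := fourierCoeff_eq_intervalIntegral F m (-Real.pi)
    have h2 : (-Real.pi) + 2 * Real.pi = Real.pi := by ring
    rw [h2] at h1
    have h3 : ∀ t : ℝ, (fourier (-m) (t : AddCircle (2 * Real.pi))) • F (t : AddCircle (2 * Real.pi))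
        = f t * Complex.exp (-(Complex.I * m * t)) := by
      intro t
      rw [hFc, fourier_coe_apply, smul_eq_mul, mul_comm]
      congr 2
      have : (Real.pi : ℂ) ≠ 0 := by exact_mod_cast hpi.ne'
      push_cast
      field_simp
    simp only [h3] at h1
    rw [hA]
    simp only [h1, norm_smul]
    have := norm_integral_mul_exp_le hf hper hJ m
    rw [Real.norm_of_nonneg (by positivity)]
    calc _ ≤ 1 / (2 * Real.pi) * (J * Real.exp (-(δ * |(m : ℝ)|))) := by gcongr
      _ = _ := by ring
  have hsumexp : Summable fun m : ℤ => Real.exp (-(δ * |(m : ℝ)|)) := by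
    simpa [Subsingleton.elim _ (0 : ZMod 1)] using (sum_exp_residue 1 0 hδ).1
  have hAs : Summable A := Summable.of_norm_bounded (hsumexp.mul_left _) hAb
  have hchar : ∀ (m : ℤ) (r : ZMod S),
      fourier m (((2 * Real.pi * r.valMinAbs / S : ℝ) : ℝ) : AddCircle (2 * Real.pi)) =
        ZMod.stdAddChar (r * (m : ZMod S)) := by
    intro m r
    have h1 : r * (m : ZMod S) = ((r.valMinAbs * m : ℤ) : ZMod S) := by simp
    rw [h1, ZMod.stdAddChar_coe, fourier_coe_apply]
    congr 1
    have : (Real.pi : ℂ) ≠ 0 := by exact_mod_cast hpi.ne'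
    push_cast
    field_simp
  have hpt : ∀ r : ZMod S, HasSum (fun m => A m * ZMod.stdAddChar (r * (m : ZMod S)))
      (f ((2 * Real.pi * r.valMinAbs / S : ℝ) : ℂ)) := by
    intro r
    have := has_pointwise_sum_fourier_series_of_summable (f := F) hAs
      (((2 * Real.pi * r.valMinAbs / S : ℝ) : ℝ) : AddCircle (2 * Real.pi))
    simp only [hchar, smul_eq_mul, hFc] at this
    exact this
  -- Poisson summation on the finite group: the character sum selects the Fourier coefficients whose
  -- index lies in the class of -x. Their decay is then summed by `sum_exp_residue`.
  have horth : ∀ m : ℤ, (S : ℂ)⁻¹ * ∑ r : ZMod S,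
      A m * ZMod.stdAddChar (r * (m : ZMod S)) * ZMod.stdAddChar (r * x) =
      if (m : ZMod S) = -x then A m else 0 := by
    intro m
    have h1 : ∀ r : ZMod S, A m * ZMod.stdAddChar (r * (m : ZMod S)) * ZMod.stdAddChar (r * x) =
        A m * ZMod.stdAddChar (r * ((m : ZMod S) + x)) := by
      intro r
      rw [mul_add, AddChar.map_add_eq_mul, mul_assoc]
    simp only [h1]
    rw [← Finset.mul_sum, AddChar.sum_mulShift _ (ZMod.isPrimitive_stdAddChar S), ZMod.card]
    simp only [← eq_neg_iff_add_eq_zero]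
    split_ifs
    · field_simp
    · simp
  have hsum : HasSum (fun m : ℤ => if (m : ZMod S) = -x then A m else 0)
      ((S : ℂ)⁻¹ * ∑ r : ZMod S, f ((2 * Real.pi * r.valMinAbs / S : ℝ) : ℂ) *
        ZMod.stdAddChar (r * x)) := by
    have := (hasSum_sum (s := Finset.univ) fun r (_ : r ∈ Finset.univ) =>
      (hpt r).mul_right (ZMod.stdAddChar (r * x))).mul_left ((S : ℂ)⁻¹)
    simp only [horth] at this
    exact this
  obtain ⟨hs1, hs2⟩ := sum_exp_residue S (-x) hδ
  have hJ0 : 0 ≤ J / (2 * Real.pi) := by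
    have := (norm_nonneg _).trans (hAb 0)
    simpa using this
  rw [← hsum.tsum_eq]
  refine (tsum_of_norm_bounded ((hs1.mul_left (J / (2 * Real.pi))).hasSum) fun m => ?_).trans ?_
  · split_ifs
    · exact hAb m
    · simp
  · rw [tsum_mul_left]
    rw [← Int.cast_abs, abs_valMinAbs_neg, Int.cast_abs] at hs2
    gcongr

end Periodic

end

end PBS


namespace PBS

noncomputable section

/-! ### The heat kernel on a discrete torus -/

section Heat

variable {N : Fin 3 → ℕ} [∀ i, NeZero (N i)]

/-- The shortest representative of the momentum with label `r`. -/
def torusMom (N : Fin 3 → ℕ) (r : ∀ i, ZMod (N i)) (i : Fin 3) : ℝ :=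
  2 * Real.pi * (r i).valMinAbs / N i

/-- The kernel of `e ^ (-j h)` on a discrete torus. -/
def heat (hhat : (Fin 3 → ℂ) → ℂ) (N : Fin 3 → ℕ) [∀ i, NeZero (N i)] (j : ℕ)
    (x : ∀ i, ZMod (N i)) : ℂ :=
  (∏ i, (N i : ℂ))⁻¹ * ∑ r : ∀ i, ZMod (N i),
    Complex.exp (-(j * hhat (cvec (torusMom N r)))) * ∏ i, ZMod.stdAddChar (r i * x i)

theorem abs_two_pi_valMinAbs_div_le (S : ℕ) [NeZero S] (r : ZMod S) :
    |2 * Real.pi * r.valMinAbs / S| ≤ Real.pi := by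
  have hpi := Real.pi_pos
  have hS : (0 : ℝ) < S := by exact_mod_cast Nat.pos_of_ne_zero (NeZero.ne S)
  have h2 : 2 * |(r.valMinAbs : ℝ)| ≤ S := by
    exact_mod_cast two_mul_abs_valMinAbs_le S r
  rw [abs_div, abs_mul, abs_of_pos (by positivity : 0 < 2 * Real.pi), abs_of_pos hS,
    div_le_iff₀ hS]
  nlinarith

/-- Completing the square; the Gaussian is traded for an exponential, whose sums are already
available. -/
theorem exp_neg_sq_le (y : ℝ) : Real.exp (-y ^ 2) ≤ Real.exp (1 / 4) * Real.exp (-|y|) := by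
  rw [← Real.exp_add, Real.exp_le_exp, ← sq_abs y]
  nlinarith [sq_nonneg (|y| - 1 / 2)]

/-- Riemann sums of a Gaussian. -/
theorem sum_gaussian_le {c : ℝ} (hc : 0 < c) (S : ℕ) [NeZero S] {j : ℕ} (hj : 1 ≤ j) :
    (S : ℝ)⁻¹ * ∑ r : ZMod S, Real.exp (-(j * (c * (2 * Real.pi * r.valMinAbs / S) ^ 2))) ≤
      3 * Real.exp (1 / 4) * (1 + 1 / √c) * (1 / √j + 1 / S) := by
  have hpi := Real.pi_gt_three
  have hS : (0 : ℝ) < S := by exact_mod_cast Nat.pos_of_ne_zero (NeZero.ne S)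
  have hj0 : (0 : ℝ) < √j := Real.sqrt_pos.2 (by exact_mod_cast hj)
  have hc0 : 0 < √c := Real.sqrt_pos.2 hc
  set α : ℝ := √j * √c * (2 * Real.pi) / S with hα
  have hα0 : 0 < α := by positivity
  have h1 : ∀ r : ZMod S, Real.exp (-(j * (c * (2 * Real.pi * r.valMinAbs / S) ^ 2))) ≤
      Real.exp (1 / 4) * Real.exp (-(α * |(r.valMinAbs : ℝ)|)) := by
    intro r
    have h2 := exp_neg_sq_le (α * r.valMinAbs)
    rw [abs_mul, abs_of_pos hα0] at h2
    refine le_trans (le_of_eq ?_) h2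
    congr 1
    have e1 : (j : ℝ) = √j ^ 2 := (Real.sq_sqrt (by positivity)).symm
    have e2 : c = √c ^ 2 := (Real.sq_sqrt hc.le).symm
    rw [hα]
    conv_lhs => rw [e1, e2]
    ring
  calc _ ≤ (S : ℝ)⁻¹ * (Real.exp (1 / 4) * (3 * (1 + 1 / α))) := by
        gcongr
        refine (Finset.sum_le_sum fun r _ => h1 r).trans ?_
        rw [← Finset.mul_sum]
        gcongr
        exact sum_exp_valMinAbs_le S hα0
    _ = 3 * Real.exp (1 / 4) * (1 / S + 1 / √c * (1 / √j) * (1 / (2 * Real.pi))) := by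
        rw [hα]; field_simp
    _ ≤ 3 * Real.exp (1 / 4) * (1 / S + 1 / √c * (1 / √j) * 1) := by
        gcongr
        rw [div_le_one (by positivity)]; linarith
    _ ≤ _ := by
        rw [mul_assoc (3 * Real.exp (1 / 4))]
        gcongr
        have : 0 ≤ 1 / √c * (1 / S) := by positivity
        have : 0 ≤ 1 / √(j : ℝ) := by positivity
        nlinarith

theorem integral_gaussian_le {b : ℝ} (hb : 0 < b) :
    ∫ t in (-Real.pi)..Real.pi, Real.exp (-b * t ^ 2) ≤ √(Real.pi / b) := by
  have hpi := Real.pi_pos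
  rw [intervalIntegral.integral_of_le (by linarith), ← integral_gaussian b]
  exact MeasureTheory.setIntegral_le_integral (integrable_exp_neg_mul_sq hb)
    (Filter.Eventually.of_forall fun t => (Real.exp_pos _).le)

variable {h : (Fin 3 → ℤ) → ℂ} {hhat : (Fin 3 → ℂ) → ℂ}

/-- Exponential decay of the heat kernel in one direction. -/
theorem IsHamiltonian.exists_heat_le_dir (H : IsHamiltonian h hhat) : ∃ K : ℝ, 0 < K ∧
    ∀ (N : Fin 3 → ℕ) [∀ i, NeZero (N i)] (ε : ℝ), (∀ i, 1 / (N i : ℝ) ≤ ε) → ∀ (j : ℕ), 1 ≤ j →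
    ∀ (δ : ℝ), 1 / √j ≤ δ → δ ≤ 2 → ∀ (x : ∀ i, ZMod (N i)) (i : Fin 3),
      ‖heat hhat N j x‖ ≤ K * Real.exp (K * (δ ^ 2 * j)) * (1 / √j + ε) ^ 3 *
        Real.exp (-(δ * |((x i).valMinAbs : ℝ)|)) := by
  obtain ⟨c, hc, hlow⟩ := H.exists_lower
  obtain ⟨C, hC, hshift⟩ := H.exists_shift_lower
  have hpi := Real.pi_pos
  set G : ℝ := 3 * Real.exp (1 / 4) * (1 + 1 / √c) with hG
  have hG0 : 0 < G := by positivity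
  set K₁ : ℝ := √(Real.pi / c) / (2 * Real.pi) * 3 * G ^ 2 with hK₁
  have hK₁0 : 0 < K₁ := by positivity
  refine ⟨C + K₁, by positivity, ?_⟩
  intro N _ ε hε j hj δ hδ1 hδ2 x i
  have hj' : (1 : ℝ) ≤ j := by exact_mod_cast hj
  have hj0 : (0 : ℝ) < √j := Real.sqrt_pos.2 (by linarith)
  have hδ0 : 0 < δ := lt_of_lt_of_le (by positivity) hδ1
  have hN : ∀ k, (0 : ℝ) < N k := fun k => by exact_mod_cast Nat.pos_of_ne_zero (NeZero.ne (N k))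
  have hε0 : 0 < ε := lt_of_lt_of_le (one_div_pos.2 (hN 0)) (hε 0)
  let base : (∀ k : Fin 2, ZMod (N (i.succAbove k))) → Fin 3 → ℝ := fun r' =>
    i.insertNth (α := fun _ => ℝ) 0 fun k => 2 * Real.pi * (r' k).valMinAbs / N (i.succAbove k)
  have hmom : ∀ (r : ZMod (N i)) (r' : ∀ k : Fin 2, ZMod (N (i.succAbove k))),
      cvec (torusMom N (i.insertNth r r')) =
        cvec (base r') + ((2 * Real.pi * r.valMinAbs / N i : ℝ) : ℂ) • Pi.single i 1 := by
    intro r r'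
    funext k
    refine Fin.succAboveCases i ?_ (fun k => ?_) k
    · simp [cvec, torusMom, base]
    · simp [cvec, torusMom, base, Fin.succAbove_ne]
  let fz : (∀ k : Fin 2, ZMod (N (i.succAbove k))) → ℂ → ℂ := fun r' z =>
    Complex.exp (-(j * hhat (cvec (base r') + z • Pi.single i 1)))
  -- The sum over momenta is arranged so that the innermost sum is a one-dimensional discrete
  -- Fourier transform in direction i, to which the contour shift applies.
  have hsplit : heat hhat N j x = ∑ r' : ∀ k : Fin 2, ZMod (N (i.succAbove k)),
      (∏ k : Fin 2, ((N (i.succAbove k) : ℂ)⁻¹ * ZMod.stdAddChar (r' k * x (i.succAbove k)))) *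
      ((N i : ℂ)⁻¹ * ∑ r : ZMod (N i), fz r' ((2 * Real.pi * r.valMinAbs / N i : ℝ) : ℂ) *
        ZMod.stdAddChar (r * x i)) := by
    rw [heat, ← (Fin.insertNthEquiv (fun k => ZMod (N k)) i).sum_comp, Fintype.sum_prod_type,
      Finset.sum_comm, Finset.mul_sum]
    refine Finset.sum_congr rfl fun r' _ => ?_
    rw [Finset.mul_sum, Finset.mul_sum, Finset.mul_sum]
    refine Finset.sum_congr rfl fun r _ => ?_
    have e1 : (Fin.insertNthEquiv (fun k => ZMod (N k)) i) (r, r') = i.insertNth r r' := rfl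
    rw [e1]
    simp only [hmom, fz, Fin.prod_univ_succAbove _ i,
      Fin.insertNth_apply_same, Fin.insertNth_apply_succAbove, Finset.prod_mul_distrib,
      Finset.prod_inv_distrib]
    rw [mul_inv]
    generalize Complex.exp _ = E
    ring
  set g : (∀ k : Fin 2, ZMod (N (i.succAbove k))) → ℝ := fun r' =>
    ∏ k, Real.exp (-(j * (c * (2 * Real.pi * (r' k).valMinAbs / N (i.succAbove k)) ^ 2))) with hg
  have hfib : ∀ r', ‖(N i : ℂ)⁻¹ * ∑ r : ZMod (N i),
      fz r' ((2 * Real.pi * r.valMinAbs / N i : ℝ) : ℂ) * ZMod.stdAddChar (r * x i)‖ ≤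
      g r' * (√(Real.pi / c) / (2 * Real.pi) * 3 * Real.exp (C * (δ ^ 2 * j)) * (1 / √j + ε) *
        Real.exp (-(δ * |((x i).valMinAbs : ℝ)|))) := by
    intro r'
    have hd : Differentiable ℂ (fz r') :=
      (((differentiable_line H.entire _ _).const_mul (j : ℂ)).neg).cexp
    have hp : ∀ z, fz r' (z + 2 * Real.pi) = fz r' z := fun z => by
      simp only [fz, H.periodic]
    -- On the shifted line the real part of the transform is at least c |p|² - C δ². The transverse
    -- components of c |p|² give g r', the component i gives a Gaussian in t.
    have hJ : ∀ σ : ℝ, σ = δ ∨ σ = -δ →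
        ∫ t in (-Real.pi)..Real.pi, ‖fz r' (t + σ * Complex.I)‖ ≤
          g r' * Real.exp (C * (δ ^ 2 * j)) * √(Real.pi / (j * c)) := by
      intro σ hσ
      have hσ2 : σ ^ 2 = δ ^ 2 := by rcases hσ with rfl | rfl <;> ring
      have hσa : |σ| ≤ 2 := by
        rcases hσ with rfl | rfl
        · rwa [abs_of_pos hδ0]
        · rwa [abs_neg, abs_of_pos hδ0]
      have hcn : Continuous fun t : ℝ => ‖fz r' (t + σ * Complex.I)‖ :=
        (hd.continuous.comp (by fun_prop)).norm
      have hb : 0 < (j : ℝ) * c := by positivity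
      have hle : ∀ t ∈ Set.Icc (-Real.pi) Real.pi, ‖fz r' (t + σ * Complex.I)‖ ≤
          g r' * Real.exp (C * (δ ^ 2 * j)) * Real.exp (-(j * c) * t ^ 2) := by
        intro t ht
        set p : Fin 3 → ℝ := i.insertNth (α := fun _ => ℝ) t fun k =>
          2 * Real.pi * (r' k).valMinAbs / N (i.succAbove k) with hpdef
        have hpn : ‖p‖ ≤ Real.pi := by
          refine (pi_norm_le_iff_of_nonneg hpi.le).2 fun k => ?_
          refine Fin.succAboveCases i ?_ (fun k => ?_) k
          · simpa [hpdef] using abs_le.2 ht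
          · simpa only [hpdef, Fin.insertNth_apply_succAbove, Real.norm_eq_abs] using
              abs_two_pi_valMinAbs_div_le _ (r' k)
        have hvec : cvec (base r') + ((t : ℂ) + σ * Complex.I) • Pi.single i 1 =
            cvec p + (σ * Complex.I) • Pi.single i 1 := by
          funext k
          refine Fin.succAboveCases i ?_ (fun k => ?_) k
          · simp [cvec, base, hpdef]
          · simp [cvec, base, hpdef, Fin.succAbove_ne]
        have h1 := hshift p i σ hpn hσa
        have h2 := hlow p hpn
        rw [Fin.sum_univ_succAbove _ i] at h2
        simp only [hpdef, Fin.insertNth_apply_same, Fin.insertNth_apply_succAbove] at h2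
        rw [← hpdef] at h2
        simp only [fz, hg]
        rw [hvec, Complex.norm_exp, ← Real.exp_sum, ← Real.exp_add, ← Real.exp_add,
          Real.exp_le_exp, Complex.neg_re, ← Complex.ofReal_natCast, Complex.re_ofReal_mul,
          Finset.sum_neg_distrib, ← Finset.mul_sum, ← Finset.mul_sum]
        rw [hσ2] at h1
        nlinarith
      calc _ ≤ ∫ t in (-Real.pi)..Real.pi,
            g r' * Real.exp (C * (δ ^ 2 * j)) * Real.exp (-(j * c) * t ^ 2) :=
            intervalIntegral.integral_mono_on (by linarith) (hcn.intervalIntegrable _ _)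
              (Continuous.intervalIntegrable (by fun_prop) _ _) hle
        _ ≤ _ := by
            rw [intervalIntegral.integral_const_mul]
            have : 0 ≤ g r' := Finset.prod_nonneg fun _ _ => (Real.exp_pos _).le
            gcongr
            exact integral_gaussian_le hb
    refine (norm_dft_le hd hp hδ0 hJ (N i) (x i)).trans ?_
    have hg0 : 0 ≤ g r' := Finset.prod_nonneg fun _ _ => (Real.exp_pos _).le
    have hsq : √(Real.pi / (j * c)) = √(Real.pi / c) * (1 / √j) := by
      rw [mul_comm (j : ℝ), ← div_div, Real.sqrt_div (by positivity)]; ring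
    -- The wrap-around factor. With δ ≥ 1/√j it combines with the Gaussian integral 1/√j into 1/√j +
    -- ε, which is also the size of the transverse Riemann sums.
    have hinv : (1 - Real.exp (-(δ * N i)))⁻¹ ≤ 1 + √j * ε := by
      refine (inv_one_sub_exp_neg_le (mul_pos hδ0 (hN i))).trans ?_
      have : 1 / (δ * N i) ≤ √j * ε := by
        rw [← one_div_mul_one_div]
        have h3 : 1 / δ ≤ √j := by
          rw [div_le_iff₀ hδ0]
          rw [div_le_iff₀ hj0] at hδ1
          linarith
        exact mul_le_mul h3 (hε i) (one_div_pos.2 (hN i)).le hj0.le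
      linarith
    rw [hsq, div_eq_mul_inv _ (1 - Real.exp (-(δ * N i)))]
    calc _ ≤ g r' * Real.exp (C * (δ ^ 2 * j)) * (√(Real.pi / c) * (1 / √j)) / (2 * Real.pi) *
          (3 * Real.exp (-(δ * |((x i).valMinAbs : ℝ)|)) * (1 + √j * ε)) := by gcongr
      _ = _ := by field_simp
  have hN' : ∀ k : Fin 2, (0 : ℝ) < N (i.succAbove k) := fun k => hN _
  have hrest : ∑ r', (∏ k : Fin 2, (N (i.succAbove k) : ℝ)⁻¹) * g r' ≤
      G ^ 2 * (1 / √j + ε) ^ 2 := by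
    have e1 : ∀ r', (∏ k : Fin 2, (N (i.succAbove k) : ℝ)⁻¹) * g r' =
        ∏ k : Fin 2, ((N (i.succAbove k) : ℝ)⁻¹ *
          Real.exp (-(j * (c * (2 * Real.pi * (r' k).valMinAbs / N (i.succAbove k)) ^ 2)))) :=
      fun r' => by rw [hg, Finset.prod_mul_distrib]
    simp only [e1]
    rw [sum_prod_pi fun (k : Fin 2) (w : ZMod (N (i.succAbove k))) =>
      (N (i.succAbove k) : ℝ)⁻¹ *
          Real.exp (-(j * (c * (2 * Real.pi * w.valMinAbs / N (i.succAbove k)) ^ 2)))]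
    calc _ ≤ ∏ _k : Fin 2, G * (1 / √j + ε) := by
          refine Finset.prod_le_prod (fun k _ => Finset.sum_nonneg fun w _ => ?_) fun k _ => ?_
          · have := hN' k
            positivity
          · rw [← Finset.mul_sum]
            refine (sum_gaussian_le hc _ hj).trans ?_
            rw [← hG]
            gcongr
            exact hε _
      _ = _ := by rw [Finset.prod_const, Finset.card_univ, Fintype.card_fin, mul_pow]
  rw [hsplit]
  refine (norm_sum_le _ _).trans ?_
  calc _ ≤ ∑ r', ((∏ k : Fin 2, (N (i.succAbove k) : ℝ)⁻¹) * g r') *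
        (√(Real.pi / c) / (2 * Real.pi) * 3 * Real.exp (C * (δ ^ 2 * j)) * (1 / √j + ε) *
        Real.exp (-(δ * |((x i).valMinAbs : ℝ)|))) := by
        refine Finset.sum_le_sum fun r' _ => ?_
        rw [norm_mul, mul_assoc]
        have e1 : ‖∏ k : Fin 2, ((N (i.succAbove k) : ℂ)⁻¹ *
            ZMod.stdAddChar (r' k * x (i.succAbove k)))‖ =
            ∏ k : Fin 2, (N (i.succAbove k) : ℝ)⁻¹ := by
          rw [norm_prod]
          refine Finset.prod_congr rfl fun k _ => ?_
          rw [norm_mul, norm_inv, Complex.norm_natCast]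
          simp
        rw [e1]
        have : 0 ≤ ∏ k : Fin 2, (N (i.succAbove k) : ℝ)⁻¹ :=
          Finset.prod_nonneg fun k _ => (inv_pos.2 (hN' k)).le
        gcongr
        exact hfib r'
    _ ≤ G ^ 2 * (1 / √j + ε) ^ 2 *
        (√(Real.pi / c) / (2 * Real.pi) * 3 * Real.exp (C * (δ ^ 2 * j)) * (1 / √j + ε) *
        Real.exp (-(δ * |((x i).valMinAbs : ℝ)|))) := by
        rw [← Finset.sum_mul]
        gcongr
    _ = K₁ * Real.exp (C * (δ ^ 2 * j)) * (1 / √j + ε) ^ 3 *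
        Real.exp (-(δ * |((x i).valMinAbs : ℝ)|)) := by rw [hK₁]; ring
    _ ≤ _ := by
        gcongr
        · linarith
        · linarith

/-- Exponential decay of the heat kernel, uniformly in time and in the size of the torus. -/
theorem IsHamiltonian.exists_heat_le (H : IsHamiltonian h hhat) : ∃ K : ℝ, 0 < K ∧
    ∀ (N : Fin 3 → ℕ) [∀ i, NeZero (N i)] (ε : ℝ), (∀ i, 1 / (N i : ℝ) ≤ ε) → ∀ (j : ℕ), 1 ≤ j →
    ∀ (b : ℝ), 0 ≤ b → b ≤ 1 / 3 → ∀ (x : ∀ i, ZMod (N i)),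
      ‖heat hhat N j x‖ ≤ K * Real.exp (K * (b ^ 2 * j)) * (1 / √j + ε) ^ 3 *
        (Real.exp (-(b * ∑ i, |((x i).valMinAbs : ℝ)|)) *
          Real.exp (-(1 / (3 * √j) * ∑ i, |((x i).valMinAbs : ℝ)|))) := by
  obtain ⟨K, hK, hb⟩ := H.exists_heat_le_dir
  -- The choice δ = 1/√j + 3 b gives δ² j ≤ 2 + 18 b² j: the 2 becomes a factor exp(2 K), the 18
  -- enlarges the growth rate.
  refine ⟨K * Real.exp (2 * K) + 18 * K, by positivity, ?_⟩
  intro N _ ε hε j hj b hb0 hb1 x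
  have hj' : (1 : ℝ) ≤ j := by exact_mod_cast hj
  have hj0 : (1 : ℝ) ≤ √j := Real.one_le_sqrt.2 hj'
  have hN : ∀ k, (0 : ℝ) < N k := fun k => by exact_mod_cast Nat.pos_of_ne_zero (NeZero.ne (N k))
  have hε0 : 0 < ε := lt_of_lt_of_le (one_div_pos.2 (hN 0)) (hε 0)
  -- The direction with the largest component carries at least a third of the ℓ¹ length. Hence the
  -- shift contains 3 b, and b ≤ 1/3 together with j ≥ 1 does not give more than the admissible size
  -- 2.
  obtain ⟨i, -, hi⟩ := Finset.exists_max_image Finset.univ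
    (fun i => |((x i).valMinAbs : ℝ)|) Finset.univ_nonempty
  have hmax : ∑ k, |((x k).valMinAbs : ℝ)| ≤ 3 * |((x i).valMinAbs : ℝ)| := by
    refine (Finset.sum_le_card_nsmul _ _ _ fun k hk => hi k hk).trans (le_of_eq ?_)
    simp
  have h1j : 1 / √(j : ℝ) ≤ 1 := by rw [div_le_one (by linarith)]; exact hj0
  refine (hb N ε hε j hj (1 / √j + 3 * b) (by linarith) (by linarith) x i).trans ?_
  have hexp : Real.exp (-((1 / √j + 3 * b) * |((x i).valMinAbs : ℝ)|)) ≤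
      Real.exp (-(b * ∑ i, |((x i).valMinAbs : ℝ)|)) *
          Real.exp (-(1 / (3 * √j) * ∑ i, |((x i).valMinAbs : ℝ)|)) := by
    rw [← Real.exp_add, Real.exp_le_exp]
    have e1 : 1 / (3 * √(j : ℝ)) = 1 / √j / 3 := by field_simp
    rw [e1]
    have : 0 ≤ 1 / √(j : ℝ) := by positivity
    nlinarith
  have hδ : (1 / √j + 3 * b) ^ 2 * j ≤ 2 + 18 * (b ^ 2 * j) := by
    have e1 : (1 / √(j : ℝ)) ^ 2 * j = 1 := by
      rw [div_pow, Real.sq_sqrt (by positivity)]; field_simp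
    have e2 : (1 / √j + 3 * b) ^ 2 * j ≤ (2 * (1 / √j) ^ 2 + 18 * b ^ 2) * j := by
      gcongr
      nlinarith [sq_nonneg (1 / √(j : ℝ) - 3 * b)]
    nlinarith
  calc _ ≤ K * Real.exp (K * (2 + 18 * (b ^ 2 * j))) * (1 / √j + ε) ^ 3 *
        (Real.exp (-(b * ∑ i, |((x i).valMinAbs : ℝ)|)) *
          Real.exp (-(1 / (3 * √j) * ∑ i, |((x i).valMinAbs : ℝ)|))) := by gcongr
    _ = (K * Real.exp (2 * K)) * Real.exp (18 * K * (b ^ 2 * j)) * (1 / √j + ε) ^ 3 *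
        (Real.exp (-(b * ∑ i, |((x i).valMinAbs : ℝ)|)) *
          Real.exp (-(1 / (3 * √j) * ∑ i, |((x i).valMinAbs : ℝ)|))) := by
        rw [show K * (2 + 18 * (b ^ 2 * j)) = 2 * K + 18 * K * (b ^ 2 * j) by ring, Real.exp_add]
        ring
    _ ≤ _ := by
        have : 0 < K * Real.exp (2 * K) := by positivity
        gcongr
        · linarith
        · linarith

end Heat

end

end PBS


namespace PBS

noncomputable section

/-! ### The symbol of the differential operator -/

section Symbol

variable {L t s n : ℕ} [NeZero L] {ι : Type*} [Fintype ι] [DecidableEq ι] {lab : ι → Fin 4 → ℤ}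
variable {h : (Fin 3 → ℤ) → ℂ} {hhat : (Fin 3 → ℂ) → ℂ}

/-- The momentum with integer label `z`, in units of the inverse lattice spacing. -/
def latMom (L t s n : ℕ) (z : Fin 4 → ℤ) (ν : Fin 4) : ℝ := 2 * Real.pi * z ν / size L t s n ν

/-- The space components of a momentum. -/
def spMom (L t s n : ℕ) (z : Fin 4 → ℤ) (i : Fin 3) : ℝ := latMom L t s n z i.succ

/-- The symbol of `e^{-h₀} (1 + ∂₀)`. -/
def stepSym (hhat : (Fin 3 → ℂ) → ℂ) (L t s n : ℕ) (z : Fin 4 → ℤ) : ℂ :=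
  Complex.exp (-hhat (cvec (spMom L t s n z))) *
    Complex.exp (Complex.I * (latMom L t s n z 0 : ℝ))

/-- The symbol of `D_n`. -/
def dSym (hhat : (Fin 3 → ℂ) → ℂ) (L t s n : ℕ) (z : Fin 4 → ℤ) : ℂ :=
  (L : ℂ) ^ (2 * n) * (1 - stepSym hhat L t s n z)

theorem pmom_mul_eps (z : Fin 4 → ℤ) (ν : Fin 4) :
    pmom L t s z ν * eps L n ν = latMom L t s n z ν := by
  have h1 : (Ldir L ν : ℝ) ≠ 0 := by exact_mod_cast (Ldir_pos L ν).ne'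
  have h2 : (period L t s ν : ℝ) ≠ 0 := by exact_mod_cast NeZero.ne (period L t s ν)
  rw [pmom, eps, latMom, size]
  push_cast
  field_simp

theorem chi_intCast_latMom (z x : Fin 4 → ℤ) :
    chi z (fun ν => (x ν : ZMod (size L t s n ν))) =
      Complex.exp (Complex.I * ((∑ ν, latMom L t s n z ν * x ν : ℝ) : ℂ)) := by
  rw [chi_intCast]
  congr 3
  refine Finset.sum_congr rfl fun ν _ => ?_
  rw [← mul_assoc, pmom_mul_eps]

theorem sum_hPer_mul_chi
    (hF : ∀ p : Fin 3 → ℝ, HasSum (fun x : Fin 3 → ℤ =>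
      h x * Complex.exp (-(Complex.I * ((∑ i, p i * x i : ℝ) : ℂ)))) (hhat (cvec p)))
    (z : Fin 4 → ℤ) (u : Lat L t s n) :
    ∑ v, hPer L t s n h u v * chi z v = chi z u * hhat (cvec (spMom L t s n z)) := by
  classical
  have hs : Summable h := by simpa using (hF 0).summable
  let sh : (Fin 3 → ℤ) → Lat L t s n := fun x ν =>
    ((Fin.cons 0 x : Fin 4 → ℤ) ν : ZMod (size L t s n ν))
  have hiff : ∀ (x : Fin 3 → ℤ) (v : Lat L t s n), (u 0 = v 0 ∧
      ∀ i : Fin 3, (x i : ZMod (size L t s n i.succ)) = u i.succ - v i.succ) ↔ v = u - sh x := by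
    intro x v
    constructor
    · rintro ⟨h0, hi⟩
      funext ν
      refine Fin.cases ?_ (fun i => ?_) ν
      · simp [sh, h0]
      · simp [sh, hi i]
    · rintro rfl
      exact ⟨by simp [sh], fun i => by simp [sh]⟩
  have hv : ∀ v : Lat L t s n, HasSum (fun x => if v = u - sh x then h x * chi z v else 0)
      (hPer L t s n h u v * chi z v) := by
    intro v
    have h1 : Summable fun x => if v = u - sh x then h x else 0 :=
      Summable.of_norm_bounded hs.norm fun x => by split_ifs <;> simp
    have h2 : hPer L t s n h u v = ∑' x, if v = u - sh x then h x else 0 := by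
      simp only [hPer, Matrix.of_apply, ← hiff]
      by_cases h0 : u 0 = v 0 <;> simp [h0]
    rw [h2]
    have h3 := h1.hasSum.mul_right (chi z v)
    simpa only [ite_mul, zero_mul] using h3
  have hL := hasSum_sum fun v (_ : v ∈ (Finset.univ : Finset (Lat L t s n))) => hv v
  simp only [Finset.sum_ite_eq', Finset.mem_univ, if_true] at hL
  have hR := (hF (spMom L t s n z)).mul_left (chi z u)
  have hfun : (fun x => h x * chi z (u - sh x)) = fun x => chi z u *
      (h x * Complex.exp (-(Complex.I * ((∑ i, spMom L t s n z i * x i : ℝ) : ℂ)))) := by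
    funext x
    have h4 : chi z (u - sh x) * chi z (sh x) = chi z u := by rw [← chi_add, sub_add_cancel]
    have h5 : chi z (sh x) =
        Complex.exp (Complex.I * ((∑ i, spMom L t s n z i * x i : ℝ) : ℂ)) := by
      rw [show chi z (sh x) = _ from chi_intCast_latMom z (Fin.cons 0 x : Fin 4 → ℤ),
        Fin.sum_univ_succ]
      simp [spMom]
    rw [← h4, h5, Complex.exp_neg]
    field_simp [Complex.exp_ne_zero]
  rw [hfun] at hL
  exact hL.unique hR

theorem hPer_eq_mulMat (hlab : IsLabel L t s n lab)
    (hF : ∀ p : Fin 3 → ℝ, HasSum (fun x : Fin 3 → ℤ =>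
      h x * Complex.exp (-(Complex.I * ((∑ i, p i * x i : ℝ) : ℂ)))) (hhat (cvec p))) :
    hPer L t s n h = mulMat L t s n lab fun i => hhat (cvec (spMom L t s n (lab i))) := by
  refine eq_mulMat hlab ?_
  ext u i
  rw [Matrix.mul_diagonal, Matrix.mul_apply]
  exact sum_hPer_mul_chi hF (lab i) u

/-- Fourier multipliers as a ring homomorphism. -/
def mulMatHom (hlab : IsLabel L t s n lab) :
    (ι → ℂ) →+* Matrix (Lat L t s n) (Lat L t s n) ℂ where
  toFun := mulMat L t s n lab
  map_one' := mulMat_one hlab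
  map_mul' f g := (mulMat_mul hlab f g).symm
  map_zero' := by simp [mulMat]
  map_add' := mulMat_add

/-- Multipliers are a continuous ring homomorphism from functions with pointwise product, and such
homomorphisms commute with exponentials. -/
theorem exp_mulMat (hlab : IsLabel L t s n lab) (f : ι → ℂ) :
    NormedSpace.exp (mulMat L t s n lab f) = mulMat L t s n lab fun i => Complex.exp (f i) := by
  have hc : Continuous (mulMatHom hlab) := by
    refine continuous_pi fun u => continuous_pi fun v => ?_
    change Continuous fun f => mulMat L t s n lab f u v
    simp only [mulMat_apply]
    fun_prop
  let := Matrix.linftyOpNormedRing (n := Lat L t s n) (α := ℂ)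
  have := NormedSpace.map_exp (mulMatHom hlab) hc f
  change mulMat L t s n lab (NormedSpace.exp f) = _ at this
  change _ = NormedSpace.exp (mulMat L t s n lab f) at this
  rw [← this, Pi.exp_def]
  simp only [Complex.exp_eq_exp_ℂ]

namespace IsHamiltonian

/-- Reflecting the three coordinates in turn shows that the transform is even, so the reflected
kernel has the same transform. This makes the periodised operator symmetric. -/
theorem fourier_neg (H : IsHamiltonian h hhat) (p : Fin 3 → ℝ) :
    HasSum (fun x : Fin 3 → ℤ =>
      h (-x) * Complex.exp (-(Complex.I * ((∑ i, p i * x i : ℝ) : ℂ)))) (hhat (cvec p)) := by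
  have hneg : hhat (cvec (-p)) = hhat (cvec p) := by
    have e0 := H.even (cvec p) 0
    have e1 := H.even (Function.update (cvec p) 0 (-cvec p 0)) 1
    have e2 := H.even (Function.update (Function.update (cvec p) 0 (-cvec p 0)) 1
      (-(Function.update (cvec p) 0 (-cvec p 0)) 1)) 2
    rw [← e0, ← e1, ← e2]
    congr 1
    funext i
    fin_cases i <;> simp [cvec, Function.update]
  have h1 := (Equiv.neg (Fin 3 → ℤ)).hasSum_iff.2 (H.fourier (-p))
  rw [← hneg]
  convert h1 using 2 with x
  on_goal 2 => rfl
  simp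

theorem hPer_transpose (H : IsHamiltonian h hhat) :
    (hPer L t s n h).transpose = hPer L t s n h := by
  have h1 : (hPer L t s n h).transpose = hPer L t s n fun x => h (-x) := by
    ext u v
    simp only [hPer, Matrix.transpose_apply, Matrix.of_apply, eq_comm (a := v 0)]
    split_ifs with h0
    · rw [← (Equiv.neg (Fin 3 → ℤ)).tsum_eq]
      refine tsum_congr fun x => ?_
      refine if_congr (forall_congr' fun i => ?_) (by simp) rfl
      simp only [Equiv.neg_apply, Pi.neg_apply, Int.cast_neg]
      rw [neg_eq_iff_eq_neg, neg_sub]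
    · rfl
  rw [h1, hPer_eq_mulMat (isLabel_labMin (L := L) (t := t) (s := s)) H.fourier_neg,
    hPer_eq_mulMat (isLabel_labMin (L := L) (t := t) (s := s)) H.fourier]

theorem exp_hPer (H : IsHamiltonian h hhat) (hlab : IsLabel L t s n lab) :
    NormedSpace.exp (-hPer L t s n h) =
      mulMat L t s n lab fun i => Complex.exp (-hhat (cvec (spMom L t s n (lab i)))) := by
  rw [hPer_eq_mulMat hlab H.fourier, ← exp_mulMat hlab]
  congr 1
  have := mulMat_smul (L := L) (t := t) (s := s) (j := n) (lab := lab) (-1)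
    fun i => hhat (cvec (spMom L t s n (lab i)))
  rw [neg_one_smul ℂ, neg_one_smul ℂ] at this
  rw [← this]
  rfl

theorem tr_eq_mulMat (hlab : IsLabel L t s n lab) (c : Lat L t s n) :
    tr c = mulMat L t s n lab fun i => chi (lab i) c := eq_mulMat hlab (tr_mul_charMat lab c)

theorem chi_single (z : Fin 4 → ℤ) : chi z (Pi.single 0 1 : Lat L t s n) =
    Complex.exp (Complex.I * (latMom L t s n z 0 : ℝ)) := by
  have h1 : (Pi.single 0 1 : Lat L t s n) =
      fun ν => ((Pi.single 0 1 : Fin 4 → ℤ) ν : ZMod (size L t s n ν)) := by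
    funext ν
    refine Fin.cases ?_ (fun i => ?_) ν <;> simp
  rw [h1, chi_intCast_latMom, Fin.sum_univ_succ]
  simp

theorem Dn_eq (h : (Fin 3 → ℤ) → ℂ) : Dn L t s h n = ((L : ℂ) ^ (2 * n)) •
    (1 - NormedSpace.exp (-hPer L t s n h) * tr (Pi.single 0 1)) := by
  have h1 : tr (Pi.single 0 1 : Lat L t s n) = 1 + timeDeriv L t s n := by
    ext u v
    simp only [tr, timeDeriv, Matrix.of_apply, Matrix.add_apply, Matrix.one_apply,
      eq_comm (a := u)]
    ring
  rw [Dn, h1, Matrix.mul_add, Matrix.mul_one]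
  congr 1
  abel

theorem Dn_eq_mulMat (H : IsHamiltonian h hhat) (hlab : IsLabel L t s n lab) :
    Dn L t s h n = mulMat L t s n lab fun i => dSym hhat L t s n (lab i) := by
  rw [Dn_eq, H.exp_hPer hlab, tr_eq_mulMat hlab, mulMat_mul hlab, ← mulMat_one hlab, ← mulMat_sub,
    ← mulMat_smul]
  congr 1
  funext i
  simp [dSym, stepSym, chi_single]

theorem star_dSym (H : IsHamiltonian h hhat) (z : Fin 4 → ℤ) : star (dSym hhat L t s n z) =
    (L : ℂ) ^ (2 * n) * (1 - Complex.exp (-hhat (cvec (spMom L t s n z))) *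
      star (Complex.exp (Complex.I * (latMom L t s n z 0 : ℝ)))) := by
  have h1 : star (Complex.exp (-hhat (cvec (spMom L t s n z)))) =
      Complex.exp (-hhat (cvec (spMom L t s n z))) := by
    have h2 : (starRingEnd ℂ) (hhat (cvec (spMom L t s n z))) = hhat (cvec (spMom L t s n z)) :=
      Complex.conj_eq_iff_im.2 (H.real _)
    change (starRingEnd ℂ) _ = _
    rw [← Complex.exp_conj, map_neg, h2]
  rw [dSym, stepSym, star_mul', star_sub, star_mul', h1]
  simp

/-- Transposition reverses the time translation and fixes e^{-h₀}. The symbol is conjugated, and the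
bounds on its real part and modulus carry over. -/
theorem Dn_transpose_eq_mulMat (H : IsHamiltonian h hhat) (hlab : IsLabel L t s n lab) :
    (Dn L t s h n).transpose = mulMat L t s n lab fun i => star (dSym hhat L t s n (lab i)) := by
  have htr : (tr (Pi.single 0 1 : Lat L t s n)).transpose = tr (-Pi.single 0 1) := by
    ext u v
    simp only [tr, Matrix.transpose_apply, Matrix.of_apply]
    refine if_congr ?_ rfl rfl
    rw [← sub_eq_add_neg, eq_sub_iff_add_eq, eq_comm]
  have hexp : (NormedSpace.exp (-hPer L t s n h)).transpose =
      NormedSpace.exp (-hPer L t s n h) := by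
    rw [← Matrix.exp_transpose, Matrix.transpose_neg, H.hPer_transpose]
  have hneg : ∀ (z : Fin 4 → ℤ) (c : Lat L t s n), chi z (-c) = star (chi z c) := by
    intro z c
    have h1 : chi z (-c) * chi z c = 1 := by rw [← chi_add, neg_add_cancel]; simp [chi]
    have h2 := Complex.conj_mul' (chi z c)
    rw [norm_chi] at h2
    have h3 : chi z c ≠ 0 := by rw [← norm_ne_zero_iff, norm_chi]; simp
    refine mul_right_cancel₀ h3 (h1.trans ?_)
    simpa using h2.symm
  rw [Dn_eq, Matrix.transpose_smul, Matrix.transpose_sub, Matrix.transpose_one,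
    Matrix.transpose_mul, hexp, htr, H.exp_hPer hlab, tr_eq_mulMat hlab, mulMat_mul hlab,
    ← mulMat_one hlab, ← mulMat_sub, ← mulMat_smul]
  congr 1
  funext i
  simp only [H.star_dSym, ← chi_single, hneg, Pi.smul_apply, Pi.sub_apply, Pi.mul_apply,
    Pi.one_apply, smul_eq_mul]
  ring

theorem norm_exp_neg_hhat (H : IsHamiltonian h hhat) (p : Fin 3 → ℝ) :
    Complex.exp (-hhat (cvec p)) = ((Real.exp (-(hhat (cvec p)).re) : ℝ) : ℂ) := by
  have h1 : hhat (cvec p) = ((hhat (cvec p)).re : ℂ) :=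
    Complex.ext (by simp) (H.real p)
  conv_lhs => rw [h1]
  push_cast
  rfl

theorem norm_stepSym_le (H : IsHamiltonian h hhat) (z : Fin 4 → ℤ) :
    ‖stepSym hhat L t s n z‖ ≤ 1 := by
  rw [stepSym, norm_mul, mul_comm Complex.I, Complex.norm_exp_ofReal_mul_I, mul_one,
    H.norm_exp_neg_hhat, Complex.norm_real, Real.norm_of_nonneg (Real.exp_pos _).le,
    Real.exp_le_one_iff]
  linarith [H.nonneg (spMom L t s n z), show (hhat (cvec (spMom L t s n z))).re =
    (hhat fun i => ((spMom L t s n z i : ℝ) : ℂ)).re from rfl]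

theorem dSym_re_nonneg (H : IsHamiltonian h hhat) (z : Fin 4 → ℤ) :
    0 ≤ (dSym hhat L t s n z).re := by
  have h1 : ((L : ℂ) ^ (2 * n)) = (((L : ℝ) ^ (2 * n) : ℝ) : ℂ) := by push_cast; rfl
  rw [dSym, h1, Complex.re_ofReal_mul, Complex.sub_re, Complex.one_re]
  have h2 := (Complex.re_le_norm _).trans (H.norm_stepSym_le (L := L) (t := t) (s := s) (n := n) z)
  have h3 : 0 ≤ 1 - (stepSym hhat L t s n z).re := by linarith
  positivity

/-- Both 1 - ρ and the distance from e^{iθ} to ρ e^{iθ} are controlled by |1 - ρ e^{iθ}|. -/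
theorem half_norm_le {ρ θ : ℝ} (h0 : 0 ≤ ρ) (h1 : ρ ≤ 1) :
    ‖1 - Complex.exp (Complex.I * θ)‖ / 2 ≤ ‖1 - ρ * Complex.exp (Complex.I * θ)‖ := by
  have hn : ‖Complex.exp (Complex.I * θ)‖ = 1 := by
    rw [mul_comm, Complex.norm_exp_ofReal_mul_I]
  have e1 : ‖1 - (ρ : ℂ) * Complex.exp (Complex.I * θ)‖ ≥ 1 - ρ := by
    have := norm_sub_norm_le (1 : ℂ) (ρ * Complex.exp (Complex.I * θ))
    rw [norm_mul, hn, Complex.norm_real, Real.norm_of_nonneg h0] at this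
    simpa using this
  have e2 : ‖1 - Complex.exp (Complex.I * θ)‖ ≤
      ‖1 - (ρ : ℂ) * Complex.exp (Complex.I * θ)‖ + (1 - ρ) := by
    have e3 : 1 - Complex.exp (Complex.I * θ) = (1 - (ρ : ℂ) * Complex.exp (Complex.I * θ)) -
        ((1 - ρ : ℝ) : ℂ) * Complex.exp (Complex.I * θ) := by push_cast; ring
    rw [e3]
    refine (norm_sub_le _ _).trans ?_
    rw [norm_mul, hn, Complex.norm_real, Real.norm_of_nonneg (by linarith)]
    linarith
  linarith

theorem two_div_pi_mul_abs_le {θ : ℝ} (hθ : |θ| ≤ Real.pi) :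
    2 / Real.pi * |θ| ≤ ‖1 - Complex.exp (Complex.I * θ)‖ := by
  rw [norm_sub_rev, mul_comm Complex.I, mul_comm _ Complex.I, Complex.norm_exp_I_mul_ofReal_sub_one,
    Real.norm_eq_abs, abs_mul, abs_two]
  have h1 := Real.mul_abs_le_abs_sin (x := θ / 2) (by rw [abs_div, abs_two]; linarith)
  rw [abs_div, abs_two] at h1
  linarith

/-- Away from small momenta the symbol of `D_n` is bounded below. -/
theorem exists_dSym_lower (H : IsHamiltonian h hhat) : ∃ c : ℝ, 0 < c ∧
    ∀ (L : ℕ) [NeZero L], Odd L → ∀ (t s n : ℕ) (κ : Lat L t s 0) (l : Bdual L n), l ≠ 0 →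
      c ≤ ‖dSym hhat L t s n (labPair L t s n (κ, l))‖ := by
  obtain ⟨c, hc, hlow⟩ := H.exists_lower
  have hpi := Real.pi_pos
  set y : ℝ := c * Real.pi ^ 2 with hy
  have hy0 : 0 < y := by positivity
  -- The two entries belong to the cases in which a time component or a space component of ℓ is
  -- nonzero.
  refine ⟨min 1 (y / (1 + y)), by positivity, ?_⟩
  intro L _ hL t s n κ l hl
  set z := labPair L t s n (κ, l) with hz
  have hL0 : (0 : ℝ) < L := by exact_mod_cast Nat.pos_of_ne_zero (NeZero.ne L)
  have hL1 : (1 : ℝ) ≤ L := by exact_mod_cast Nat.pos_of_ne_zero (NeZero.ne L)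
  have hP : ∀ ν, (0 : ℝ) < period L t s ν := fun ν => by
    exact_mod_cast Nat.pos_of_ne_zero (NeZero.ne (period L t s ν))
  have hκ : ∀ ν, 2 * |((κ ν).valMinAbs : ℝ)| ≤ period L t s ν := fun ν => by
    have h3 : (2 * |(κ ν).valMinAbs| : ℤ) ≤ period L t s ν := by
      simpa [size] using two_mul_abs_valMinAbs_le _ (κ ν)
    exact_mod_cast h3
  have hlb : ∀ ν, 2 * |((l ν).valMinAbs : ℝ)| ≤ (Ldir L ν : ℝ) ^ n - 1 := fun ν => by
    have h3 : (2 * |(l ν).valMinAbs| : ℤ) ≤ ((Ldir L ν ^ n : ℕ) : ℤ) :=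
      two_mul_abs_valMinAbs_le _ (l ν)
    obtain ⟨k, hk⟩ := (odd_Ldir hL ν).pow (n := n)
    have h4 : (2 * |(l ν).valMinAbs| : ℤ) ≤ ((Ldir L ν ^ n : ℕ) : ℤ) - 1 := by omega
    exact_mod_cast h4
  have hLd : ∀ ν, (0 : ℝ) < (Ldir L ν : ℝ) ^ n := fun ν => by
    have : (0 : ℝ) < Ldir L ν := by exact_mod_cast Ldir_pos L ν
    positivity
  have hsz : ∀ ν, (size L t s n ν : ℝ) = (Ldir L ν : ℝ) ^ n * period L t s ν := fun ν => by
    rw [size]; push_cast; rfl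
  have hzν : ∀ ν, (z ν : ℝ) = (κ ν).valMinAbs + period L t s ν * (l ν).valMinAbs := fun ν => by
    rw [hz, labPair]; push_cast; rfl
  have hup : ∀ ν, |latMom L t s n z ν| ≤ Real.pi := by
    intro ν
    have h1 : |(z ν : ℝ)| ≤ |((κ ν).valMinAbs : ℝ)| + period L t s ν * |((l ν).valMinAbs : ℝ)| := by
      rw [hzν]
      refine (abs_add_le _ _).trans ?_
      rw [abs_mul, abs_of_pos (hP ν)]
    have h2 : 2 * |(z ν : ℝ)| ≤ size L t s n ν := by
      rw [hsz]
      have := mul_le_mul_of_nonneg_left (hlb ν) (hP ν).le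
      linarith [hκ ν]
    have h3 : (0 : ℝ) < size L t s n ν := by rw [hsz]; exact mul_pos (hLd ν) (hP ν)
    rw [latMom, abs_div, abs_mul, abs_of_pos (by positivity : 0 < 2 * Real.pi), abs_of_pos h3,
      div_le_iff₀ h3]
    nlinarith
  obtain ⟨ν, hν⟩ : ∃ ν, l ν ≠ 0 := by
    by_contra hcon
    push Not at hcon
    exact hl (funext hcon)
  -- Since k lies in the central zone, a nonzero ℓ_ν leaves k_ν + ℓ_ν of modulus at least π; in
  -- units of the inverse spacing this is π L_ν^(-n).
  have hlo : Real.pi * ((Ldir L ν : ℝ) ^ n)⁻¹ ≤ |latMom L t s n z ν| := by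
    have h0 : (1 : ℝ) ≤ |((l ν).valMinAbs : ℝ)| := by
      have : (l ν).valMinAbs ≠ 0 := by simpa using hν
      exact_mod_cast Int.one_le_abs this
    have h1 : (period L t s ν : ℝ) * |((l ν).valMinAbs : ℝ)| ≤
        |(z ν : ℝ)| + |((κ ν).valMinAbs : ℝ)| := by
      have e : (period L t s ν : ℝ) * (l ν).valMinAbs = z ν - (κ ν).valMinAbs := by
        rw [hzν]; ring
      have e' : (period L t s ν : ℝ) * |((l ν).valMinAbs : ℝ)| =
          |(period L t s ν : ℝ) * (l ν).valMinAbs| := by rw [abs_mul, abs_of_pos (hP ν)]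
      rw [e', e]
      exact abs_sub _ _
    have h2 : (period L t s ν : ℝ) ≤ 2 * |(z ν : ℝ)| := by
      have := mul_le_mul_of_nonneg_left h0 (hP ν).le
      linarith [hκ ν]
    have h3 : (0 : ℝ) < size L t s n ν := by rw [hsz]; exact mul_pos (hLd ν) (hP ν)
    rw [latMom, abs_div, abs_mul, abs_of_pos (by positivity : 0 < 2 * Real.pi), abs_of_pos h3,
      le_div_iff₀ h3, hsz]
    have := hLd ν
    have := hP ν
    calc _ = Real.pi * period L t s ν := by field_simp
      _ ≤ _ := by nlinarith
  have hns : ‖dSym hhat L t s n z‖ = (L : ℝ) ^ (2 * n) *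
      ‖1 - ((Real.exp (-(hhat (cvec (spMom L t s n z))).re) : ℝ) : ℂ) *
        Complex.exp (Complex.I * (latMom L t s n z 0 : ℝ))‖ := by
    rw [dSym, stepSym, H.norm_exp_neg_hhat, norm_mul, norm_pow, Complex.norm_natCast]
  have hre0 : 0 ≤ (hhat (cvec (spMom L t s n z))).re := H.nonneg _
  have hρ1 : Real.exp (-(hhat (cvec (spMom L t s n z))).re) ≤ 1 :=
    Real.exp_le_one_iff.2 (by linarith)
  rw [hns]
  rcases Fin.eq_zero_or_eq_succ ν with rfl | ⟨i, rfl⟩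
  · refine (min_le_left _ _).trans ?_
    have h1 := half_norm_le (θ := latMom L t s n z 0) (Real.exp_pos _).le hρ1
    have h2 := two_div_pi_mul_abs_le (hup 0)
    have h3 : Ldir L 0 = L ^ 2 := by simp [Ldir]
    rw [h3] at hlo
    push_cast at hlo
    rw [← pow_mul] at hlo
    have h4 : ((L : ℝ) ^ (2 * n))⁻¹ ≤ ‖1 - ((Real.exp (-(hhat (cvec (spMom L t s n z))).re) : ℝ) : ℂ) *
        Complex.exp (Complex.I * (latMom L t s n z 0 : ℝ))‖ := by
      refine le_trans ?_ h1
      have h5 : 2 / Real.pi * (Real.pi * ((L : ℝ) ^ (2 * n))⁻¹) ≤ _ := le_trans (by gcongr) h2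
      have h6 : 2 / Real.pi * (Real.pi * ((L : ℝ) ^ (2 * n))⁻¹) = 2 * ((L : ℝ) ^ (2 * n))⁻¹ := by
        field_simp
      rw [h6] at h5
      linarith
    calc (1 : ℝ) = (L : ℝ) ^ (2 * n) * ((L : ℝ) ^ (2 * n))⁻¹ := by field_simp
      _ ≤ _ := by gcongr
  · refine (min_le_right _ _).trans ?_
    have h3 : Ldir L i.succ = L := by simp [Ldir]
    rw [h3] at hlo
    have hpn : ‖spMom L t s n z‖ ≤ Real.pi :=
      (pi_norm_le_iff_of_nonneg hpi.le).2 fun k => hup k.succ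
    set η : ℝ := ((L : ℝ) ^ (2 * n))⁻¹ with hη
    have hη0 : 0 < η := by positivity
    have hη1 : η ≤ 1 := inv_le_one_of_one_le₀ (one_le_pow₀ hL1)
    -- A space momentum of size π L^(-n) makes the transform at least y η with η = L^(-2n). Then 1 -
    -- exp(-y η) is of order η, which the prefactor L^(2n) of D_n compensates.
    have h4 : y * η ≤ (hhat (cvec (spMom L t s n z))).re := by
      refine le_trans ?_ (hlow _ hpn)
      rw [hy, mul_assoc]
      gcongr
      calc Real.pi ^ 2 * η = (Real.pi * ((L : ℝ) ^ n)⁻¹) ^ 2 := by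
            rw [hη, mul_pow, inv_pow, ← pow_mul, mul_comm n 2]
        _ ≤ |latMom L t s n z i.succ| ^ 2 := by gcongr
        _ = spMom L t s n z i ^ 2 := sq_abs _
        _ ≤ _ := Finset.single_le_sum (f := fun k => spMom L t s n z k ^ 2)
            (fun k _ => sq_nonneg _) (Finset.mem_univ i)
    have h5 : 1 - Real.exp (-(hhat (cvec (spMom L t s n z))).re) ≤
        ‖1 - ((Real.exp (-(hhat (cvec (spMom L t s n z))).re) : ℝ) : ℂ) *
        Complex.exp (Complex.I * (latMom L t s n z 0 : ℝ))‖ := by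
      have := norm_sub_norm_le (1 : ℂ) (((Real.exp (-(hhat (cvec (spMom L t s n z))).re) : ℝ) : ℂ) *
        Complex.exp (Complex.I * (latMom L t s n z 0 : ℝ)))
      rw [norm_mul, mul_comm Complex.I, Complex.norm_exp_ofReal_mul_I, Complex.norm_real,
        Real.norm_of_nonneg (Real.exp_pos _).le, mul_one, norm_one] at this
      rw [mul_comm Complex.I]
      exact this
    have h6 : Real.exp (-(hhat (cvec (spMom L t s n z))).re) ≤ 1 / (1 + y * η) := by
      refine (Real.exp_le_exp.2 (neg_le_neg h4)).trans ?_
      rw [Real.exp_neg, one_div]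
      exact inv_anti₀ (by positivity) (by linarith [Real.add_one_le_exp (y * η)])
    have h7 : y * η / (1 + y) ≤ 1 - 1 / (1 + y * η) := by
      have e : 1 - 1 / (1 + y * η) = y * η / (1 + y * η) := by field_simp; ring
      rw [e]
      gcongr
      nlinarith
    calc y / (1 + y) = (L : ℝ) ^ (2 * n) * (y * η / (1 + y)) := by rw [hη]; field_simp
      _ ≤ _ := by gcongr; linarith

end IsHamiltonian

end Symbol

end

end PBS


namespace PBS

noncomputable section

/-! ### Kernel bounds for series of matrices -/

theorem ExpBd.hasSum {X Y : Type*} [Fintype X] [Fintype Y] [Nonempty X] {d : X → Y → ℝ} {m C : ℝ}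
    {A : ℕ → Matrix X Y ℂ} {c : ℕ → ℝ} {R : Matrix X Y ℂ} (hA : ∀ j, ExpBd d m (c j) (A j))
    (hc : HasSum c C) (hR : ∀ u v, HasSum (fun j => A j u v) (R u v)) : ExpBd d m C R := by
  have hpart : ∀ J, ExpBd d m C (∑ j ∈ Finset.range J, A j) := fun J => by
    have h := ExpBd.sum (Finset.range J) fun j _ => hA j
    have hle := sum_le_hasSum (Finset.range J) (fun j _ => (hA j).nonneg) hc
    exact ⟨fun u => (h.row u).trans hle, fun u => (h.col u).trans hle⟩
  have hlim : ∀ u v, Filter.Tendsto (fun J => (∑ j ∈ Finset.range J, A j) u v) Filter.atTop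
      (nhds (R u v)) := fun u v => by
    simpa only [Matrix.sum_apply] using (hR u v).tendsto_sum_nat
  constructor <;> intro u
  · exact le_of_tendsto' (tendsto_finsetSum _ fun v _ => ((hlim u v).norm.const_mul _))
      fun J => (hpart J).row u
  · exact le_of_tendsto' (tendsto_finsetSum _ fun v _ => ((hlim v u).norm.const_mul _))
      fun J => (hpart J).col u

/-! ### Translation invariant kernels, and the splitting of the distance into time and space. -/

section Lattice

variable {L t s n : ℕ} [NeZero L]

theorem expBd_of_le_conv {m C : ℝ} {A : Matrix (Lat L t s n) (Lat L t s n) ℂ}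
    (φ : Lat L t s n → ℝ) (hA : ∀ u v, Real.exp (m * d1 u v) * ‖A u v‖ ≤ φ (u - v))
    (hφ : ∑ w, φ w ≤ C) : ExpBd d1 m C A := by
  constructor <;> intro u
  · refine (Finset.sum_le_sum fun v _ => hA u v).trans ?_
    exact ((Equiv.subLeft u).sum_comp φ).le.trans hφ
  · refine (Finset.sum_le_sum fun v _ => hA v u).trans ?_
    exact ((Equiv.subRight u).sum_comp φ).le.trans hφ

theorem eps_succ (L n : ℕ) (i : Fin 3) : eps L n i.succ = ((L : ℝ) ^ n)⁻¹ := by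
  simp [eps, Ldir]

theorem eps_zero (L n : ℕ) : eps L n 0 = (((L : ℝ) ^ n)⁻¹) ^ 2 := by
  simp only [eps, Ldir, if_true]
  push_cast
  rw [inv_pow, ← pow_mul, ← pow_mul, mul_comm]

/-- The `ℓ¹` length of the space components. -/
def spLen (w : Lat L t s n) : ℝ := ∑ i : Fin 3, |((w i.succ).valMinAbs : ℝ)|

theorem d1_eq_time_add_space (u v : Lat L t s n) :
    d1 u v = eps L n 0 * |((u 0 - v 0).valMinAbs : ℝ)| + ((L : ℝ) ^ n)⁻¹ * spLen (u - v) := by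
  rw [d1, Fin.sum_univ_succ, spLen, Finset.mul_sum]
  simp only [eps_succ, Pi.sub_apply]

/-- Summation over the torus of a function supported on a time slice. -/
theorem sum_timeSlice (c : ZMod (size L t s n 0)) (f : (∀ i : Fin 3, ZMod (size L t s n i.succ)) → ℝ) :
    ∑ w : Lat L t s n, (if w 0 + c = 0 then f (fun i => w i.succ) else 0) = ∑ w', f w' := by
  classical
  rw [← (Fin.consEquiv fun ν => ZMod (size L t s n ν)).sum_comp, Fintype.sum_prod_type,
    Finset.sum_eq_single (-c)]
  · refine Finset.sum_congr rfl fun w' _ => ?_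
    simp [Fin.consEquiv]
  · intro b _ hb
    refine Finset.sum_eq_zero fun w' _ => ?_
    rw [if_neg]
    simpa [Fin.consEquiv, eq_neg_iff_add_eq_zero] using hb
  · simp

variable {h : (Fin 3 → ℤ) → ℂ} {hhat : (Fin 3 → ℂ) → ℂ}

/-! ### The kernels of the powers of `e^{-h₀} (1 + ∂₀)` -/

/-- The `j`-th power of `e^{-h₀} (1 + ∂₀)`. -/
def stepPow (hhat : (Fin 3 → ℂ) → ℂ) (L t s n : ℕ) [NeZero L] (j : ℕ) :
    Matrix (Lat L t s n) (Lat L t s n) ℂ :=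
  mulMat L t s n (labMin L t s n) fun r => stepSym hhat L t s n (labMin L t s n r) ^ j

/-- The time momentum enters only through a phase, so its sum enforces a displacement by exactly j
time steps; the space momenta give the heat kernel. -/
theorem stepPow_apply (hhat : (Fin 3 → ℂ) → ℂ) (j : ℕ) (u v : Lat L t s n) :
    stepPow hhat L t s n j u v = if (u - v) 0 + (j : ZMod (size L t s n 0)) = 0 then
      heat hhat (fun i => size L t s n i.succ) j (fun i => (u - v) i.succ) else 0 := by
  classical
  set w := u - v with hw
  have hterm : ∀ r : Lat L t s n,
      stepSym hhat L t s n (labMin L t s n r) ^ j * chi (labMin L t s n r) w =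
      (Complex.exp (-(j * hhat (cvec (torusMom (fun i => size L t s n i.succ) fun i => r i.succ)))) *
        ∏ i : Fin 3, ZMod.stdAddChar (r i.succ * w i.succ)) *
        ZMod.stdAddChar (r 0 * (w 0 + (j : ZMod (size L t s n 0)))) := by
    intro r
    have h1 : Complex.exp (Complex.I * (latMom L t s n (labMin L t s n r) 0 : ℝ)) ^ j =
        ZMod.stdAddChar (r 0 * (j : ZMod (size L t s n 0))) := by
      have e1 : r 0 * (j : ZMod (size L t s n 0)) =
          (((r 0).valMinAbs * j : ℤ) : ZMod (size L t s n 0)) := by simp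
      rw [e1, ZMod.stdAddChar_coe, ← Complex.exp_nat_mul]
      congr 1
      simp only [latMom, labMin]
      push_cast
      ring
    have h2 : chi (labMin L t s n r) w = ZMod.stdAddChar (r 0 * w 0) *
        ∏ i : Fin 3, ZMod.stdAddChar (r i.succ * w i.succ) := by
      rw [chi, Fin.prod_univ_succ]
      simp [labMin]
    have h3 : spMom L t s n (labMin L t s n r) =
        torusMom (fun i => size L t s n i.succ) fun i => r i.succ := rfl
    rw [stepSym, mul_pow, h1, h2, h3, ← Complex.exp_nat_mul, mul_add, AddChar.map_add_eq_mul,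
      mul_neg]
    ring
  rw [stepPow, mulMat_apply, ← hw]
  simp only [hterm]
  rw [← (Fin.consEquiv fun ν => ZMod (size L t s n ν)).sum_comp, Fintype.sum_prod_type]
  have hc0 : ∀ (a : ZMod (size L t s n 0)) (b : ∀ i : Fin 3, ZMod (size L t s n i.succ)),
      (Fin.consEquiv fun ν => ZMod (size L t s n ν)) (a, b) 0 = a := fun a b => rfl
  have hcs : ∀ (a : ZMod (size L t s n 0)) (b : ∀ i : Fin 3, ZMod (size L t s n i.succ)) (i : Fin 3),
      (Fin.consEquiv fun ν => ZMod (size L t s n ν)) (a, b) i.succ = b i := fun a b i => rfl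
  simp only [hc0, hcs]
  rw [Finset.sum_comm]
  simp only [← Finset.mul_sum]
  rw [AddChar.sum_mulShift _ (ZMod.isPrimitive_stdAddChar _), ZMod.card, ← Finset.sum_mul,
    Fintype.card_pi, Fin.prod_univ_succ]
  simp only [ZMod.card]
  split_ifs with h0
  · rw [heat]
    have hs : (size L t s n 0 : ℂ) ≠ 0 := by exact_mod_cast NeZero.ne (size L t s n 0)
    push_cast
    rw [mul_inv]
    field_simp
  · simp

/-- The bound on the heat kernel. -/
def heatBound (K ε b : ℝ) (j : ℕ) (x : ℝ) : ℝ :=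
  K * Real.exp (K * (b ^ 2 * (max j 1 : ℕ))) * (1 / √((max j 1 : ℕ) : ℝ) + ε) ^ 3 *
    (Real.exp (-(b * x)) * Real.exp (-(1 / (3 * √((max j 1 : ℕ) : ℝ)) * x)))

theorem IsHamiltonian.exists_norm_stepPow_le (H : IsHamiltonian h hhat) : ∃ K : ℝ, 1 ≤ K ∧
    ∀ (L : ℕ) [NeZero L] (t s n j : ℕ) (b : ℝ), 0 ≤ b → b ≤ 1 / 3 → ∀ u v : Lat L t s n,
      ‖stepPow hhat L t s n j u v‖ ≤ if (u - v) 0 + (j : ZMod (size L t s n 0)) = 0 then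
        heatBound K ((L : ℝ) ^ n)⁻¹ b j (spLen (u - v)) else 0 := by
  obtain ⟨K, hK, hb⟩ := H.exists_heat_le
  refine ⟨K + 1, by linarith, ?_⟩
  intro L _ t s n j b hb0 hb1 u v
  have hL1 : (1 : ℝ) ≤ L := by exact_mod_cast Nat.pos_of_ne_zero (NeZero.ne L)
  have hε0 : 0 < ((L : ℝ) ^ n)⁻¹ := by positivity
  rcases Nat.eq_zero_or_pos j with rfl | hj
  -- The power j = 0 is the identity, which has no smoothing. Replacing j by max j 1 in `heatBound`
  -- covers it, since every factor is at least 1 at distance 0.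
  · have h1 : stepPow hhat L t s n 0 = 1 := by
      simp only [stepPow, pow_zero]
      exact mulMat_one isLabel_labMin
    rw [h1]
    have hnn : 0 ≤ heatBound (K + 1) ((L : ℝ) ^ n)⁻¹ b 0 (spLen (u - v)) := by
      unfold heatBound; positivity
    rcases eq_or_ne u v with rfl | huv
    · have h2 : spLen (u - u) = 0 := by simp [spLen]
      rw [Matrix.one_apply_eq, norm_one, if_pos (by simp), h2, heatBound]
      have h3 : 1 ≤ Real.exp ((K + 1) * (b ^ 2 * (max 0 1 : ℕ))) :=
        Real.one_le_exp (by positivity)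
      have h4 : (1 : ℝ) ≤ (1 / √((max 0 1 : ℕ) : ℝ) + ((L : ℝ) ^ n)⁻¹) ^ 3 :=
        one_le_pow₀ (by simp [hε0.le])
      have h5 : 1 ≤ (K + 1) * Real.exp ((K + 1) * (b ^ 2 * (max 0 1 : ℕ))) :=
        one_le_mul_of_one_le_of_one_le (by linarith) h3
      simpa using one_le_mul_of_one_le_of_one_le h5 h4
    · rw [Matrix.one_apply_ne huv, norm_zero]
      split_ifs <;> [exact hnn; exact le_rfl]
  · rw [stepPow_apply]
    split_ifs with h0
    · have hN : ∀ i : Fin 3, 1 / ((size L t s n i.succ : ℕ) : ℝ) ≤ ((L : ℝ) ^ n)⁻¹ := by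
        intro i
        rw [one_div]
        refine inv_anti₀ (by positivity) ?_
        have e : ((size L t s n i.succ : ℕ) : ℝ) = (L : ℝ) ^ n * (L : ℝ) ^ s := by
          simp [size, Ldir, period]
        rw [e]
        exact le_mul_of_one_le_right (by positivity) (one_le_pow₀ hL1)
      have h1 := hb (fun i => size L t s n i.succ) ((L : ℝ) ^ n)⁻¹ hN j hj b hb0 hb1
        (fun i => (u - v) i.succ)
      refine h1.trans ?_
      have hmax : max j 1 = j := max_eq_left hj
      rw [heatBound, hmax, spLen]
      gcongr <;> linarith
    · simp

/-- The scalar estimate behind the summation over the powers. -/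
theorem pow_mul_exp_le {η x : ℝ} (hη0 : 0 < η) (hη1 : η ≤ 1) (hx : 0 ≤ x) (j : ℕ)
    (hxj : x ^ 2 = η * (max j 1 : ℕ)) :
    (1 + x) ^ 4 * Real.exp (1 / 8 * x ^ 2) * ((1 + η)⁻¹) ^ j * Real.exp (1 / 8 * (η * j)) ≤
      1024 * Real.exp (1 / 4) * Real.exp (-(η / 8 * j)) := by
  have hxu : x ^ 2 ≤ η * j + 1 := by
    have : ((max j 1 : ℕ) : ℝ) ≤ j + 1 := by
      have : max j 1 ≤ j + 1 := by omega
      exact_mod_cast this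
    rw [hxj]
    nlinarith
  have h1 : (1 + x) ^ 4 ≤ 1024 * Real.exp (1 / 8 * x ^ 2) := by
    have e1 : (1 + x) ^ 2 ≤ 2 * (1 + x ^ 2) := by nlinarith [sq_nonneg (x - 1)]
    have e2 : 1 + x ^ 2 ≤ 16 * Real.exp (x ^ 2 / 16) := by
      nlinarith [Real.add_one_le_exp (x ^ 2 / 16), sq_nonneg x]
    calc (1 + x) ^ 4 = ((1 + x) ^ 2) ^ 2 := by ring
      _ ≤ (2 * (16 * Real.exp (x ^ 2 / 16))) ^ 2 := by gcongr; linarith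
      _ = 1024 * (Real.exp (x ^ 2 / 16) * Real.exp (x ^ 2 / 16)) := by ring
      _ = _ := by rw [← Real.exp_add]; ring_nf
  have h2 : (1 + η)⁻¹ ≤ Real.exp (-(η / 2)) := by
    rw [Real.exp_neg]
    refine inv_anti₀ (Real.exp_pos _) ?_
    have := (abs_le.1 (Real.abs_exp_sub_one_sub_id_le (x := η / 2)
      (by rw [abs_of_pos (by positivity)]; linarith))).2
    nlinarith
  have h3 : ((1 + η)⁻¹) ^ j ≤ Real.exp (-(η / 2 * j)) := by
    calc _ ≤ Real.exp (-(η / 2)) ^ j := by gcongr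
      _ = _ := by rw [← Real.exp_nat_mul]; ring_nf
  calc _ ≤ 1024 * Real.exp (1 / 8 * x ^ 2) * Real.exp (1 / 8 * x ^ 2) * Real.exp (-(η / 2 * j)) *
        Real.exp (1 / 8 * (η * j)) := by gcongr
    _ = 1024 * Real.exp (1 / 8 * x ^ 2 + 1 / 8 * x ^ 2 + -(η / 2 * j) + 1 / 8 * (η * j)) := by
        rw [Real.exp_add, Real.exp_add, Real.exp_add]; ring
    -- With x² ≤ η j + 1 the growing terms amount to at most 3 η j / 8 + 1/4, against the decay η j
    -- / 2 of (1 + η)^(-j).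
    _ ≤ 1024 * Real.exp (1 / 4 + -(η / 8 * j)) := by
        refine mul_le_mul_of_nonneg_left (Real.exp_le_exp.2 ?_) (by norm_num)
        linarith
    _ = _ := by rw [Real.exp_add]; ring

/-- The coefficients of the power series of `(η / (1 + η - ρ)) ^ (k + 1)` in `ρ`. -/
def resCoeff (η : ℝ) (k j : ℕ) : ℝ :=
  (η * (1 + η)⁻¹) ^ (k + 1) * ((j + k).choose k * ((1 + η)⁻¹) ^ j)

/-- The resolvent `(1 + D_n)⁻¹`. -/
def resolv (hhat : (Fin 3 → ℂ) → ℂ) (L t s n : ℕ) [NeZero L] :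
    Matrix (Lat L t s n) (Lat L t s n) ℂ :=
  mulMat L t s n (labMin L t s n) fun r => (1 + dSym hhat L t s n (labMin L t s n r))⁻¹

/-- With ρ the symbol of one step, 1 + dSym = (1 + η) η⁻¹ (1 - ρ / (1 + η)). The negative binomial
series converges because |ρ| ≤ 1 < 1 + η. -/
theorem IsHamiltonian.hasSum_resolv (H : IsHamiltonian h hhat) (k : ℕ) (u v : Lat L t s n) :
    HasSum (fun j => (((resCoeff (eps L n 0) k j : ℝ) : ℂ) • stepPow hhat L t s n j) u v)
      ((resolv hhat L t s n ^ (k + 1)) u v) := by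
  have hη0 : 0 < eps L n 0 := eps_pos 0
  set η := eps L n 0 with hη
  have hηL : (L : ℂ) ^ (2 * n) = ((η : ℝ) : ℂ)⁻¹ := by
    rw [hη, eps, Ldir, if_pos rfl]
    push_cast
    rw [inv_inv, ← pow_mul]
  have hη' : ((η : ℝ) : ℂ) ≠ 0 := by exact_mod_cast hη0.ne'
  have hη1 : (1 + (η : ℝ) : ℂ) ≠ 0 := by
    have : (1 + η : ℝ) ≠ 0 := by positivity
    exact_mod_cast this
  have key : ∀ r : Lat L t s n, HasSum (fun j => ((resCoeff η k j : ℝ) : ℂ) *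
      stepSym hhat L t s n (labMin L t s n r) ^ j)
      ((1 + dSym hhat L t s n (labMin L t s n r))⁻¹ ^ (k + 1)) := by
    intro r
    set ρ := stepSym hhat L t s n (labMin L t s n r) with hρ
    have hρ1 : ‖ρ‖ ≤ 1 := H.norm_stepSym_le _
    have hr : ‖(1 + (η : ℂ))⁻¹ * ρ‖ < 1 := by
      have e1 : ‖(1 + (η : ℂ))⁻¹‖ = (1 + η)⁻¹ := by
        rw [norm_inv, ← Complex.ofReal_one, ← Complex.ofReal_add, Complex.norm_real,
          Real.norm_of_nonneg (by positivity)]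
      rw [norm_mul, e1]
      calc _ ≤ (1 + η)⁻¹ * 1 := by gcongr
        _ < 1 := by rw [mul_one]; exact inv_lt_one_of_one_lt₀ (by linarith)
    have h1 := (hasSum_choose_mul_geometric_of_norm_lt_one k hr).mul_left
      (((η : ℂ) * (1 + (η : ℂ))⁻¹) ^ (k + 1))
    have e2 : ((η : ℂ) * (1 + (η : ℂ))⁻¹) ^ (k + 1) *
        (1 / (1 - (1 + (η : ℂ))⁻¹ * ρ) ^ (k + 1)) =
        (1 + dSym hhat L t s n (labMin L t s n r))⁻¹ ^ (k + 1) := by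
      rw [one_div, ← inv_pow, ← mul_pow]
      congr 1
      have e3 : 1 + dSym hhat L t s n (labMin L t s n r) =
          (1 + (η : ℂ)) * (η : ℂ)⁻¹ * (1 - (1 + (η : ℂ))⁻¹ * ρ) := by
        rw [dSym, ← hρ, hηL]
        field_simp
        ring
      rw [e3, mul_inv, mul_inv, inv_inv]
      ring
    rw [e2] at h1
    refine h1.congr_fun ?_
    intro j
    simp only [resCoeff]
    push_cast
    ring
  rw [resolv, mulMat_pow isLabel_labMin, mulMat_apply]
  have h2 := (hasSum_sum fun r (_ : r ∈ (Finset.univ : Finset (Lat L t s n))) =>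
    (key r).mul_right (chi (labMin L t s n r) (u - v))).mul_left
      ((Fintype.card (Lat L t s n) : ℂ)⁻¹)
  refine h2.congr_fun fun j => ?_
  rw [Matrix.smul_apply, stepPow, mulMat_apply, smul_eq_mul, mul_left_comm, Finset.mul_sum]
  congr 1
  refine Finset.sum_congr rfl fun r _ => by ring

end Lattice

end

end PBS


namespace PBS

noncomputable section

/-! ### Bounds on the resolvent -/

section Resolvent

variable {h : (Fin 3 → ℤ) → ℂ} {hhat : (Fin 3 → ℂ) → ℂ}

theorem resCoeff_nonneg {η : ℝ} (hη : 0 ≤ η) (k j : ℕ) : 0 ≤ resCoeff η k j := by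
  unfold resCoeff; positivity

theorem resCoeff_le {η : ℝ} (hη : 0 ≤ η) (k j : ℕ) :
    resCoeff η k j ≤ η ^ (k + 1) * ((j + k).choose k * ((1 + η)⁻¹) ^ j) := by
  have h1 : (1 + η)⁻¹ ≤ 1 := inv_le_one_of_one_le₀ (by linarith)
  unfold resCoeff
  gcongr
  exact mul_le_of_le_one_right hη h1

theorem choose_add_two_le (j : ℕ) : ((j + 2).choose 2 : ℝ) ≤ 3 * ((max j 1 : ℕ) : ℝ) ^ 2 := by
  have h1 : ((j + 2).choose 2 : ℝ) = ((j : ℝ) + 2) * (j + 1) / 2 := by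
    rw [Nat.cast_choose_two]; push_cast; ring
  rw [h1]
  rcases Nat.eq_zero_or_pos j with rfl | hj
  · norm_num
  · rw [max_eq_left hj]
    have : (1 : ℝ) ≤ j := by exact_mod_cast hj
    nlinarith

/-- A real sum over the nonnegative integers in a residue class. -/
theorem tsum_nat_residue_le (S : ℕ) [NeZero S] (w : ZMod S) {δ : ℝ} (hδ : 0 < δ) :
    Summable (fun j : ℕ => if w + (j : ZMod S) = 0 then Real.exp (-(δ * j)) else 0) ∧
    ∑' j : ℕ, (if w + (j : ZMod S) = 0 then Real.exp (-(δ * j)) else 0) ≤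
      3 * Real.exp (-(δ * |(w.valMinAbs : ℝ)|)) / (1 - Real.exp (-(δ * S))) := by
  obtain ⟨h1, h2⟩ := sum_exp_residue S (-w) hδ
  rw [← Int.cast_abs, abs_valMinAbs_neg, Int.cast_abs] at h2
  have hfun : (fun j : ℕ => if w + (j : ZMod S) = 0 then Real.exp (-(δ * j)) else 0) =
      (fun m : ℤ => if (m : ZMod S) = -w then Real.exp (-(δ * |(m : ℝ)|)) else 0) ∘
        (Nat.cast : ℕ → ℤ) := by
    funext j
    simp [eq_neg_iff_add_eq_zero, add_comm w]
  have hinj : Function.Injective (Nat.cast : ℕ → ℤ) := Nat.cast_injective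
  constructor
  · rw [hfun]; exact h1.comp_injective hinj
  · refine le_trans ?_ h2
    rw [hfun]
    exact tsum_comp_le_tsum_of_inj h1 (fun m => by split_ifs <;> positivity) hinj

theorem sum_exp_spLen_le {L t s n : ℕ} [NeZero L] {σ : ℝ} (hσ : 1 ≤ σ) :
    ∑ w : ∀ i : Fin 3, ZMod (size L t s n i.succ),
      Real.exp (-(1 / (3 * σ) * ∑ i, |((w i).valMinAbs : ℝ)|)) ≤ (12 * σ) ^ 3 := by
  have h1 : ∀ w : ∀ i : Fin 3, ZMod (size L t s n i.succ),
      Real.exp (-(1 / (3 * σ) * ∑ i, |((w i).valMinAbs : ℝ)|)) =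
      ∏ i, Real.exp (-(1 / (3 * σ) * |((w i).valMinAbs : ℝ)|)) := by
    intro w
    rw [← Real.exp_sum, Finset.sum_neg_distrib, ← Finset.mul_sum]
  simp only [h1]
  rw [sum_prod_pi fun (i : Fin 3) (z : ZMod (size L t s n i.succ)) =>
    Real.exp (-(1 / (3 * σ) * |(z.valMinAbs : ℝ)|))]
  calc _ ≤ ∏ _i : Fin 3, 12 * σ := by
        refine Finset.prod_le_prod (fun i _ => by positivity) fun i _ => ?_
        refine (sum_exp_valMinAbs_le _ (by positivity)).trans ?_
        rw [one_div_one_div]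
        linarith
    _ = _ := by simp

/-- Put σ = √(max j 1). The j-th term of R^(k+1) has size η^(k+1) σ^(2k), times a heat kernel of
size σ^(-3) when ε σ ≤ 1. With η = ε² and volume weight ε⁵ the density is (ε σ)^(2k-3), which is
bounded for small j only from k = 2 on; large j are suppressed by (1 + η)^(-j). For R itself only
row and column sums are bounded. -/
theorem IsHamiltonian.exists_resolv_bounds (H : IsHamiltonian h hhat) : ∃ m C : ℝ, 0 < m ∧ 0 ≤ C ∧
    ∀ (L : ℕ) [NeZero L] (t s n : ℕ), ExpBd d1 m C (resolv hhat L t s n) ∧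
      PtBd d1 m (C * weight L n) (resolv hhat L t s n ^ 3) := by
  obtain ⟨K, hK, hstep⟩ := H.exists_norm_stepPow_le
  have hK0 : 0 < K := by linarith
  -- With b = m ε this makes the growth K b² j of the heat bound at most (ε σ)² / 8, which
  -- `pow_mul_exp_le` absorbs.
  set m : ℝ := 1 / (8 * K) with hm
  have hm0 : 0 < m := by positivity
  have hm1 : m ≤ 1 / 8 := by
    rw [hm]; exact one_div_le_one_div_of_le (by norm_num) (by linarith)
  have hKm : K * m ^ 2 ≤ 1 / 8 := by
    have : K * m = 1 / 8 := by rw [hm]; field_simp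
    nlinarith
  set B : ℝ := 1024 * Real.exp (1 / 4) with hB
  have hB0 : 0 < B := by positivity
  refine ⟨m, 9 * (12 ^ 3 * K * B) + 27 * (3 * K * B), hm0, by positivity, ?_⟩
  intro L _ t s n
  have hL1 : (1 : ℝ) ≤ L := by exact_mod_cast Nat.pos_of_ne_zero (NeZero.ne L)
  set ε : ℝ := ((L : ℝ) ^ n)⁻¹ with hε
  have hε0 : 0 < ε := by positivity
  have hε1 : ε ≤ 1 := inv_le_one_of_one_le₀ (one_le_pow₀ hL1)
  set η : ℝ := eps L n 0 with hη
  have hηε : η = ε ^ 2 := eps_zero L n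
  have hη0 : 0 < η := eps_pos 0
  have hη1 : η ≤ 1 := eps_le_one 0
  have hb0 : 0 ≤ m * ε := by positivity
  have hb1 : m * ε ≤ 1 / 3 := by nlinarith
  let σ : ℕ → ℝ := fun j => √((max j 1 : ℕ) : ℝ)
  have hσ1 : ∀ j, 1 ≤ σ j := fun j => Real.one_le_sqrt.2 (by
    have : 1 ≤ max j 1 := le_max_right _ _
    exact_mod_cast this)
  have hσ2 : ∀ j, σ j ^ 2 = ((max j 1 : ℕ) : ℝ) := fun j => Real.sq_sqrt (by positivity)
  have hx2 : ∀ j, (ε * σ j) ^ 2 = η * (max j 1 : ℕ) := fun j => by rw [mul_pow, hσ2, hηε]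
  have hx0 : ∀ j, 0 ≤ ε * σ j := fun j => mul_nonneg hε0.le (by linarith [hσ1 j])
  have hscal := fun j => pow_mul_exp_le hη0 hη1 (hx0 j) j (hx2 j)
  have hheat : ∀ j (y : ℝ), heatBound K ε (m * ε) j y ≤
      K * Real.exp (1 / 8 * (ε * σ j) ^ 2) * (1 / σ j + ε) ^ 3 *
        (Real.exp (-(m * ε * y)) * Real.exp (-(1 / (3 * σ j) * y))) := by
    intro j y
    have hs : 0 < σ j := by linarith [hσ1 j]
    unfold heatBound
    have e : K * ((m * ε) ^ 2 * ((max j 1 : ℕ) : ℝ)) = K * m ^ 2 * (ε * σ j) ^ 2 := by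
      rw [← hσ2]; ring
    rw [e]
    change _ * (1 / σ j + ε) ^ 3 * (_ * Real.exp (-(1 / (3 * σ j) * y))) ≤ _
    gcongr
  have hcube : ∀ j, (1 / σ j + ε) ^ 3 * σ j ^ 3 = (1 + ε * σ j) ^ 3 := fun j => by
    have : σ j ≠ 0 := by linarith [hσ1 j]
    rw [← mul_pow]
    congr 1
    field_simp
  constructor
  -- The space sum over the time slice costs (12 σ)³ and cancels the height (1/σ + ε)³ up to (1 + ε
  -- σ)³. The time displacement is at most j steps, so its weight costs exp(η j / 8).
  · have hExp : ∀ j, ExpBd d1 m (K * Real.exp (1 / 8 * (ε * σ j) ^ 2) * (1 / σ j + ε) ^ 3 *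
        Real.exp (1 / 8 * (η * j)) * (12 * σ j) ^ 3) (stepPow hhat L t s n j) := by
      intro j
      have hs : 0 < σ j := by linarith [hσ1 j]
      set A : ℝ := K * Real.exp (1 / 8 * (ε * σ j) ^ 2) * (1 / σ j + ε) ^ 3 *
        Real.exp (1 / 8 * (η * j)) with hA
      have hA0 : 0 ≤ A := by positivity
      refine expBd_of_le_conv (fun w => if w 0 + (j : ZMod (size L t s n 0)) = 0 then
        A * Real.exp (-(1 / (3 * σ j) * spLen w)) else 0) (fun u v => ?_) ?_
      · have h1 := hstep L t s n j (m * ε) hb0 hb1 u v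
        split_ifs at h1 ⊢ with h0
        · have h2 := h1.trans (hheat j _)
          have h3 : |(((u - v) 0).valMinAbs : ℝ)| ≤ j := by
            have e1 : (u - v) 0 = ((-j : ℤ) : ZMod (size L t s n 0)) := by
              push_cast; exact eq_neg_of_add_eq_zero_left h0
            have e2 := abs_valMinAbs_intCast_le (size L t s n 0) (-j)
            rw [e1]
            rw [abs_neg, Nat.abs_cast] at e2
            exact_mod_cast e2
          have h4 : Real.exp (m * d1 u v) ≤
              Real.exp (1 / 8 * (η * j)) * Real.exp (m * ε * spLen (u - v)) := by
            rw [← Real.exp_add, Real.exp_le_exp, d1_eq_time_add_space, ← hη, ← hε, mul_add]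
            have h5 : m * (η * |((u 0 - v 0).valMinAbs : ℝ)|) ≤ 1 / 8 * (η * j) := by
              have h3' : |((u 0 - v 0).valMinAbs : ℝ)| ≤ j := h3
              gcongr
            rw [mul_assoc m ε]
            linarith
          calc _ ≤ Real.exp (1 / 8 * (η * j)) * Real.exp (m * ε * spLen (u - v)) *
                (K * Real.exp (1 / 8 * (ε * σ j) ^ 2) * (1 / σ j + ε) ^ 3 *
                (Real.exp (-(m * ε * spLen (u - v))) *
                  Real.exp (-(1 / (3 * σ j) * spLen (u - v))))) := by gcongr
            _ = A * Real.exp (-(1 / (3 * σ j) * spLen (u - v))) *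
                (Real.exp (m * ε * spLen (u - v)) * Real.exp (-(m * ε * spLen (u - v)))) := by
                rw [hA]; ring
            _ = _ := by rw [← Real.exp_add, add_neg_cancel, Real.exp_zero, mul_one]
        · rw [le_antisymm h1 (norm_nonneg _), mul_zero]
      · have h1 := sum_timeSlice (L := L) (t := t) (s := s) (n := n)
          (j : ZMod (size L t s n 0)) fun w' => A * Real.exp (-(1 / (3 * σ j) *
            ∑ i, |((w' i).valMinAbs : ℝ)|))
        refine h1.le.trans ?_
        rw [← Finset.mul_sum]
        gcongr
        exact sum_exp_spLen_le (hσ1 j)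
    -- The sum η ∑ exp(-η j / 8) is a Riemann sum of an integral over physical time, bounded by 9
    -- uniformly in η ≤ 1.
    have hsum : HasSum (fun j : ℕ => 12 ^ 3 * K * B * (η * Real.exp (-(η / 8)) ^ j))
        (12 ^ 3 * K * B * (η * (1 - Real.exp (-(η / 8)))⁻¹)) :=
      ((hasSum_geometric_of_lt_one (Real.exp_pos _).le
        (Real.exp_lt_one_iff.2 (by linarith))).mul_left _).mul_left _
    have hR := ExpBd.hasSum (d := d1) (m := m) (R := resolv hhat L t s n) (fun j => ?_) hsum
      (fun u v => by simpa using H.hasSum_resolv 0 u v)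
    · refine hR.mono le_rfl ?_ isDist_d1.nonneg
      have h1 : η * (1 - Real.exp (-(η / 8)))⁻¹ ≤ 9 := by
        have h2 := inv_one_sub_exp_neg_le (y := η / 8) (by positivity)
        calc _ ≤ η * (1 + 1 / (η / 8)) := by gcongr
          _ = η + 8 := by field_simp
          _ ≤ 9 := by linarith
      have h3 : 0 ≤ 27 * (3 * K * B) := by positivity
      have h4 : 12 ^ 3 * K * B * (η * (1 - Real.exp (-(η / 8)))⁻¹) ≤ 12 ^ 3 * K * B * 9 := by gcongr
      linarith
    · have hs : 0 < σ j := by linarith [hσ1 j]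
      refine ((hExp j).smul _).mono le_rfl ?_ isDist_d1.nonneg
      rw [Complex.norm_real, Real.norm_of_nonneg (resCoeff_nonneg hη0.le 0 j)]
      have h1 := resCoeff_le hη0.le 0 j
      simp only [zero_add, pow_one, add_zero, Nat.choose_zero_right, Nat.cast_one, one_mul] at h1
      have h2 := hscal j
      have h4 : Real.exp (-(η / 8)) ^ j = Real.exp (-(η / 8 * j)) := by
        rw [← Real.exp_nat_mul]; ring_nf
      have h5 : (1 + ε * σ j) ^ 3 ≤ (1 + ε * σ j) ^ 4 :=
        pow_le_pow_right₀ (by linarith [hx0 j]) (by norm_num)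
      rw [h4]
      calc _ ≤ η * ((1 + η)⁻¹) ^ j * (K * Real.exp (1 / 8 * (ε * σ j) ^ 2) * (1 / σ j + ε) ^ 3 *
            Real.exp (1 / 8 * (η * j)) * (12 * σ j) ^ 3) := by gcongr
        _ = 12 ^ 3 * K * η * (((1 / σ j + ε) ^ 3 * σ j ^ 3) * Real.exp (1 / 8 * (ε * σ j) ^ 2) *
            ((1 + η)⁻¹) ^ j * Real.exp (1 / 8 * (η * j))) := by ring
        _ ≤ 12 ^ 3 * K * η * ((1 + ε * σ j) ^ 4 * Real.exp (1 / 8 * (ε * σ j) ^ 2) *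
            ((1 + η)⁻¹) ^ j * Real.exp (1 / 8 * (η * j))) := by
            rw [hcube]
            have := hx0 j
            gcongr
        _ ≤ 12 ^ 3 * K * η * (B * Real.exp (-(η / 8 * j))) := by gcongr
        _ = _ := by ring
  · intro u v
    obtain ⟨hres1, hres2⟩ := tsum_nat_residue_le (size L t s n 0) ((u - v) 0)
      (δ := η / 8) (by positivity)
    have hw : weight L n = ε ^ 5 := by
      rw [weight, hε, inv_pow, ← pow_mul, mul_comm]
    -- G collects the density and the space decay. Given two points, only those j in one residue
    -- class modulo the time period contribute, and their sum yields the time decay.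
    set G : ℝ := 3 * K * B * ε ^ 5 * Real.exp (-(m * ε * spLen (u - v))) with hG
    have hG0 : 0 ≤ G := by positivity
    have hterm : ∀ j, ‖(((resCoeff η 2 j : ℝ) : ℂ) • stepPow hhat L t s n j) u v‖ ≤
        G * (if (u - v) 0 + (j : ZMod (size L t s n 0)) = 0 then
          Real.exp (-(η / 8 * j)) else 0) := by
      intro j
      have hs : 0 < σ j := by linarith [hσ1 j]
      rw [Matrix.smul_apply, norm_smul, Complex.norm_real,
        Real.norm_of_nonneg (resCoeff_nonneg hη0.le 2 j)]
      have h1 := hstep L t s n j (m * ε) hb0 hb1 u v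
      split_ifs at h1 ⊢ with h0
      · have h2 := h1.trans (hheat j _)
        have hsp : 0 ≤ spLen (u - v) := Finset.sum_nonneg fun i _ => abs_nonneg _
        have h3 : Real.exp (-(1 / (3 * σ j) * spLen (u - v))) ≤ 1 :=
          Real.exp_le_one_iff.2 (by
            have : 0 ≤ 1 / (3 * σ j) * spLen (u - v) := by positivity
            linarith)
        have h4 := resCoeff_le hη0.le 2 j
        have h5 := choose_add_two_le j
        rw [← hσ2] at h5
        have hxx : ε * σ j ≤ 1 + ε * σ j := by linarith
        have hx := hx0 j
        have h6 : 1 ≤ Real.exp (1 / 8 * (η * j)) := Real.one_le_exp (by positivity)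
        -- Power counting: η³ σ⁴ = ε⁵ (ε σ) σ³, and σ³ is used up by the height of the heat kernel.
        calc _ ≤ η ^ (2 + 1) * ((3 * (σ j ^ 2) ^ 2) * ((1 + η)⁻¹) ^ j) *
              (K * Real.exp (1 / 8 * (ε * σ j) ^ 2) * (1 / σ j + ε) ^ 3 *
              (Real.exp (-(m * ε * spLen (u - v))) * 1)) := by
              refine mul_le_mul (h4.trans ?_) (h2.trans ?_) (norm_nonneg _) (by positivity)
              · gcongr
              · gcongr
          _ = 3 * K * ε ^ 5 * Real.exp (-(m * ε * spLen (u - v))) *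
              (((1 / σ j + ε) ^ 3 * σ j ^ 3) * (ε * σ j) * Real.exp (1 / 8 * (ε * σ j) ^ 2) *
                ((1 + η)⁻¹) ^ j * 1) := by rw [hηε]; ring
          _ ≤ 3 * K * ε ^ 5 * Real.exp (-(m * ε * spLen (u - v))) *
              ((1 + ε * σ j) ^ 3 * (1 + ε * σ j) * Real.exp (1 / 8 * (ε * σ j) ^ 2) *
                ((1 + η)⁻¹) ^ j * Real.exp (1 / 8 * (η * j))) := by
              rw [hcube]
              gcongr
          _ ≤ 3 * K * ε ^ 5 * Real.exp (-(m * ε * spLen (u - v))) *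
              (B * Real.exp (-(η / 8 * j))) := by
              rw [← pow_succ]
              exact mul_le_mul_of_nonneg_left (hscal j) (by positivity)
          _ = _ := by rw [hG]; ring
      · rw [le_antisymm h1 (norm_nonneg _), mul_zero, mul_zero]
    have hRs := H.hasSum_resolv (L := L) (t := t) (s := s) (n := n) 2 u v
    rw [← hη] at hRs
    rw [show resolv hhat L t s n ^ 3 = resolv hhat L t s n ^ (2 + 1) from rfl, ← hRs.tsum_eq]
    refine (tsum_of_norm_bounded ((hres1.mul_left G).hasSum) hterm).trans ?_
    rw [tsum_mul_left]
    -- The physical time period is L^t ≥ 1, so winding around the torus costs only a bounded factor.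
    have hηS : 1 ≤ η * (size L t s n 0 : ℝ) := by
      have e : η * (size L t s n 0 : ℝ) = (L : ℝ) ^ t := by
        have hLd : (Ldir L 0 : ℝ) ≠ 0 := by exact_mod_cast (Ldir_pos L 0).ne'
        rw [hη, eps, size, period, if_pos rfl]
        push_cast
        field_simp
      rw [e]
      exact one_le_pow₀ hL1
    have hinv : (1 - Real.exp (-(η / 8 * (size L t s n 0 : ℝ))))⁻¹ ≤ 9 := by
      have h2 := inv_one_sub_exp_neg_le (y := η / 8 * (size L t s n 0 : ℝ)) (by linarith)
      refine h2.trans ?_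
      have : 1 / (η / 8 * (size L t s n 0 : ℝ)) ≤ 8 := by
        rw [div_le_iff₀ (by linarith)]
        linarith
      linarith
    have hdist : Real.exp (-(m * ε * spLen (u - v))) *
        Real.exp (-(η / 8 * |(((u - v) 0).valMinAbs : ℝ)|)) ≤ Real.exp (-(m * d1 u v)) := by
      rw [← Real.exp_add, Real.exp_le_exp, d1_eq_time_add_space, ← hη, ← hε]
      have h3 : m * (η * |((u 0 - v 0).valMinAbs : ℝ)|) ≤
          η / 8 * |(((u - v) 0).valMinAbs : ℝ)| := by
        rw [← mul_assoc]
        have : m * η ≤ η / 8 := by nlinarith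
        exact mul_le_mul_of_nonneg_right this (abs_nonneg _)
      rw [mul_add, ← mul_assoc m ε]
      linarith
    calc _ ≤ G * (3 * Real.exp (-(η / 8 * |(((u - v) 0).valMinAbs : ℝ)|)) * 9) := by
          refine mul_le_mul_of_nonneg_left (hres2.trans ?_) hG0
          rw [div_eq_mul_inv]
          gcongr
      _ = 27 * (3 * K * B) * ε ^ 5 * (Real.exp (-(m * ε * spLen (u - v))) *
          Real.exp (-(η / 8 * |(((u - v) 0).valMinAbs : ℝ)|))) := by rw [hG]; ring
      _ ≤ 27 * (3 * K * B) * ε ^ 5 * Real.exp (-(m * d1 u v)) := by gcongr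
      _ ≤ _ := by
          rw [hw]
          have : 0 ≤ 9 * (12 ^ 3 * K * B) := by positivity
          gcongr
          linarith

theorem one_add_ne_zero_of_re_nonneg {z : ℂ} (hz : 0 ≤ z.re) : 1 + z ≠ 0 := by
  intro h0
  have := congrArg Complex.re h0
  simp at this
  linarith

theorem IsHamiltonian.resolv_mul {L t s n : ℕ} [NeZero L] (H : IsHamiltonian h hhat) :
    resolv hhat L t s n * (1 + Dn L t s h n) = 1 := by
  rw [H.Dn_eq_mulMat isLabel_labMin, resolv, ← mulMat_one isLabel_labMin, ← mulMat_add,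
    mulMat_mul isLabel_labMin]
  congr 1
  funext r
  exact inv_mul_cancel₀ (one_add_ne_zero_of_re_nonneg (H.dSym_re_nonneg _))

end Resolvent

end

end PBS


namespace PBS

noncomputable section

/-! ### The Green's functions -/

section Neumann

variable {X : Type*} [Fintype X] [DecidableEq X]

/-- Perturbation of an operator by a small multiple of the identity. -/
theorem ExpBd.inv_sub_smul_one {d : X → X → ℝ} (hd : IsDist d) {m Γ : ℝ} (hm : 0 ≤ m) (hΓ : 0 ≤ Γ)
    {K : Matrix X X ℂ} (hK : IsUnit K) (hb : ExpBd d m Γ K⁻¹) {μ : ℂ} (hμ : ‖μ‖ * Γ ≤ 1 / 2) :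
    IsUnit (K - μ • 1) ∧ ExpBd d m (2 * Γ) (K - μ • 1)⁻¹ ∧
      ExpBd d m (‖μ‖ * (2 * Γ * Γ)) ((K - μ • 1)⁻¹ - K⁻¹) := by
  have hdet : IsUnit K.det := (Matrix.isUnit_iff_isUnit_det K).1 hK
  obtain ⟨hu, hn⟩ := ((hb.smul μ).mono le_rfl hμ hd.nonneg).isUnit_one_sub hd hm
  have hfac : K - μ • 1 = K * (1 - μ • K⁻¹) := by
    rw [Matrix.mul_sub, Matrix.mul_one, Matrix.mul_smul, Matrix.mul_nonsing_inv _ hdet]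
  have hunit : IsUnit (K - μ • 1) := by rw [hfac]; exact hK.mul hu
  have hudet := (Matrix.isUnit_iff_isUnit_det _).1 hunit
  have hinv : ExpBd d m (2 * Γ) (K - μ • 1)⁻¹ := by
    rw [hfac, Matrix.mul_inv_rev]
    exact hn.mul hm (by norm_num) hΓ hd.tri hb
  refine ⟨hunit, hinv, ?_⟩
  have hdiff : (K - μ • 1)⁻¹ - K⁻¹ = μ • ((K - μ • 1)⁻¹ * K⁻¹) := by
    have h1 : (K - μ • 1)⁻¹ * (K - (K - μ • 1)) * K⁻¹ = (K - μ • 1)⁻¹ - K⁻¹ := by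
      rw [Matrix.mul_sub, Matrix.nonsing_inv_mul _ hudet, Matrix.sub_mul, Matrix.mul_assoc,
        Matrix.mul_nonsing_inv _ hdet, Matrix.mul_one, Matrix.one_mul]
    rw [← h1, sub_sub_cancel, Matrix.mul_smul, Matrix.mul_one, Matrix.smul_mul]
  rw [hdiff]
  exact (hinv.mul hm (by positivity) hΓ hd.tri hb).smul μ

end Neumann

section Cube

variable {X : Type*} [Fintype X] [DecidableEq X]

/-- Every term other than R³ contains a factor R B, which has a density because B does. Hence E³
inherits a density from R³ and B. -/
theorem cube_sub_mul {M : Type*} [Ring M] (R B : M) : (R - R * B) ^ 3 =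
    R ^ 3 - R * B * R ^ 2 - (R - R * B) * (R * B) * R - (R - R * B) ^ 2 * (R * B) := by
  noncomm_ring

theorem ptBd_cube_sub_mul {d : X → X → ℝ} (hd : IsDist d) {m C₁ C₃ CB CE : ℝ} (hm : 0 ≤ m)
    (hC₁ : 0 ≤ C₁) (hCB : 0 ≤ CB) (hCE : 0 ≤ CE) {R B : Matrix X X ℂ} (hR : ExpBd d m C₁ R)
    (hR3 : PtBd d m C₃ (R ^ 3)) (hB : PtBd d m CB B) (hE : ExpBd d m CE (R - R * B)) :
    PtBd d m (C₃ + C₁ * CB * C₁ ^ 2 + CE * (C₁ * CB) * C₁ + CE ^ 2 * (C₁ * CB))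
      ((R - R * B) ^ 3) := by
  have hRB : PtBd d m (C₁ * CB) (R * B) := PtBd.rowBd_mul hm hCB hd.tri hR.row hB
  have h1 : PtBd d m (C₁ * CB * C₁ ^ 2) (R * B * R ^ 2) :=
    hRB.mul_expBd hm (by positivity) hd.tri (hR.pow hd hm hC₁ 2)
  have h2 : PtBd d m (CE * (C₁ * CB) * C₁) ((R - R * B) * (R * B) * R) :=
    PtBd.mul_expBd hm (by positivity) hd.tri
      (PtBd.rowBd_mul hm (by positivity) hd.tri hE.row hRB) hR
  have h4 : PtBd d m (CE ^ 2 * (C₁ * CB)) ((R - R * B) ^ 2 * (R * B)) :=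
    PtBd.rowBd_mul hm (by positivity) hd.tri (hE.pow hd hm hCE 2).row hRB
  rw [cube_sub_mul]
  exact ((hR3.sub h1).sub h2).sub h4

end Cube

/-- Invertibility of `D + Q^+ 𝔔_n Q^-` and bounds on the inverse, given bounds on `(1 + D)⁻¹`. -/
theorem exists_expBd_inv {q : ℕ} (hq : 1 ≤ q) {a c₀ m₁ C₁ : ℝ} (ha : 0 < a) (hc₀ : 0 < c₀)
    (hm₁ : 0 < m₁) (hC₁ : 0 ≤ C₁) :
    ∃ m Γ : ℝ, 0 < m ∧ 0 ≤ Γ ∧ ∀ (L : ℕ) [NeZero L], Odd L → 2 ≤ (L : ℝ) →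
      ∀ (t s n : ℕ) (v w : Lat L t s 0 × Bdual L n → ℂ), SymPair q v w →
      ∀ (d : Lat L t s 0 × Bdual L n → ℂ), (∀ i, 0 ≤ (d i).re) →
      (∀ κ l, l ≠ 0 → c₀ ≤ ‖d (κ, l)‖) → ∀ D R : Matrix (Lat L t s n) (Lat L t s n) ℂ,
      D = mulMat L t s n (labPair L t s n) d → R * (1 + D) = 1 → ExpBd d1 m₁ C₁ R →
      PtBd d1 m₁ (C₁ * weight L n) (R ^ 3) →
        IsUnit (D + ((weight L n : ℝ) : ℂ)⁻¹ • (coarse v).conjTranspose *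
          fQ L q t s a n * coarse w) ∧
        ExpBd d1 m Γ (D + ((weight L n : ℝ) : ℂ)⁻¹ • (coarse v).conjTranspose *
          fQ L q t s a n * coarse w)⁻¹ := by
  obtain ⟨mB, CB, hmB, -, hCB, hPB⟩ := exists_ptBd_averaging hq ha
  obtain ⟨CK, hCK, hlow⟩ := exists_l2_lower hq ha hc₀
  have hV : 0 ≤ volBound (mB / 2) := by unfold volBound; positivity
  set C' : ℝ := CB * volBound (mB / 2) with hC'
  have hC'0 : 0 ≤ C' := by positivity
  set m₂ : ℝ := min m₁ (mB / 2) with hm₂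
  have hm₂0 : 0 < m₂ := by positivity
  have hm₂1 : m₂ ≤ m₁ := min_le_left _ _
  have hm₂B : m₂ ≤ mB / 2 := min_le_right _ _
  set CE : ℝ := C₁ + C₁ * C' with hCE
  have hCE0 : 0 ≤ CE := by positivity
  set C₂ : ℝ := C₁ + C₁ * CB * C₁ ^ 2 + CE * C₁ * CB * C₁ + CE ^ 2 * C₁ * CB with hC₂
  set c : ℝ := (1 + CK * (1 + C'))⁻¹ with hc
  have hc0 : 0 < c := by positivity
  obtain ⟨m, C, hm, hmm, hC, hcore⟩ := exists_expBd_inv_one_sub (C₁ := CE) (C₂ := C₂) hm₂0 hCE0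
    (by positivity) hc0 volBound
  refine ⟨m, C * C₁, hm, by positivity, ?_⟩
  intro L _ hL hL2 t s n v w hvw d hd hd' D R hD hR hRE hRP
  have hwt := weight_pos (L := L) (j := n)
  set B : Matrix (Lat L t s n) (Lat L t s n) ℂ :=
    ((weight L n : ℝ) : ℂ)⁻¹ • (coarse v).conjTranspose * fQ L q t s a n * coarse w with hB
  have hdist : IsDist (d1 : Lat L t s n → Lat L t s n → ℝ) := isDist_d1
  have hPB1 : PtBd d1 mB (CB * weight L n) B := hPB L hL hL2 t s n v w hvw
  have hPB2 : PtBd d1 m₂ (CB * weight L n) B :=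
    hPB1.mono (by linarith) le_rfl (by positivity) hdist.nonneg
  have hEB : ExpBd d1 m₂ C' B := by
    have h1 : ExpBd d1 (mB / 2) C' B := PtBd.expBd (s := mB / 2) (wt := weight L n) hdist.symm hCB
      (by rw [add_halves]; exact hPB1) fun u => sum_weight_exp_le (half_pos hmB) u
    exact h1.mono hm₂B le_rfl hdist.nonneg
  have hRE2 : ExpBd d1 m₂ C₁ R := hRE.mono hm₂1 le_rfl hdist.nonneg
  have hRP2 : PtBd d1 m₂ (C₁ * weight L n) (R ^ 3) :=
    hRP.mono hm₂1 le_rfl (by positivity) hdist.nonneg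
  set E : Matrix (Lat L t s n) (Lat L t s n) ℂ := R - R * B with hE
  have hEE : ExpBd d1 m₂ CE E := hRE2.sub (hRE2.mul hm₂0.le hC₁ hC'0 hdist.tri hEB)
  have hE3 : PtBd d1 m₂ (C₂ * weight L n) (E ^ 3) := by
    have h1 := ptBd_cube_sub_mul hdist hm₂0.le hC₁ (by positivity) hCE0 hRE2 hRP2 hPB2 hEE
    convert h1 using 1
    rw [hC₂]; ring
  have hR' : (1 + D) * R = 1 := mul_eq_one_comm.1 hR
  have hRK : 1 - E = R * (D + B) := by
    have : R * D = 1 - R := by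
      rw [mul_add, mul_one] at hR
      exact eq_sub_of_add_eq' hR
    rw [mul_add, this, hE]
    abel
  have hKfac : D + B = (1 + D) * (1 - E) := by
    rw [hRK, ← mul_assoc, hR', one_mul]
  -- With y = (1 - E) x one has (D + B) x = (1 + D) y and therefore (D + B)(x - y) = (1 - B) y. The
  -- large operator D has disappeared from the right-hand side, so the lower bound for D + B
  -- estimates x - y, and with it x, by y uniformly.
  have hlow1 : ∀ x, c * l2 x ≤ l2 ((1 - E).mulVec x) := by
    intro x
    set y := (1 - E).mulVec x with hy
    have hKx : (D + B).mulVec x = (1 + D).mulVec y := by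
      rw [hy, Matrix.mulVec_mulVec, ← hKfac]
    have hdiff : (D + B).mulVec (x - y) = (1 - B).mulVec y := by
      rw [Matrix.mulVec_sub, hKx, ← Matrix.sub_mulVec]
      congr 1
      abel
    have h1 : l2 (x - y) ≤ CK * l2 ((D + B).mulVec (x - y)) := by
      have := hlow L hL hL2 t s n v w hvw d hd hd' (x - y)
      rw [← hD] at this
      exact this
    have h2 : l2 ((1 - B).mulVec y) ≤ (1 + C') * l2 y :=
      ((ExpBd.one hdist m₂).sub hEB).l2_mulVec_le hm₂0.le (by positivity) hdist.nonneg y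
    have h3 : l2 x ≤ l2 y + l2 (x - y) := by
      have := l2_add_le y (x - y)
      rwa [add_sub_cancel] at this
    have h4 : l2 x ≤ (1 + CK * (1 + C')) * l2 y := by
      rw [hdiff] at h1
      have := mul_le_mul_of_nonneg_left h2 hCK.le
      linarith
    rw [hc, inv_mul_le_iff₀ (by positivity)]
    exact h4
  obtain ⟨hu, hinv⟩ := hcore d1 (weight L n) E hdist hwt
    (fun σ hσ u => sum_weight_exp_le hσ u) hEE hE3 hlow1
  have hudet := (Matrix.isUnit_iff_isUnit_det _).1 hu
  have hKinv : (D + B)⁻¹ = (1 - E)⁻¹ * R := by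
    refine Matrix.inv_eq_left_inv ?_
    rw [mul_assoc, ← hRK, Matrix.nonsing_inv_mul _ hudet]
  refine ⟨?_, ?_⟩
  · rw [hKfac]
    exact (IsUnit.of_mul_eq_one R hR').mul hu
  · rw [hKinv]
    exact hinv.mul hm.le hC hC₁ hdist.tri (hRE2.mono hmm le_rfl hdist.nonneg)

variable {h : (Fin 3 → ℤ) → ℂ} {hhat : (Fin 3 → ℂ) → ℂ}

/-- The transpose of D_n has the conjugate symbol and the transposed resolvent, so both cases
satisfy the hypotheses of `exists_expBd_inv` with the same constants. -/
theorem IsHamiltonian.exists_green (H : IsHamiltonian h hhat) {q : ℕ} (hq : 1 ≤ q) {a : ℝ}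
    (ha : 0 < a) :
    ∃ m Γ : ℝ, 0 < m ∧ 0 ≤ Γ ∧ ∀ (L : ℕ) [NeZero L], Odd L → 2 ≤ (L : ℝ) →
      ∀ (t s n : ℕ) (v w : Lat L t s 0 × Bdual L n → ℂ), SymPair q v w →
      ∀ D, D = Dn L t s h n ∨ D = (Dn L t s h n).transpose →
        IsUnit (D + ((weight L n : ℝ) : ℂ)⁻¹ • (coarse v).conjTranspose *
          fQ L q t s a n * coarse w) ∧
        ExpBd d1 m Γ (D + ((weight L n : ℝ) : ℂ)⁻¹ • (coarse v).conjTranspose *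
          fQ L q t s a n * coarse w)⁻¹ := by
  obtain ⟨c₀, hc₀, hlow⟩ := H.exists_dSym_lower
  obtain ⟨m₁, C₁, hm₁, hC₁, hres⟩ := H.exists_resolv_bounds
  obtain ⟨m, Γ, hm, hΓ, hmain⟩ := exists_expBd_inv hq ha hc₀ hm₁ hC₁
  refine ⟨m, Γ, hm, hΓ, ?_⟩
  intro L _ hL hL2 t s n v w hvw D hD
  obtain ⟨hE, hP⟩ := hres L t s n
  have hsymm : ∀ u v : Lat L t s n, d1 u v = d1 v u := isDist_d1.symm
  rcases hD with rfl | rfl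
  · exact hmain L hL hL2 t s n v w hvw _ (fun i => H.dSym_re_nonneg _)
      (fun κ l hl => hlow L hL t s n κ l hl) _ _ (H.Dn_eq_mulMat isLabel_labPair) H.resolv_mul hE hP
  · refine hmain L hL hL2 t s n v w hvw _ (fun i => ?_) (fun κ l hl => ?_) _
      (resolv hhat L t s n).transpose (H.Dn_transpose_eq_mulMat isLabel_labPair) ?_
      (hE.transpose hsymm) ?_
    · change 0 ≤ ((starRingEnd ℂ) _).re
      rw [Complex.conj_re]
      exact H.dSym_re_nonneg _
    · rw [norm_star]
      exact hlow L hL t s n κ l hl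
    · rw [← Matrix.transpose_one, ← Matrix.transpose_add, ← Matrix.transpose_mul,
        mul_eq_one_comm.1 H.resolv_mul]
    · rw [← Matrix.transpose_pow]
      intro u v
      rw [hsymm u v]
      exact hP v u

end

end PBS

theorem mainTheorem1 (q : ℕ) (hq : 4 ≤ q) (hq_even : Even q) :
    ∃ Γ₂ : ℝ, ∀ (a : ℝ) (h : (Fin 3 → ℤ) → ℂ) (hhat : (Fin 3 → ℂ) → ℂ),
      0 < a → PBS.IsHamiltonian h hhat →
      ∃ μup m₃ Γ₁₁ : ℝ, 0 < μup ∧ 0 < m₃ ∧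
        ∀ (L : ℕ) [NeZero L], Odd L → Γ₂ < (L : ℝ) →
        ∀ (n t s : ℕ) (μ : ℂ), ‖μ‖ ≤ μup →
          (IsUnit (PBS.K L q t s a h n μ) ∧
            PBS.expNorm m₃ (PBS.K L q t s a h n μ)⁻¹ ≤ Γ₁₁ ∧
            PBS.expNorm m₃ ((PBS.K L q t s a h n μ)⁻¹ - (PBS.K L q t s a h n 0)⁻¹)
              ≤ ‖μ‖ * Γ₁₁) ∧
          ∀ ν : Fin 4,
            (IsUnit (PBS.KPlus L q t s a h n ν μ) ∧
              PBS.expNorm m₃ (PBS.KPlus L q t s a h n ν μ)⁻¹ ≤ Γ₁₁ ∧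
              PBS.expNorm m₃ ((PBS.KPlus L q t s a h n ν μ)⁻¹ - (PBS.KPlus L q t s a h n ν 0)⁻¹)
                ≤ ‖μ‖ * Γ₁₁) ∧
            (IsUnit (PBS.KMinus L q t s a h n ν μ) ∧
              PBS.expNorm m₃ (PBS.KMinus L q t s a h n ν μ)⁻¹ ≤ Γ₁₁ ∧
              PBS.expNorm m₃ ((PBS.KMinus L q t s a h n ν μ)⁻¹ - (PBS.KMinus L q t s a h n ν 0)⁻¹)
                ≤ ‖μ‖ * Γ₁₁) := by
  -- The size of L matters only for ∑_{j≥1} L^(-2j) ≤ 1 in the bounds on 𝔔_n.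
  refine ⟨2, fun a h hhat ha H => ?_⟩
  obtain ⟨m, Γ, hm, hΓ, hgreen⟩ := H.exists_green (q := q) (by omega) ha
  -- The radius makes ‖μ‖ Γ ≤ 1/2; the constant is the sum of the bounds 2 Γ for the inverse and 2
  -- Γ² for the difference quotient.
  refine ⟨1 / (2 * (Γ + 1)), m, 2 * Γ + 2 * Γ * Γ, by positivity, hm, ?_⟩
  intro L _ hL hL2 n t s μ hμ
  have hμΓ : ‖μ‖ * Γ ≤ 1 / 2 := by
    calc ‖μ‖ * Γ ≤ 1 / (2 * (Γ + 1)) * (Γ + 1) := by gcongr; linarith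
      _ = 1 / 2 := by field_simp
  have key : ∀ A : Matrix (PBS.Lat L t s n) (PBS.Lat L t s n) ℂ,
      IsUnit A ∧ PBS.ExpBd PBS.d1 m Γ A⁻¹ →
      IsUnit (A - μ • 1) ∧ PBS.expNorm m (A - μ • 1)⁻¹ ≤ 2 * Γ + 2 * Γ * Γ ∧
        PBS.expNorm m ((A - μ • 1)⁻¹ - (A - (0 : ℂ) • 1)⁻¹) ≤ ‖μ‖ * (2 * Γ + 2 * Γ * Γ) := by
    rintro A ⟨hA, hb⟩
    obtain ⟨h1, h2, h3⟩ := hb.inv_sub_smul_one PBS.isDist_d1 hm.le hΓ hA hμΓ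
    have hΓ2 : 0 ≤ Γ * Γ := by positivity
    refine ⟨h1, (PBS.expNorm_le hm.le h2).trans (by linarith), ?_⟩
    rw [zero_smul, sub_zero]
    refine (PBS.expNorm_le hm.le h3).trans ?_
    gcongr
    linarith
  refine ⟨?_, fun ν => ⟨?_, ?_⟩⟩
  · have h1 := key _ (hgreen L hL hL2.le t s n _ _ (PBS.symPair_symQ hL (by omega)) _ (Or.inl rfl))
    rw [← PBS.QnStar_eq_coarse hL, ← PBS.Qn_eq_coarse hL] at h1
    exact h1
  · have h1 := key _ (hgreen L hL hL2.le t s n _ _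
      (PBS.symPair_symPlus_symMinus hL (by omega) ν) _ (Or.inr rfl))
    rw [← PBS.QnPlus_eq_coarse, ← PBS.QnMinus_eq_coarse] at h1
    exact h1
  · have h1 := key _ (hgreen L hL hL2.le t s n _ _
      (PBS.symPair_symPlus_symMinus hL (by omega) ν) _ (Or.inl rfl))
    rw [← PBS.QnPlus_eq_coarse, ← PBS.QnMinus_eq_coarse] at h1
    exact h1
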